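/- Let $n,k\ge 1$, let $m=(m_1,\dots,m_n)$ be positive integers and $0\le n_0\le n$ with $m_a\le k-1$ for $a\le n_0$ and $m_a>k-1$ for $a>n_0$; let $z_1,\dots,z_n\in\mathbb C$ be distinct and $\kappa\in\mathbb C^\times$. On $\mathbb C^k$ put $$\omega_a=\sum_{1\le i<l\le k}\frac{2}{\kappa}\,d\log(t_i-t_l)-\sum_{i=1}^k\sum_{b=1}^n\frac{m_b}{\kappa}\,d\log(t_i-z_b).$$ Let $\mathbf j=\{j_1<\dots<j_p\}\subset\{1,\dots,n_0\}$, $p\ge1$, $s=\sum_{a\in\mathbf j}(m_a+1)\le k$ and $e=k-s$. For a family $\mathbf I=\{I_a\}_{a\in\mathbf j}$ of disjoint subsets of $\{1,\dots,k\}$ with $|I_a|=m_a+1$, let $C_{\mathbf I}$ be the corresponding stratum of the weighted blow-up manifold of this arrangement (obtained from the minimal resolution of the arrangement in $\mathbb C^k$ by deleting the components of the divisor which belong to nonresonant dense edges). It is the complement in $\prod_{a\in\mathbf j}\mathbb P^{m_a}\times\mathbb C^{e}$, with homogeneous coordinates $x_i$ ($i\in I_a$) on $\mathbb P^{m_a}$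 and coordinates $t_i$ ($i\notin\bigcup_a I_a$) on $\mathbb C^e$, of the hyperplanes $x_i=0$, $x_i=x_l$ ($i,l\in I_a$) and $t_i=t_l$, $t_i=z_b$. Near $C_{\mathbf I}$ the resolution is the product of the blow-ups of $\mathbb C^{I_a}$ at the points $(z_a,\dots,z_a)$ and of $\mathbb C^e$. The pull-back of $\omega_a$ to the resolution is regular along the strata; let $\tilde\omega_a$ be its restriction to $\bigcup_{\mathbf I}C_{\mathbf I}$. Let $A^q(C_{\mathbf I})$ be the span of the $q$-fold exterior products of the logarithmic forms $d\log(g_1/g_2)$ ($g_1,g_2$ among the forms $x_i$, $x_i-x_l$ with $i,l\in I_a$, for one $a$), $d\log(t_i-t_l)$, $d\log(t_i-z_b)$, and let $A^q_-=A^q_-(\bigcup_{\mathbf I}C_{\mathbf I})\subset\bigoplus_{\mathbf I}A^q(C_{\mathbf I})$ be the space of the forms which are skew-symmetric under $S_k$. For $I=\{i_0<\dots<i_r\}$ let $\mu_I=d\log(x_{i_1}/x_{i_0})\wedge\dots\wedge d\log(x_{i_r}/x_{i_0})$. Let $I^0_{j_1},\dots,I^0_{j_p}$ be the consecutive segments of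 lengths $m_{j_1}+1,\dots,m_{j_p}+1$ of $\{1,\dots,s\}$. For $K\in\mathbb Z_{\ge0}^n$ with $|K|\in\{e,e-1\}$ let $\eta_{K,b}$ be the product, in increasing order of $q$, of the forms $d\log(t_q-z_b)$ for $s+k_1+\dots+k_{b-1}<q\le s+k_1+\dots+k_b$, let $$\alpha_K=(-1)^{\sum_{i=1}^{p-1}i(m_{j_i}+1)}\Bigl(\prod_{a\in\mathbf j}(m_a+1)!\prod_{b=1}^n k_b!\Bigr)^{-1},$$ and let $\theta_K$ be the form $\alpha_K\,\mu_{I^0_{j_1}}\wedge\dots\wedge\mu_{I^0_{j_p}}\wedge\eta_{K,1}\wedge\dots\wedge\eta_{K,n}$ on $C_{\mathbf I^0}$, extended by zero to the other strata. Put $\omega_K=\sum_{\sigma\in S_k}(-1)^{|\sigma|}\sigma(\kappa^{-k}\theta_K)$ if $|K|=e$ and $\omega_K=\sum_{\sigma\in S_k}(-1)^{|\sigma|}\sigma((-1)^{k-p}\kappa^{-(k-1)}\theta_K)$ if $|K|=e-1$. Let $m^{\mathbf j}_a=-m_a-2$ for $a\in\mathbf j$ and $m^{\mathbf j}_a=m_a$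 otherwise. Let $M_c$ be the Verma module of $\mathfrak{sl}_2$ with highest weight $c$ and highest weight vector $v_c$, let $(\bigotimes_aM_{m^{\mathbf j}_a})^*$ be the restricted dual with the contragradient structure ($e$ and $f$ act by the transposes of $f$ and $e$), and let $\phi^K=\phi^{k_1}\otimes\dots\otimes\phi^{k_n}$ be its basis dual to the basis $f^{k_1}v_{m_1^{\mathbf j}}\otimes\dots\otimes f^{k_n}v_{m_n^{\mathbf j}}$. Let $\mathfrak n_-=\mathbb Cf$ and $|m|=m_1+\dots+m_n$. Then exterior multiplication $\eta\mapsto\tilde\omega_a\wedge\eta$ defines a complex $A^{k-p-1}_-\to A^{k-p}_-$. The forms $\omega_K$ with $|K|=e-1$ are a basis of its first term, and those with $|K|=e$ are a basis of its second term. The complex is isomorphic to the component of weight $|m|-2k$ of the complex $\mathfrak n_-\otimes(\bigotimes_aM_{m^{\mathbf j}_a})^*\to(\bigotimes_aM_{m^{\mathbf j}_a})^*$, $f\otimes v\mapsto fv$, i.e. to $$\mathfrak n_-\otimes\Bigl(\bigotimes_aM_{m^{\mathbf j}_a}\Bigr)^*[|m|-2k+2]\to\Bigl(\bigotimes_aM_{m^{\mathbf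 j}_a}\Bigr)^*[|m|-2k],$$ by an isomorphism which sends $\omega_K$ to $f\otimes\phi^K$ if $|K|=e-1$ and to $\phi^K$ if $|K|=e$. -/

import Mathlib

open scoped TensorProduct Topology

noncomputable section

/-! ### `sl₂`-modules: Verma modules, tensor products, restricted duals -/

/-- An `sl₂`-module structure on a complex vector space `V`, given by the action of the standard
basis `e, f, h` with `[e,f] = h`, `[h,e] = 2e`, `[h,f] = -2f`. -/
structure Sl2Module (V : Type*) [AddCommGroup V] [Module ℂ V] where
  e : Module.End ℂ V
  f : Module.End ℂ V
  h : Module.End ℂ V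
  lie_e_f : ⁅e, f⁆ = h
  lie_h_e : ⁅h, e⁆ = (2 : ℂ) • e
  lie_h_f : ⁅h, f⁆ = -((2 : ℂ) • f)

namespace Sl2Module

section General

variable {V : Type*} [AddCommGroup V] [Module ℂ V]

/-- The weight space `V[c] = {v | h v = c v}`. -/
def weightSpace (M : Sl2Module V) (c : ℂ) : Submodule ℂ V where
  carrier := {v | M.h v = c • v}
  add_mem' := by
    intro a b ha hb
    simp only [Set.mem_ofPred_eq] at ha hb ⊢
    rw [map_add, ha, hb, smul_add]
  zero_mem' := by simp
  smul_mem' := by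
    intro r a ha
    simp only [Set.mem_ofPred_eq] at ha ⊢
    rw [map_smul, ha, smul_comm]

theorem h_e_apply (M : Sl2Module V) (v : V) : M.h (M.e v) = M.e (M.h v) + (2 : ℂ) • M.e v := by
  have := LinearMap.congr_fun M.lie_h_e v
  simp only [Ring.lie_def, LinearMap.sub_apply, Module.End.mul_apply, LinearMap.smul_apply] at this
  rw [← this]; abel

theorem h_f_apply (M : Sl2Module V) (v : V) : M.h (M.f v) = M.f (M.h v) - (2 : ℂ) • M.f v := by
  have := LinearMap.congr_fun M.lie_h_f v
  simp only [Ring.lie_def, LinearMap.sub_apply, Module.End.mul_apply, LinearMap.smul_apply,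
    LinearMap.neg_apply] at this
  rw [sub_eq_add_neg, ← this]; abel

theorem e_mem_weightSpace (M : Sl2Module V) {c : ℂ} {v : V} (hv : v ∈ M.weightSpace c) :
    M.e v ∈ M.weightSpace (c + 2) := by
  have hv' : M.h v = c • v := hv
  change M.h (M.e v) = (c + 2) • M.e v
  rw [h_e_apply, hv', map_smul, add_smul]

theorem f_mem_weightSpace (M : Sl2Module V) {c : ℂ} {v : V} (hv : v ∈ M.weightSpace c) :
    M.f v ∈ M.weightSpace (c - 2) := by
  have hv' : M.h v = c • v := hv
  change M.h (M.f v) = (c - 2) • M.f v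
  rw [h_f_apply, hv', map_smul, sub_smul]

theorem h_mem_weightSpace (M : Sl2Module V) {c : ℂ} {v : V} (hv : v ∈ M.weightSpace c) :
    M.h v ∈ M.weightSpace c := by
  have hv' : M.h v = c • v := hv
  rw [hv']; exact Submodule.smul_mem _ _ hv

/-- The space `V[c]^*`, embedded in `Hom(V, ℂ)` as the functionals which vanish on all the other
weight spaces. -/
def dualWeight (M : Sl2Module V) (c : ℂ) : Submodule ℂ (Module.Dual ℂ V) where
  carrier := {φ | ∀ c' : ℂ, c' ≠ c → ∀ v ∈ M.weightSpace c', φ v = 0}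
  add_mem' := by
    intro a b ha hb c' hc v hv
    rw [LinearMap.add_apply, ha c' hc v hv, hb c' hc v hv, add_zero]
  zero_mem' := by intro c' _ v _; rfl
  smul_mem' := by
    intro r a ha c' hc v hv
    rw [LinearMap.smul_apply, ha c' hc v hv, smul_zero]

/-- The restricted dual `V^* = ⨁_c V[c]^*`. -/
def restrictedDual (M : Sl2Module V) : Submodule ℂ (Module.Dual ℂ V) :=
  ⨆ c : ℂ, M.dualWeight c

/-- A functional in the restricted dual stays there after composition with an operator of
weight `d`. -/
theorem comp_mem_restrictedDual (M : Sl2Module V) (T : Module.End ℂ V) (d : ℂ)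
    (hT : ∀ c v, v ∈ M.weightSpace c → T v ∈ M.weightSpace (c + d))
    {φ : Module.Dual ℂ V} (hφ : φ ∈ M.restrictedDual) : φ ∘ₗ T ∈ M.restrictedDual := by
  have key : M.restrictedDual ≤ M.restrictedDual.comap (LinearMap.lcomp ℂ ℂ T) := by
    refine iSup_le fun c ψ hψ => ?_
    refine Submodule.mem_iSup_of_mem (c - d) ?_
    intro c' hc v hv
    exact hψ (c' + d) (fun h => hc (by rw [← h]; ring)) (T v) (hT c' v hv)
  exact key hφ

/-- Transposition of an operator of weight `d`, on the restricted dual. -/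
def transposeOn (M : Sl2Module V) (T : Module.End ℂ V) (d : ℂ)
    (hT : ∀ c v, v ∈ M.weightSpace c → T v ∈ M.weightSpace (c + d)) :
    Module.End ℂ M.restrictedDual where
  toFun φ := ⟨(φ : Module.Dual ℂ V) ∘ₗ T, M.comp_mem_restrictedDual T d hT φ.2⟩
  map_add' _ _ := rfl
  map_smul' _ _ := rfl

/-- The contragradient module structure on the restricted dual:
`⟨eφ, v⟩ = ⟨φ, fv⟩`, `⟨fφ, v⟩ = ⟨φ, ev⟩`, `⟨hφ, v⟩ = ⟨φ, hv⟩`. -/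
def contragradient (M : Sl2Module V) : Sl2Module M.restrictedDual where
  e := M.transposeOn M.f (-2) fun c v hv => by
    rw [← sub_eq_add_neg]; exact M.f_mem_weightSpace hv
  f := M.transposeOn M.e 2 fun c v hv => M.e_mem_weightSpace hv
  h := M.transposeOn M.h 0 fun c v hv => by rw [add_zero]; exact M.h_mem_weightSpace hv
  lie_e_f := by
    ext φ v
    have := LinearMap.congr_fun M.lie_e_f v
    simp only [Ring.lie_def, LinearMap.sub_apply, Module.End.mul_apply] at this
    change (φ : Module.Dual ℂ V) (M.e (M.f v)) - (φ : Module.Dual ℂ V) (M.f (M.e v))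
      = (φ : Module.Dual ℂ V) (M.h v)
    rw [← map_sub, this]
  lie_h_e := by
    ext φ v
    change (φ : Module.Dual ℂ V) (M.f (M.h v)) - (φ : Module.Dual ℂ V) (M.h (M.f v))
      = (2 : ℂ) • (φ : Module.Dual ℂ V) (M.f v)
    rw [← map_sub, ← map_smul, h_f_apply, sub_sub_cancel]
  lie_h_f := by
    ext φ v
    change (φ : Module.Dual ℂ V) (M.e (M.h v)) - (φ : Module.Dual ℂ V) (M.h (M.e v))
      = -((2 : ℂ) • (φ : Module.Dual ℂ V) (M.e v))
    rw [← map_sub, ← map_smul, ← map_neg, h_e_apply, sub_add_cancel_left]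

/-- The action of a traceless `2 × 2` matrix `x = x₀₁ e + x₁₀ f + x₀₀ h`. -/
def act (M : Sl2Module V) : Matrix (Fin 2) (Fin 2) ℂ →ₗ[ℂ] Module.End ℂ V where
  toFun x := x 0 1 • M.e + x 1 0 • M.f + x 0 0 • M.h
  map_add' x y := by simp only [Matrix.add_apply, add_smul]; abel
  map_smul' r x := by simp only [Matrix.smul_apply, smul_eq_mul, mul_smul, smul_add, RingHom.id_apply]

end General

/-- The matrix of the basis element `f` of `sl₂`. -/
def matF : Matrix (Fin 2) (Fin 2) ℂ := !![0, 0; 1, 0]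

/-- The subalgebra `𝔫₋ = ℂ f` of `sl₂`. -/
def nMinus : Submodule ℂ (Matrix (Fin 2) (Fin 2) ℂ) := Submodule.span ℂ {matF}

/-- The basis element `f` of `𝔫₋`. -/
def nMinusF : nMinus := ⟨matF, Submodule.mem_span_singleton_self _⟩

section Complex

variable {V : Type*} [AddCommGroup V] [Module ℂ V]

theorem act_nMinus_mem (M : Sl2Module V) (c : ℂ) (x : nMinus) (v : M.weightSpace (c + 2)) :
    M.act (x : Matrix (Fin 2) (Fin 2) ℂ) (v : V) ∈ M.weightSpace c := by
  obtain ⟨r, hr⟩ := Submodule.mem_span_singleton.1 x.2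
  have hv := M.f_mem_weightSpace v.2
  rw [add_sub_cancel_right] at hv
  rw [← hr, map_smul]
  refine Submodule.smul_mem _ r ?_
  simpa [act, matF] using hv

/-- The only nonzero map of the weight component `C_•(𝔫₋, V)[c]` of the standard complex,
`𝔫₋ ⊗ V[c + 2] → V[c]`, `x ⊗ v ↦ x v`. -/
def nMinusMap (M : Sl2Module V) (c : ℂ) :
    nMinus ⊗[ℂ] M.weightSpace (c + 2) →ₗ[ℂ] M.weightSpace c :=
  TensorProduct.lift (LinearMap.mk₂ ℂ
    (fun x v => ⟨M.act (x : Matrix (Fin 2) (Fin 2) ℂ) (v : V), M.act_nMinus_mem c x v⟩)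
    (fun x y v => Subtype.ext (by simp))
    (fun r x v => Subtype.ext (by simp))
    (fun x v w => Subtype.ext (by simp))
    (fun r x v => Subtype.ext (by simp)))

end Complex

/-- The Verma module of highest weight `m`; `Finsupp.single j 1` is the basis vector `f^j v_m`. -/
def verma (m : ℂ) : Sl2Module (ℕ →₀ ℂ) where
  e := Finsupp.linearCombination ℂ fun j : ℕ => Finsupp.single (j - 1) ((j : ℂ) * (m - j + 1))
  f := Finsupp.linearCombination ℂ fun j : ℕ => Finsupp.single (j + 1) (1 : ℂ)
  h := Finsupp.linearCombination ℂ fun j : ℕ => Finsupp.single j (m - 2 * j)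
  lie_e_f := by
    refine Finsupp.lhom_ext' fun j => LinearMap.ext_ring ?_
    ext i
    rcases j with _ | j
    · simp +contextual [Ring.lie_def, Finsupp.linearCombination_single, Finsupp.single_apply]
    · simp only [Ring.lie_def, LinearMap.comp_apply, LinearMap.sub_apply, Module.End.mul_apply,
        Finsupp.lsingle_apply, Finsupp.linearCombination_single, one_smul, Finsupp.smul_single,
        smul_eq_mul, Finsupp.sub_apply, Nat.add_sub_cancel, Finsupp.single_apply, mul_one]
      push_cast
      split_ifs <;> ring
  lie_h_e := by
    refine Finsupp.lhom_ext' fun j => LinearMap.ext_ring ?_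
    ext i
    rcases j with _ | j
    · simp [Ring.lie_def, Finsupp.linearCombination_single]
    · simp only [Ring.lie_def, LinearMap.comp_apply, LinearMap.sub_apply, Module.End.mul_apply,
        Finsupp.lsingle_apply, Finsupp.linearCombination_single, one_smul, Finsupp.smul_single,
        smul_eq_mul, Finsupp.sub_apply, Nat.add_sub_cancel, Finsupp.single_apply,
        LinearMap.smul_apply]
      push_cast
      split_ifs <;> ring
  lie_h_f := by
    refine Finsupp.lhom_ext' fun j => LinearMap.ext_ring ?_
    ext i
    simp only [Ring.lie_def, LinearMap.comp_apply, LinearMap.sub_apply, Module.End.mul_apply,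
      Finsupp.lsingle_apply, Finsupp.linearCombination_single, one_smul, Finsupp.smul_single,
      smul_eq_mul, Finsupp.sub_apply, Finsupp.single_apply, mul_one, LinearMap.neg_apply,
      LinearMap.smul_apply, Finsupp.neg_apply]
    push_cast
    split_ifs <;> ring

section Tensor

variable {n : ℕ} {W : Fin n → Type*} [∀ i, AddCommGroup (W i)] [∀ i, Module ℂ (W i)]

/-- The operator `1 ⊗ ⋯ ⊗ T ⊗ ⋯ ⊗ 1` with `T` at the place `a`. -/
def atPlace (a : Fin n) (T : Module.End ℂ (W a)) : Module.End ℂ (⨂[ℂ] i, W i) :=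
  PiTensorProduct.map (Function.update (fun _ => LinearMap.id) a T)

/-- The operator `∑_a 1 ⊗ ⋯ ⊗ T_a ⊗ ⋯ ⊗ 1`. -/
def sumPlaces (T : ∀ i, Module.End ℂ (W i)) : Module.End ℂ (⨂[ℂ] i, W i) :=
  ∑ a, atPlace a (T a)

theorem atPlace_tprod (a : Fin n) (T : Module.End ℂ (W a)) (v : ∀ i, W i) :
    atPlace a T (PiTensorProduct.tprod ℂ v)
      = PiTensorProduct.tprod ℂ (Function.update v a (T (v a))) := by
  rw [atPlace, PiTensorProduct.map_tprod]
  congr 1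
  funext i
  by_cases hi : i = a
  · subst hi; simp
  · simp [hi]

theorem lie_atPlace_same (a : Fin n) (S T : Module.End ℂ (W a)) :
    ⁅atPlace (W := W) a S, atPlace a T⁆ = atPlace a ⁅S, T⁆ := by
  apply PiTensorProduct.ext
  ext v
  simp [Ring.lie_def, atPlace_tprod, Function.update_idem, MultilinearMap.map_update_sub]

theorem lie_atPlace_ne {a b : Fin n} (hab : a ≠ b) (S : Module.End ℂ (W a))
    (T : Module.End ℂ (W b)) : ⁅atPlace (W := W) a S, atPlace b T⁆ = 0 := by
  apply PiTensorProduct.ext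
  ext v
  simp [Ring.lie_def, atPlace_tprod, Function.update_of_ne hab, Function.update_of_ne hab.symm,
    Function.update_comm hab]

theorem lie_sumPlaces (S T : ∀ i, Module.End ℂ (W i)) :
    ⁅sumPlaces S, sumPlaces T⁆ = sumPlaces fun i => ⁅S i, T i⁆ := by
  have key : ∀ a b : Fin n, ⁅atPlace a (S a), atPlace b (T b)⁆
      = if a = b then atPlace (W := W) a ⁅S a, T a⁆ else 0 := by
    intro a b
    split_ifs with hab
    · subst hab; exact lie_atPlace_same a _ _
    · exact lie_atPlace_ne hab _ _
  simp only [Ring.lie_def] at key ⊢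
  simp only [sumPlaces, Finset.sum_mul_sum]
  rw [Finset.sum_comm (f := fun i j => atPlace i (T i) * atPlace j (S j)),
    ← Finset.sum_sub_distrib]
  refine Finset.sum_congr rfl fun a _ => ?_
  rw [← Finset.sum_sub_distrib, Finset.sum_congr rfl fun b _ => key a b]
  simp

theorem sumPlaces_smul (r : ℂ) (T : ∀ i, Module.End ℂ (W i)) :
    sumPlaces (fun i => r • T i) = r • sumPlaces T := by
  simp only [sumPlaces, Finset.smul_sum]
  refine Finset.sum_congr rfl fun a _ => ?_
  exact PiTensorProduct.map_update_smul _ a r (T a)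

/-- The tensor product of `sl₂`-modules. -/
def tensor (M : ∀ i, Sl2Module (W i)) : Sl2Module (⨂[ℂ] i, W i) where
  e := sumPlaces fun i => (M i).e
  f := sumPlaces fun i => (M i).f
  h := sumPlaces fun i => (M i).h
  lie_e_f := by rw [lie_sumPlaces]; simp only [lie_e_f]
  lie_h_e := by rw [lie_sumPlaces, ← sumPlaces_smul]; simp only [lie_h_e]
  lie_h_f := by
    have h : ∀ i, ⁅(M i).h, (M i).f⁆ = (-2 : ℂ) • (M i).f := fun i => by
      rw [(M i).lie_h_f]; module
    rw [lie_sumPlaces]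
    simp only [h, sumPlaces_smul]
    module

end Tensor

/-- The tensor product `M_{w_1} ⊗ ⋯ ⊗ M_{w_n}` of Verma modules. -/
def vermaTensor {n : ℕ} (w : Fin n → ℂ) : Sl2Module (⨂[ℂ] _i : Fin n, (ℕ →₀ ℂ)) :=
  tensor fun i => verma (w i)

/-- The functional `φ^K = φ^{k_1} ⊗ ⋯ ⊗ φ^{k_n}` of the basis dual to
`f^{k_1} v ⊗ ⋯ ⊗ f^{k_n} v`: it sends `x_1 ⊗ ⋯ ⊗ x_n` to the product of the `f^{k_i} v`-coordinates
of the `x_i`. -/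
def phiFunctional {n : ℕ} (K : Fin n → ℕ) : Module.Dual ℂ (⨂[ℂ] _i : Fin n, (ℕ →₀ ℂ)) :=
  PiTensorProduct.lift
    ((MultilinearMap.mkPiAlgebra ℂ (Fin n) ℂ).compLinearMap fun i => Finsupp.lapply (K i))

theorem phiFunctional_h {n : ℕ} (w : Fin n → ℂ) (K : Fin n → ℕ) :
    phiFunctional K ∘ₗ (vermaTensor w).h
      = ((∑ i, w i) - 2 * ((∑ i, K i : ℕ) : ℂ)) • phiFunctional K := by
  have hcoord : ∀ (m : ℂ) (j : ℕ) (x : ℕ →₀ ℂ), (verma m).h x j = (m - 2 * j) * x j := by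
    intro m j x
    have : Finsupp.lapply j ∘ₗ (verma m).h = (m - 2 * j) • Finsupp.lapply (R := ℂ) j := by
      refine Finsupp.lhom_ext' fun i => LinearMap.ext_ring ?_
      by_cases hij : i = j
      · subst hij; simp [verma]
      · simp [verma, hij]
    simpa using LinearMap.congr_fun this x
  apply PiTensorProduct.ext
  ext v
  have hsum : ((∑ i, w i) - 2 * ((∑ i, K i : ℕ) : ℂ)) = ∑ i, (w i - 2 * (K i : ℂ)) := by
    rw [Finset.sum_sub_distrib, ← Finset.mul_sum]; push_cast; rfl
  simp only [LinearMap.compMultilinearMap_apply, LinearMap.comp_apply, LinearMap.smul_apply,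
    vermaTensor, tensor, sumPlaces, LinearMap.sum_apply, atPlace_tprod, map_sum, phiFunctional,
    PiTensorProduct.lift.tprod, MultilinearMap.compLinearMap_apply, MultilinearMap.mkPiAlgebra_apply,
    Finsupp.lapply_apply, smul_eq_mul, hsum, Finset.sum_mul]
  refine Finset.sum_congr rfl fun a _ => ?_
  rw [← Finset.mul_prod_erase _ _ (Finset.mem_univ a),
    ← Finset.mul_prod_erase (Finset.univ) (fun i => v i (K i)) (Finset.mem_univ a), ← mul_assoc,
    Function.update_self, hcoord]
  congr 1
  refine Finset.prod_congr rfl fun i hi => ?_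
  rw [Function.update_of_ne (Finset.ne_of_mem_erase hi)]

theorem phiFunctional_mem {n : ℕ} (w : Fin n → ℂ) (K : Fin n → ℕ) :
    phiFunctional K ∈ (vermaTensor w).restrictedDual := by
  refine Submodule.mem_iSup_of_mem ((∑ i, w i) - 2 * ((∑ i, K i : ℕ) : ℂ)) ?_
  intro c hc v hv
  have h1 := LinearMap.congr_fun (phiFunctional_h w K) v
  have hv' : (vermaTensor w).h v = c • v := hv
  rw [LinearMap.comp_apply, hv', map_smul, LinearMap.smul_apply, smul_eq_mul, smul_eq_mul] at h1
  have h2 : (c - ((∑ i, w i) - 2 * ((∑ i, K i : ℕ) : ℂ))) * phiFunctional K v = 0 := by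
    rw [sub_mul, h1, sub_self]
  exact (mul_eq_zero.1 h2).resolve_left (sub_ne_zero.2 hc)

/-- `(M_{w_1} ⊗ ⋯ ⊗ M_{w_n})^*`, the restricted dual with its contragradient structure. -/
def vermaTensorDual {n : ℕ} (w : Fin n → ℂ) : Sl2Module (vermaTensor w).restrictedDual :=
  (vermaTensor w).contragradient

/-- `φ^K` as an element of the restricted dual. -/
def phi {n : ℕ} (w : Fin n → ℂ) (K : Fin n → ℕ) : (vermaTensor w).restrictedDual :=
  ⟨phiFunctional K, phiFunctional_mem w K⟩

theorem phi_mem_weightSpace {n : ℕ} (w : Fin n → ℂ) (K : Fin n → ℕ) (c : ℂ)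
    (hc : c = (∑ i, w i) - 2 * ((∑ i, K i : ℕ) : ℂ)) :
    phi w K ∈ (vermaTensorDual w).weightSpace c := by
  subst hc
  exact Subtype.ext (phiFunctional_h w K)

end Sl2Module

/-! ### Differential forms -/

namespace Forms

/-- The space `ℂ^k`. -/
abbrev Sp (k : ℕ) : Type := Fin k → ℂ

/-- The exterior algebra of the cotangent space of `ℂ^k`. A differential form on a domain of `ℂ^k`
is a function on it with values in this algebra, and the pointwise product is the exterior
product of forms. -/
abbrev Ext (k : ℕ) : Type := ExteriorAlgebra ℂ (Sp k →L[ℂ] ℂ)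

variable {k : ℕ}

/-- The logarithmic differential `df / f`, as a field of covectors. -/
def dlogCov (g : Sp k → ℂ) (x : Sp k) : Sp k →L[ℂ] ℂ := (g x)⁻¹ • fderiv ℂ g x

/-- The logarithmic differential `df / f`, as a differential form. -/
def dlog (g : Sp k → ℂ) (x : Sp k) : Ext k := ExteriorAlgebra.ι ℂ (dlogCov g x)

/-- The pull-back under `b` of a field of covectors. -/
def pullCov (b : Sp k → Sp k) (w : Sp k → (Sp k →L[ℂ] ℂ)) (x : Sp k) : Sp k →L[ℂ] ℂ :=
  (w (b x)).comp (fderiv ℂ b x)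

/-- The coordinate permutation `x ↦ (x_{σ 1}, …, x_{σ k})` of `ℂ^k`. -/
def permMap (σ : Equiv.Perm (Fin k)) : Sp k →L[ℂ] Sp k :=
  ContinuousLinearMap.pi fun i => ContinuousLinearMap.proj (σ i)

/-- The pull-back of exterior covectors under the coordinate permutation; it sends `d t_i` to
`d t_{σ i}`. -/
def permPull (σ : Equiv.Perm (Fin k)) : Ext k →ₐ[ℂ] Ext k :=
  ExteriorAlgebra.map
    ((ContinuousLinearMap.compL ℂ (Sp k) (Sp k) ℂ).flip (permMap σ)).toLinearMap

/-- The form `ω_a` of the weighted discriminantal arrangement in `ℂ^k` with hyperplanes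
`t_i = t_l` of weight `2/κ` and `t_i = z_a` of weight `-m_a/κ`. -/
def omegaA {n : ℕ} (m : Fin n → ℕ) (z : Fin n → ℂ) (κ : ℂ) (x : Sp k) : Sp k →L[ℂ] ℂ :=
  (∑ i : Fin k, ∑ l ∈ Finset.Ioi i, (2 / κ) • dlogCov (fun t : Sp k => t i - t l) x)
    + ∑ i : Fin k, ∑ a : Fin n, (-(m a : ℂ) / κ) • dlogCov (fun t : Sp k => t i - z a) x

end Forms

/-! ### The orbit of strata -/

namespace Strata

open Forms

/-- Let `𝐣` be a set of indices of the points `z_a`. The strata `C_𝐈` with `𝐈 = {I_a}_{a ∈ 𝐣}`,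
where the `I_a` are disjoint subsets of `{1, …, k}` with `|I_a| = m_a + 1`, form one `S_k`-orbit.
The stratum `C_𝐈` is the complement of an arrangement in `(∏_{a ∈ 𝐣} ℙ^{m_a}) × ℂ^e`, where
`ℙ^{m_a}` has the homogeneous coordinates `x_i`, `i ∈ I_a`, with the hyperplanes `x_i = 0` and
`x_i = x_l`, and where `ℂ^e` has the coordinates `x_i`, `i ∉ ⋃ I_a`, with the hyperplanes
`x_i = x_l` and `x_i = z_b`.

A `StratumPoint` is a point of the disjoint union of the strata, together with a choice of its
homogeneous coordinates. Differential forms on `C_𝐈` are written in these coordinates, i.e. they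
are identified with their pull-backs to the (principal `(ℂ^×)^𝐣`-bundle of) homogeneous
coordinates. -/
structure StratumPoint (k : ℕ) {n : ℕ} (m : Fin n → ℕ) (z : Fin n → ℂ) (j : Finset (Fin n)) where
  I : j → Finset (Fin k)
  x : Sp k
  card_I : ∀ a, (I a).card = m a + 1
  disjoint_I : ∀ a b, a ≠ b → Disjoint (I a) (I b)
  ne_zero : ∀ a, ∀ i ∈ I a, x i ≠ 0
  ne_of_mem : ∀ a, ∀ i ∈ I a, ∀ l ∈ I a, i ≠ l → x i ≠ x l
  ne_of_free : ∀ i l, (∀ a, i ∉ I a) → (∀ a, l ∉ I a) → i ≠ l → x i ≠ x l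
  ne_z : ∀ i, (∀ a, i ∉ I a) → ∀ b, x i ≠ z b

variable {k n : ℕ} {m : Fin n → ℕ} {z : Fin n → ℂ} {j : Finset (Fin n)}

/-- The coordinate permutation on the union of the strata. -/
def StratumPoint.perm (σ : Equiv.Perm (Fin k)) (p : StratumPoint k m z j) :
    StratumPoint k m z j where
  I a := (p.I a).map σ.symm.toEmbedding
  x := permMap σ p.x
  card_I a := by rw [Finset.card_map, p.card_I]
  disjoint_I a b hab := (Finset.disjoint_map _).2 (p.disjoint_I a b hab)
  ne_zero a i hi := p.ne_zero a (σ i) (by simpa [Finset.mem_map_equiv] using hi)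
  ne_of_mem a i hi l hl hil := p.ne_of_mem a (σ i) (by simpa [Finset.mem_map_equiv] using hi) (σ l)
    (by simpa [Finset.mem_map_equiv] using hl) (fun h => hil (σ.injective h))
  ne_of_free i l hi hl hil := p.ne_of_free (σ i) (σ l)
    (fun a => by simpa [Finset.mem_map_equiv] using hi a)
    (fun a => by simpa [Finset.mem_map_equiv] using hl a) (fun h => hil (σ.injective h))
  ne_z i hi b := p.ne_z (σ i) (fun a => by simpa [Finset.mem_map_equiv] using hi a) b

variable (k m z j) in
/-- Differential forms on the union `⋃_𝐈 C_𝐈`, with the pointwise exterior product. -/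
abbrev StratumForm : Type := StratumPoint k m z j → Ext k

/-- The action of `σ` on forms on the union of the strata: `d log (t_i - z_b)` goes to
`d log (t_{σ i} - z_b)`. -/
def permAct (σ : Equiv.Perm (Fin k)) (η : StratumForm k m z j) : StratumForm k m z j :=
  fun p => permPull σ (η (p.perm σ))

variable (m z j) in
open scoped Classical in
/-- A form on the stratum `C_𝐈`, extended by zero to the other strata. -/
def extendZero (I : j → Finset (Fin k)) (η : Sp k → Ext k) : StratumForm k m z j :=
  fun p => if p.I = I then η p.x else 0

/-- The linear forms of the projective arrangement in `ℙ^{|S| - 1}`: `x_i` and `x_i - x_l`. -/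
def projEqs (S : Finset (Fin k)) : Set (Sp k → ℂ) :=
  {g | (∃ i ∈ S, g = fun x => x i) ∨ ∃ i ∈ S, ∃ l ∈ S, i ≠ l ∧ g = fun x => x i - x l}

variable (z) in
/-- The logarithmic 1-forms which generate the Orlik-Solomon spaces of the stratum `C_𝐈`. -/
def osGens (I : j → Finset (Fin k)) : Set (Sp k → Ext k) :=
  {w | (∃ a, ∃ g₁ ∈ projEqs (I a), ∃ g₂ ∈ projEqs (I a), w = dlog fun x => g₁ x / g₂ x) ∨
    (∃ i l, (∀ a, i ∉ I a) ∧ (∀ a, l ∉ I a) ∧ i ≠ l ∧ w = dlog fun x => x i - x l) ∨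
    ∃ i b, (∀ a, i ∉ I a) ∧ w = dlog fun x => x i - z b}

variable (k m z j) in
/-- The Orlik-Solomon space `⨁_𝐈 A^q(C_𝐈)` of the union of the strata. -/
def OS (q : ℕ) : Submodule ℂ (StratumForm k m z j) :=
  Submodule.span ℂ {η | ∃ (I : j → Finset (Fin k)) (l : List (Sp k → Ext k)),
    l.length = q ∧ (∀ w ∈ l, w ∈ osGens z I) ∧ η = extendZero m z j I l.prod}

variable (k m z j) in
/-- The `S_k`-skew-symmetric part `A^q_-(⋃_𝐈 C_𝐈)` of the Orlik-Solomon space. -/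
def OSskew (q : ℕ) : Submodule ℂ (StratumForm k m z j) where
  carrier := {η | η ∈ OS k m z j q ∧
    ∀ σ : Equiv.Perm (Fin k), permAct σ η = ((Equiv.Perm.sign σ : ℤ) : ℂ) • η}
  add_mem' := by
    rintro a b ⟨ha, ha'⟩ ⟨hb, hb'⟩
    refine ⟨add_mem ha hb, fun σ => ?_⟩
    rw [smul_add, ← ha', ← hb']
    funext p
    simp [permAct]
  zero_mem' := by
    refine ⟨zero_mem _, fun σ => ?_⟩
    funext p
    simp [permAct]
  smul_mem' := by
    rintro r a ⟨ha, ha'⟩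
    refine ⟨Submodule.smul_mem _ r ha, fun σ => ?_⟩
    rw [smul_comm, ← ha']
    funext p
    simp [permAct]

/-- The skew-symmetrization `∑_σ (-1)^{|σ|} σ η`. -/
def skew (η : StratumForm k m z j) : StratumForm k m z j :=
  ∑ σ : Equiv.Perm (Fin k), ((Equiv.Perm.sign σ : ℤ) : ℂ) • permAct σ η

open scoped Classical in
/-- The blow-down map near the stratum `C_𝐈`, where the resolution is the product of the
blow-ups of `ℂ^{I_a}` at the points `(z_a, …, z_a)` and of `ℂ^e`. The blow-up is the total space of
the tautological line bundle over `ℙ^{m_a}`: the point `s_a x` of the line through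
`x ∈ ℂ^{I_a} - 0` goes to the point with the coordinates `t_i = z_a + s_a x_i`. The other
coordinates are unchanged. The stratum is `{s = 0}` and the exceptional divisors are
`{s_a = 0}`. -/
def blowDown (z : Fin n → ℂ) (I : j → Finset (Fin k)) (s : j → ℂ) (x : Sp k) : Sp k :=
  fun i => if h : ∃ a, i ∈ I a then z h.choose + s h.choose * x i else x i

/-- The filter of the parameters `s` which tend to `0` off the exceptional divisors. -/
def offDivisors (j : Finset (Fin n)) : Filter (j → ℂ) :=
  𝓝[{s | ∀ a, s a ≠ 0}] 0

/-- The restriction to the stratum of the lift `π^* ω_a`, as a field of covectors: the limit, as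
`s → 0`, of the pull-back of `ω_a` under the blow-down map. -/
def omegaTildeCov (κ : ℂ) (p : StratumPoint k m z j) : Sp k →L[ℂ] ℂ :=
  Filter.limUnder (offDivisors j) fun s => pullCov (blowDown z p.I s) (omegaA m z κ) p.x

variable (m z j) in
/-- The 1-form `ω̃_a` on the union of the strata. -/
def omegaTilde (κ : ℂ) : StratumForm k m z j :=
  fun p => ExteriorAlgebra.ι ℂ (omegaTildeCov κ p)

/-! ### The basic skew-symmetric forms -/

/-- The number `s_𝐣 = ∑_{a ∈ 𝐣} (m_a + 1)` of the coordinates in the blocks. -/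
def blockTotal (m : Fin n → ℕ) (j : Finset (Fin n)) : ℕ := ∑ a ∈ j, (m a + 1)

/-- The dimension `e(𝐣) = k - ∑_{a ∈ 𝐣} (m_a + 1)` (used only if it is not negative). -/
def freeDim (k : ℕ) (m : Fin n → ℕ) (j : Finset (Fin n)) : ℕ := k - blockTotal m j

/-- The block `I⁰_a`: the `I⁰_a`, `a ∈ 𝐣`, are consecutive segments of `m_a + 1` elements, starting
from the first element of `{1, …, k}`. -/
def baseBlock (k : ℕ) (m : Fin n → ℕ) (j : Finset (Fin n)) (a : Fin n) : Finset (Fin k) :=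
  Finset.univ.filter fun i : Fin k =>
    blockTotal m (j.filter (· < a)) ≤ i.val ∧ i.val < blockTotal m (j.filter (· < a)) + (m a + 1)

/-- The form `μ_I = d log (x_{i_1}/x_{i_0}) ∧ ⋯ ∧ d log (x_{i_m}/x_{i_0})`, where
`I = {i_0 < ⋯ < i_m}`. -/
def mu (S : Finset (Fin k)) : Sp k → Ext k :=
  match S.sort (· ≤ ·) with
  | [] => 1
  | i₀ :: tl => (tl.map fun i => dlog fun x => x i / x i₀).prod

/-- The coordinate with the number `q`, counted from `0` (used only for `q < k`). -/
def coord (q : ℕ) (x : Sp k) : ℂ := if h : q < k then x ⟨q, h⟩ else 0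

/-- The form `η_{K,a}`: the exterior product of the forms `d log (t_q - z_a)` over the `k_a`
consecutive coordinates after the first `s_𝐣 + k_1 + ⋯ + k_{a-1}` ones. -/
def etaSite (m : Fin n → ℕ) (z : Fin n → ℂ) (j : Finset (Fin n)) (K : Fin n → ℕ) (a : Fin n) :
    Sp k → Ext k :=
  ((List.range (K a)).map fun r =>
    dlog fun x => coord (blockTotal m j + (∑ b ∈ Finset.Iio a, K b) + r) x - z a).prod

/-- The number `d_𝐣 = ∑_{i=1}^{p-1} i (m_{j_i} + 1)`, where `𝐣 = {j_1 < ⋯ < j_p}`. -/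
def signExp (m : Fin n → ℕ) (j : Finset (Fin n)) : ℕ :=
  ∑ a ∈ j.filter (fun a => ∃ b ∈ j, a < b), (j.filter (· ≤ a)).card * (m a + 1)

/-- The coefficient `α_K = (-1)^{d_𝐣} (∏_{a ∈ 𝐣} (m_a + 1)! ∏_a k_a!)⁻¹`. -/
def alphaK (m : Fin n → ℕ) (j : Finset (Fin n)) (K : Fin n → ℕ) : ℂ :=
  (-1) ^ signExp m j *
    ((∏ a ∈ j, ((m a + 1).factorial : ℂ)) * ∏ a, ((K a).factorial : ℂ))⁻¹

variable (k m z j) in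
/-- The form `α_K μ_{I⁰_{j_1}} ∧ ⋯ ∧ μ_{I⁰_{j_p}} ∧ η_{K,1} ∧ ⋯ ∧ η_{K,n}` on the stratum `C_{𝐈⁰}`,
extended by zero to the other strata. -/
def baseForm (K : Fin n → ℕ) : StratumForm k m z j :=
  extendZero m z j (fun a => baseBlock k m j a)
    (alphaK m j K • (((j.sort (· ≤ ·)).map fun a => mu (baseBlock k m j a)).prod *
      (List.ofFn fun a => etaSite m z j K a).prod))

variable (k m z j) in
/-- The form `ω_K` for `|K| = e(𝐣)`. -/
def omegaTop (κ : ℂ) (K : Fin n → ℕ) : StratumForm k m z j :=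
  skew ((κ ^ k)⁻¹ • baseForm k m z j K)

variable (k m z j) in
/-- The form `ω_K` for `|K| = e(𝐣) - 1`. -/
def omegaSub (κ : ℂ) (K : Fin n → ℕ) : StratumForm k m z j :=
  skew (((-1) ^ (k - j.card) * (κ ^ (k - 1))⁻¹) • baseForm k m z j K)

/-- The reflected weights: `-m_a - 2` for `a ∈ 𝐣` and `m_a` otherwise. -/
def reflWeight (m : Fin n → ℕ) (j : Finset (Fin n)) (a : Fin n) : ℂ :=
  if a ∈ j then -(m a : ℂ) - 2 else (m a : ℂ)

end Strata

end

noncomputable section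

namespace Strata

open Forms

variable {k n : ℕ} {m : Fin n → ℕ} {z : Fin n → ℂ} {j : Finset (Fin n)}

/-! ### The action of the symmetric group -/

/-! In homogeneous coordinates the forms of a stratum are logarithmic forms on an affine complement
which are annihilated by contraction with the Euler field of each of the p blocks. The generators
there are edges d log(u - v) of a graph whose vertices are the coordinates, one origin for each
block and the points z_b (the origins and the z_b are the sites). Only vertices of the same `color`
(the same block, or no block) give admissible edges.

Spanning. Multiplication by d log x_i with i in I_a inverts the contraction on its kernel, so a form
of degree q is an iterated contraction of a form of degree q + p (`exists_contrs_eq`). Arnold's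
relation writes the latter through forests directed downwards (`chi_mul_edge_mul_mem`). Contractions
commute with skew-symmetrization, and under skew-symmetrization forests can be flattened: by
Lagrange interpolation (`skewHom_star`) all upper neighbours of a coordinate may be attached to its
own lower neighbour, while a nontrivial tree without a site gives zero. What remains are labelings
of coordinates by sites. A labeling which misses a coordinate of a block dies after contraction, and
up to permutations the others are determined by the numbers k_b of coordinates attached to z_b. Thus
there is one form `contracted` for each K. The form θ_K, before skew-symmetrization, is such a
contraction up to α_K and a nonzero factor independent of K (`exists_baseForm_eq`).

Independence. Multiplication by the forms d log x_i recovers the form from its contraction. In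
degree k the coefficients of the volume form are then separated by their poles
(`eq_zero_of_sum_fullMono`); degree k - 1 is reduced to degree k by multiplication with the
invariant form dx_1 + ... + dx_k.

Differential. The form ω̃ is invariant under S_k, and its value on each Euler field is m_a(m_a +
1)/κ - m_a(m_a + 1)/κ = 0. Hence up to sign it passes through contractions and skew-symmetrization,
and only its component at the single unlabeled coordinate t_f matters. Seen from t_f, a block is m_a
+ 1 coordinates located at z_a, so the coefficient of d log(t_f - z_a) becomes (2(m_a + 1) - m_a)/κ
= -(-m_a - 2)/κ: this is the reflected weight (`limitCov_single`). Each free coordinate attached to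
z_b contributes another 1/κ (`skewHom_edge_mul_mono`). After normalization by α_K the matrix entry
is (k_b + 1)(m^j_b - k_b), which is also the entry for f on φ^K, because e f^{q+1}v = (q + 1)(c - q)
f^q v in the Verma module of highest weight c. -/

theorem permMap_apply (σ : Equiv.Perm (Fin k)) (x : Sp k) (i : Fin k) :
    permMap σ x i = x (σ i) := rfl

theorem permPull_ι (σ : Equiv.Perm (Fin k)) (c : Sp k →L[ℂ] ℂ) :
    permPull σ (ExteriorAlgebra.ι ℂ c) = ExteriorAlgebra.ι ℂ (c.comp (permMap σ)) := by
  rw [permPull, ExteriorAlgebra.map_apply_ι]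
  rfl

/-- `permMap` reverses products and pull-back reverses them once more, so this is a left action. -/
theorem permPull_permPull (σ τ : Equiv.Perm (Fin k)) (w : Ext k) :
    permPull σ (permPull τ w) = permPull (σ * τ) w := by
  have : (permPull σ).comp (permPull τ) = permPull (k := k) (σ * τ) := by
    apply ExteriorAlgebra.hom_ext
    ext c
    simp only [AlgHom.comp_toLinearMap, LinearMap.comp_apply, AlgHom.toLinearMap_apply, permPull_ι]
    rfl
  exact DFunLike.congr_fun this w

theorem StratumPoint.perm_perm (p : StratumPoint k m z j) (σ τ : Equiv.Perm (Fin k)) :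
    (p.perm σ).perm τ = p.perm (σ * τ) := by
  have h : ((p.perm σ).perm τ).I = (p.perm (σ * τ)).I := by
    funext a
    ext i
    simp [StratumPoint.perm]
  simp only [StratumPoint.perm] at h ⊢
  congr 1

/-- The permutation action, as an algebra homomorphism. -/
def permHom (σ : Equiv.Perm (Fin k)) : StratumForm k m z j →ₐ[ℂ] StratumForm k m z j where
  toFun := permAct σ
  map_one' := by funext p; simp [permAct]
  map_mul' a b := by funext p; simp [permAct]
  map_zero' := by funext p; simp [permAct]
  map_add' a b := by funext p; simp [permAct]
  commutes' r := by funext p; simp [permAct]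

theorem permHom_apply (σ : Equiv.Perm (Fin k)) (η : StratumForm k m z j) :
    permHom σ η = permAct σ η := rfl

theorem permHom_permHom (σ τ : Equiv.Perm (Fin k)) (η : StratumForm k m z j) :
    permHom σ (permHom τ η) = permHom (σ * τ) η := by
  funext p
  change permPull σ (permPull τ (η ((p.perm σ).perm τ))) = permPull (σ * τ) (η (p.perm (σ * τ)))
  rw [permPull_permPull, StratumPoint.perm_perm]

/-- The sign of a permutation, as a complex number. -/
def csign (σ : Equiv.Perm (Fin k)) : ℂ := ((Equiv.Perm.sign σ : ℤ) : ℂ)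

theorem csign_mul (σ τ : Equiv.Perm (Fin k)) : csign (σ * τ) = csign σ * csign τ := by
  simp [csign]

theorem csign_mul_self (σ : Equiv.Perm (Fin k)) : csign σ * csign σ = 1 := by
  rw [← csign_mul, csign, map_mul, Int.units_mul_self]; simp

theorem csign_swap {i l : Fin k} (h : i ≠ l) : csign (Equiv.swap i l) = -1 := by
  simp [csign, Equiv.Perm.sign_swap h]

/-- Skew-symmetrization, as a linear map. -/
def skewHom : StratumForm k m z j →ₗ[ℂ] StratumForm k m z j :=
  ∑ σ : Equiv.Perm (Fin k), csign σ • (permHom σ).toLinearMap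

theorem skewHom_apply (η : StratumForm k m z j) : skewHom η = skew η := by
  simp [skewHom, skew, csign, permHom_apply]

theorem skewHom_eq_sum (η : StratumForm k m z j) :
    skewHom η = ∑ σ : Equiv.Perm (Fin k), csign σ • permHom σ η := by
  simp [skewHom]

theorem skewHom_permHom (σ : Equiv.Perm (Fin k)) (η : StratumForm k m z j) :
    skewHom (permHom σ η) = csign σ • skewHom η := by
  rw [skewHom_eq_sum, skewHom_eq_sum, Finset.smul_sum]
  refine Fintype.sum_equiv (Equiv.mulRight σ) _ _ fun τ => ?_
  rw [permHom_permHom, smul_smul, Equiv.coe_mulRight, csign_mul, mul_comm (csign τ), ← mul_assoc,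
    csign_mul_self, one_mul]

theorem permHom_skewHom (σ : Equiv.Perm (Fin k)) (η : StratumForm k m z j) :
    permHom σ (skewHom η) = csign σ • skewHom η := by
  rw [skewHom_eq_sum, map_sum, Finset.smul_sum]
  refine Fintype.sum_equiv (Equiv.mulLeft σ) _ _ fun τ => ?_
  rw [map_smul, permHom_permHom, smul_smul, Equiv.coe_mulLeft, csign_mul, ← mul_assoc,
    csign_mul_self, one_mul]

/-- Used for two invariant 1-forms: ω̃, and the sum of the dx_i. -/
theorem skewHom_mul_of_invariant {ω : StratumForm k m z j} (h : ∀ σ, permHom σ ω = ω)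
    (η : StratumForm k m z j) : skewHom (ω * η) = ω * skewHom η := by
  simp only [skewHom_eq_sum, map_mul, h, Finset.mul_sum, mul_smul_comm]

/-- All k! terms are equal. Since k! is invertible, every skew form is itself a skew-symmetrization.
-/
theorem skewHom_of_skew {η : StratumForm k m z j} (h : ∀ σ, permHom σ η = csign σ • η) :
    skewHom η = (k.factorial : ℂ) • η := by
  simp only [skewHom_eq_sum, h, smul_smul, csign_mul_self, one_smul]
  simp [Fintype.card_perm, ← Nat.cast_smul_eq_nsmul ℂ]

/-- The skew-symmetrization equals its own negative. -/
theorem skewHom_eq_zero_of_swap {η : StratumForm k m z j} {i l : Fin k} (hil : i ≠ l)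
    (h : permHom (Equiv.swap i l) η = η) : skewHom η = 0 := by
  have h1 := skewHom_permHom (Equiv.swap i l) η
  rw [h, csign_swap hil, neg_one_smul] at h1
  calc skewHom η = (1 / 2 : ℂ) • (skewHom η + skewHom η) := by module
    _ = (1 / 2 : ℂ) • (skewHom η + -skewHom η) := by rw [← h1]
    _ = 0 := by simp

/-! ### One-forms on the union of the strata -/

/-- A field of covectors as a 1-form. -/
def oneForm (w : StratumPoint k m z j → (Sp k →L[ℂ] ℂ)) : StratumForm k m z j :=
  fun p => ExteriorAlgebra.ι ℂ (w p)

theorem permHom_oneForm (σ : Equiv.Perm (Fin k)) (w : StratumPoint k m z j → (Sp k →L[ℂ] ℂ)) :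
    permHom σ (oneForm w) = oneForm fun p => (w (p.perm σ)).comp (permMap σ) := by
  funext p
  exact permPull_ι _ _

theorem oneForm_mul_self (w : StratumPoint k m z j → (Sp k →L[ℂ] ℂ)) :
    oneForm w * oneForm w = 0 := by
  funext p
  exact ExteriorAlgebra.ι_sq_zero _

theorem oneForm_mul_comm (v w : StratumPoint k m z j → (Sp k →L[ℂ] ℂ)) :
    oneForm v * oneForm w = -(oneForm w * oneForm v) := by
  funext p
  exact eq_neg_of_add_eq_zero_left (ExteriorAlgebra.ι_add_mul_swap _ _)

/-- The form which is `1` on the stratum `C_𝐈` and `0` on the other strata. -/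
def chi (I : j → Finset (Fin k)) : StratumForm k m z j := extendZero m z j I 1

theorem chi_of_eq {I : j → Finset (Fin k)} {p : StratumPoint k m z j} (h : p.I = I) :
    chi I p = 1 := by simp [chi, extendZero, h]

theorem chi_of_ne {I : j → Finset (Fin k)} {p : StratumPoint k m z j} (h : p.I ≠ I) :
    chi I p = 0 := by simp [chi, extendZero, h]

/-- The indicator `chi I` localizes an identity to one stratum, where it may be checked pointwise
with the nonvanishing of the equations at hand. -/
theorem chi_mul_congr {I : j → Finset (Fin k)} {A B : StratumForm k m z j}
    (h : ∀ p : StratumPoint k m z j, p.I = I → A p = B p) : chi I * A = chi I * B := by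
  funext p
  by_cases hp : p.I = I
  · simp [Pi.mul_apply, h p hp]
  · simp [Pi.mul_apply, chi_of_ne hp]

theorem chi_mul_comm (I : j → Finset (Fin k)) (A : StratumForm k m z j) :
    chi I * A = A * chi I := by
  funext p
  by_cases hp : p.I = I
  · simp [chi_of_eq hp]
  · simp [chi_of_ne hp]

theorem mul_chi_mul (I : j → Finset (Fin k)) (A B : StratumForm k m z j) :
    A * (chi I * B) = chi I * (A * B) := by
  rw [← mul_assoc, ← chi_mul_comm, mul_assoc]

theorem chi_mul_chi_mul (I : j → Finset (Fin k)) (A : StratumForm k m z j) :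
    chi I * (chi I * A) = chi I * A := by
  refine chi_mul_congr fun p hp => ?_
  simp [chi_of_eq hp]

theorem extendZero_eq (I : j → Finset (Fin k)) (F : Sp k → Ext k) :
    extendZero m z j I F = chi I * fun p => F p.x := by
  funext p
  by_cases hp : p.I = I
  · simp [chi_of_eq hp, extendZero, hp]
  · simp [chi_of_ne hp, extendZero, hp]

/-- The images of the sets `I_a` under a permutation. -/
def mapI (σ : Equiv.Perm (Fin k)) (I : j → Finset (Fin k)) : j → Finset (Fin k) :=
  fun a => (I a).map σ.toEmbedding

theorem mem_mapI {σ : Equiv.Perm (Fin k)} {I : j → Finset (Fin k)} {a : j} {i : Fin k} :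
    i ∈ mapI σ I a ↔ σ⁻¹ i ∈ I a := by
  simp [mapI, Finset.mem_map_equiv]

theorem perm_I_eq_iff {σ : Equiv.Perm (Fin k)} {I : j → Finset (Fin k)}
    {p : StratumPoint k m z j} : (p.perm σ).I = I ↔ p.I = mapI σ I := by
  constructor
  · rintro rfl
    funext a; ext i; simp [mem_mapI, StratumPoint.perm]
  · intro h
    funext a; ext i; simp [StratumPoint.perm, Finset.mem_map_equiv, h, mem_mapI]

theorem permHom_chi (σ : Equiv.Perm (Fin k)) (I : j → Finset (Fin k)) :
    permHom (m := m) (z := z) σ (chi I) = chi (mapI σ I) := by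
  funext p
  change permPull σ (chi I (p.perm σ)) = _
  by_cases h : (p.perm σ).I = I
  · rw [chi_of_eq h, map_one, chi_of_eq (perm_I_eq_iff.1 h)]
  · rw [chi_of_ne h, map_zero, chi_of_ne (fun h' => h (perm_I_eq_iff.2 h'))]

/-! ### Vertices and edges -/

variable (k j) in
/-- The coordinates `x_i`, the origin for each block, and the points `z_b`. -/
abbrev Vertex : Type := Fin k ⊕ (j ⊕ Fin n)

/-- The value of the function of a vertex. -/
def vval (p : StratumPoint k m z j) : Vertex k j → ℂ :=
  Sum.elim p.x (Sum.elim (fun _ => 0) z)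

/-- The differential of the function of a vertex. -/
def vdiff : Vertex k j → (Sp k →L[ℂ] ℂ) :=
  Sum.elim (fun i => ContinuousLinearMap.proj i) fun _ => 0

/-- The covector of the logarithmic differential of the difference of two vertices. -/
def edgeCov (u v : Vertex k j) (p : StratumPoint k m z j) : Sp k →L[ℂ] ℂ :=
  (vval p u - vval p v)⁻¹ • (vdiff u - vdiff v)

/-- The logarithmic form of the difference of two vertices. -/
def edge (u v : Vertex k j) : StratumForm k m z j := oneForm (edgeCov u v)

/-- The action of permutations on the vertices. -/
def vperm (σ : Equiv.Perm (Fin k)) : Vertex k j → Vertex k j := Sum.map σ id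

theorem vperm_inl (σ : Equiv.Perm (Fin k)) (i : Fin k) :
    vperm (j := j) σ (Sum.inl i) = Sum.inl (σ i) := rfl

theorem vperm_inr (σ : Equiv.Perm (Fin k)) (s : j ⊕ Fin n) :
    vperm (k := k) σ (Sum.inr s) = Sum.inr s := rfl

theorem permHom_edge (σ : Equiv.Perm (Fin k)) (u v : Vertex k j) :
    permHom (m := m) (z := z) σ (edge u v) = edge (vperm σ u) (vperm σ v) := by
  rw [edge, permHom_oneForm]
  have hv : ∀ (p : StratumPoint k m z j) u, vval (p.perm σ) u = vval p (vperm σ u) := by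
    rintro p (i | a | b) <;> rfl
  have hd : ∀ u : Vertex k j, (vdiff u).comp (permMap σ) = vdiff (vperm σ u) := by
    rintro (i | s)
    · rfl
    · exact ContinuousLinearMap.zero_comp _
  unfold edge
  congr 1
  funext p
  simp only [edgeCov, ContinuousLinearMap.smul_comp, ContinuousLinearMap.sub_comp, hv, hd]

theorem edgeCov_comm (u v : Vertex k j) (p : StratumPoint k m z j) :
    edgeCov u v p = edgeCov v u p := by
  rw [edgeCov, edgeCov, ← neg_sub (vval p v), ← neg_sub (vdiff v), inv_neg, neg_smul_neg]

theorem edge_comm (u v : Vertex k j) : edge (m := m) (z := z) u v = edge v u :=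
  congr_arg oneForm (funext fun p => edgeCov_comm u v p)

theorem edge_site_site (s t : j ⊕ Fin n) :
    edge (k := k) (m := m) (z := z) (Sum.inr s) (Sum.inr t) = 0 := by
  funext p
  simp [edge, oneForm, edgeCov, vdiff]

open scoped Classical in
/-- The block of a vertex; the free coordinates and the points `z_b` have no block. -/
def color (I : j → Finset (Fin k)) : Vertex k j → Option j :=
  Sum.elim (fun i => if h : ∃ a, i ∈ I a then some h.choose else none)
    (Sum.elim some fun _ => none)

/-- Disjointness of the sets `I_a`. -/
def DisjointI (I : j → Finset (Fin k)) : Prop := ∀ a b, a ≠ b → Disjoint (I a) (I b)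

theorem color_inl_eq_some {I : j → Finset (Fin k)} (hI : DisjointI I) {i : Fin k} {a : j} :
    color I (Sum.inl i) = some a ↔ i ∈ I a := by
  simp only [color, Sum.elim_inl]
  constructor
  · intro h
    split_ifs at h with h'
    · simpa [← Option.some_inj.1 h] using h'.choose_spec
  · intro h
    have h' : ∃ a, i ∈ I a := ⟨a, h⟩
    rw [dif_pos h']
    by_contra hne
    exact Finset.disjoint_left.1 (hI _ _ fun h => hne (congr_arg some h)) h'.choose_spec h

theorem color_inl_eq_none {I : j → Finset (Fin k)} {i : Fin k} :
    color I (Sum.inl i) = none ↔ ∀ a, i ∉ I a := by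
  simp [color]

theorem color_mapI {I : j → Finset (Fin k)} (hI : DisjointI I) (σ : Equiv.Perm (Fin k))
    (u : Vertex k j) : color (mapI σ I) (vperm σ u) = color I u := by
  have hI' : DisjointI (mapI σ I) := fun a b hab =>
    (Finset.disjoint_map _).2 (hI a b hab)
  rcases u with i | s
  · rcases h : color I (Sum.inl i) with _ | a
    · rw [vperm_inl, color_inl_eq_none]
      rw [color_inl_eq_none] at h
      intro a; simpa [mem_mapI] using h a
    · rw [vperm_inl, color_inl_eq_some hI']
      rw [color_inl_eq_some hI] at h
      simpa [mem_mapI] using h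
  · rfl

/-- Coordinates of the same color belong to the same blocks, so their exchange preserves the
stratum. -/
theorem mapI_swap {I : j → Finset (Fin k)} (hI : DisjointI I) {i l : Fin k}
    (h : color I (Sum.inl i) = color I (Sum.inl l)) : mapI (Equiv.swap i l) I = I := by
  have key : ∀ a, i ∈ I a ↔ l ∈ I a := fun a => by
    rw [← color_inl_eq_some hI, ← color_inl_eq_some hI, h]
  funext a
  ext r
  rw [mem_mapI, Equiv.swap_inv]
  rcases eq_or_ne r i with rfl | hi
  · rw [Equiv.swap_apply_left, key]
  rcases eq_or_ne r l with rfl | hl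
  · rw [Equiv.swap_apply_right, key]
  rw [Equiv.swap_apply_of_ne_of_ne hi hl]

/-- Pairs of distinct vertices of equal color are equations of the arrangement, or pairs of
different points z_b. A coordinate against an origin uses x_i ≠ 0, and two z_b use their
distinctness. -/
theorem vval_ne (hz : Function.Injective z) (p : StratumPoint k m z j) {u v : Vertex k j}
    (huv : u ≠ v) (hc : color p.I u = color p.I v) : vval p u ≠ vval p v := by
  have hI : DisjointI p.I := p.disjoint_I
  have aux : ∀ (i : Fin k) (v : Vertex k j), Sum.inl i ≠ v → color p.I (Sum.inl i) = color p.I v →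
      vval p (Sum.inl i) ≠ vval p v := by
    rintro i (l | a | b) huv hc
    · have hil : i ≠ l := fun h => huv (by rw [h])
      rcases h : color p.I (Sum.inl l) with _ | a
      · rw [h] at hc
        exact p.ne_of_free i l (color_inl_eq_none.1 hc) (color_inl_eq_none.1 h) hil
      · rw [h] at hc
        exact p.ne_of_mem a i ((color_inl_eq_some hI).1 hc) l ((color_inl_eq_some hI).1 h) hil
    · exact p.ne_zero a i ((color_inl_eq_some hI).1 hc)
    · exact p.ne_z i (color_inl_eq_none.1 hc) b
  rcases u with i | a | b
  · exact aux i v huv hc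
  · rcases v with l | a' | b
    · exact (aux l _ huv.symm hc.symm).symm
    · exact absurd (congr_arg (fun t => Sum.inr (Sum.inl t)) (Option.some_inj.1 hc)) huv
    · exact absurd hc (by simp [color])
  · rcases v with l | a' | b'
    · exact (aux l _ huv.symm hc.symm).symm
    · exact absurd hc (by simp [color])
    · exact fun h => huv (by rw [hz h])

/-- Arnold's relation. -/
theorem arnold (hz : Function.Injective z) (I : j → Finset (Fin k)) {v x y : Vertex k j}
    (hvx : v ≠ x) (hvy : v ≠ y) (hxy : x ≠ y) (cvx : color I v = color I x)
    (cvy : color I v = color I y) :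
    chi (m := m) (z := z) I * (edge v x * edge v y)
      = chi I * (edge x y * (edge v y - edge v x)) := by
  refine chi_mul_congr ?_
  rintro p rfl
  have h1 := sub_ne_zero.2 (vval_ne hz p hvx cvx)
  have h2 := sub_ne_zero.2 (vval_ne hz p hvy cvy)
  have h3 := sub_ne_zero.2 (vval_ne hz p hxy (cvx.symm.trans cvy))
  have hd : vdiff x - vdiff y = (vdiff v - vdiff y) - (vdiff v - vdiff x) := by abel
  have hv : vval p x - vval p y = (vval p v - vval p y) - (vval p v - vval p x) := by ring
  simp only [Pi.mul_apply, Pi.sub_apply, edge, oneForm, edgeCov, hd]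
  rw [hv] at h3 ⊢
  generalize vval p v - vval p x = a at *
  generalize vval p v - vval p y = b at *
  generalize vdiff v - vdiff x = A
  generalize vdiff v - vdiff y = B
  -- Since x - y = (v - y) - (v - x), only A and B are left. The coefficients of A ∧ B agree because
  -- 1/(ab) = (1/a - 1/b)/(b - a).
  have hBA : ExteriorAlgebra.ι ℂ B * ExteriorAlgebra.ι ℂ A
      = -(ExteriorAlgebra.ι ℂ A * ExteriorAlgebra.ι ℂ B) :=
    eq_neg_of_add_eq_zero_left (ExteriorAlgebra.ι_add_mul_swap _ _)
  simp only [map_smul, map_sub, mul_sub, sub_mul, mul_smul_comm, ExteriorAlgebra.ι_sq_zero, hBA,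
    smul_mul_assoc, smul_sub, smul_zero]
  match_scalars
  field_simp
  ring

/-! ### Lagrange interpolation for products of anticommuting elements -/

section Lagrange

/-- The Lagrange basis polynomials at the nodes t_u sum to 1; evaluate at 0 and divide by the
product of the nodes. -/
theorem sum_inv_mul_prod_inv {α : Type*} [DecidableEq α] (s : Finset α) (hs : s.Nonempty)
    (t : α → ℂ) (ht : Set.InjOn t s) (h0 : ∀ u ∈ s, t u ≠ 0) :
    ∑ u ∈ s, (t u)⁻¹ * ∏ v ∈ s.erase u, (t v - t u)⁻¹ = ∏ u ∈ s, (t u)⁻¹ := by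
  have h := congr_arg (Polynomial.eval 0) (Lagrange.sum_basis ht hs)
  rw [Polynomial.eval_finsetSum, Polynomial.eval_one] at h
  have h1 : ∏ u ∈ s, t u ≠ 0 := Finset.prod_ne_zero_iff.2 h0
  rw [Finset.prod_inv_distrib, ← mul_eq_one_iff_eq_inv₀ h1, ← h, Finset.sum_mul]
  refine Finset.sum_congr rfl fun u hu => ?_
  rw [← Finset.mul_prod_erase s t hu, Lagrange.basis, Polynomial.eval_prod]
  have h2 : ∀ v ∈ s.erase u, Polynomial.eval 0 (Lagrange.basisDivisor (t u) (t v))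
      = (t v - t u)⁻¹ * t v := by
    intro v hv
    rw [Lagrange.basisDivisor, ← neg_sub (t v), inv_neg]
    simp
  rw [Finset.prod_congr rfl h2, Finset.prod_mul_distrib]
  field_simp [h0 u hu]

variable {A : Type*} [Ring A]

/-- The leading d can be moved past the factors g y up to sign, and d² = 0 then kills the subtracted
d in every factor. -/
theorem mul_prod_sub_self {β : Type*} (d : A) (hd : d * d = 0) (g : β → A) (Y : List β)
    (hg : ∀ y ∈ Y, d * g y = -(g y * d)) :
    d * (Y.map fun y => g y - d).prod = d * (Y.map g).prod := by
  induction Y with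
  | nil => rfl
  | cons y Y ih =>
    have ih := ih fun y' hy' => hg y' (List.mem_cons_of_mem _ hy')
    have h1 := hg y List.mem_cons_self
    simp only [List.map_cons, List.prod_cons]
    rw [← mul_assoc, mul_sub, hd, sub_zero, ← mul_assoc, h1, neg_mul, neg_mul, mul_assoc, ih,
      mul_assoc]

theorem prod_map_smul_list [Algebra ℂ A] {β : Type*} (a : β → ℂ) (g : β → A) (Y : List β) :
    (Y.map fun y => a y • g y).prod = (Y.map a).prod • (Y.map g).prod := by
  induction Y with
  | nil => simp
  | cons y Y ih => simp only [List.map_cons, List.prod_cons, ih, smul_mul_smul_comm]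

/-- The two sides contain the same factors, with c x and c y₀ exchanged: a transposition of
anticommuting elements, hence one sign. -/
theorem mul_prod_swap {α : Type*} [DecidableEq α] (c : α → A)
    (hc : ∀ u v, c u * c v = -(c v * c u)) (x y₀ : α) (Y : List α) (hx : x ∉ Y)
    (hY : Y.Nodup) (hy₀ : y₀ ∈ Y) :
    c y₀ * (Y.map fun y => c (Equiv.swap x y₀ y)).prod = -(c x * (Y.map c).prod) := by
  induction Y with
  | nil => simp at hy₀
  | cons y Y ih =>
    rw [List.nodup_cons] at hY
    rw [List.mem_cons, not_or] at hx
    simp only [List.map_cons, List.prod_cons]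
    by_cases hy : y₀ = y
    · subst hy
      have : (Y.map fun y => c (Equiv.swap x y₀ y)) = Y.map c := by
        refine List.map_congr_left fun y hy => ?_
        rw [Equiv.swap_apply_of_ne_of_ne (ne_of_mem_of_not_mem hy hx.2)
          (ne_of_mem_of_not_mem hy hY.1)]
      rw [this, Equiv.swap_apply_right, ← mul_assoc, hc, neg_mul, mul_assoc]
    · have hmem : y₀ ∈ Y := (List.mem_cons.1 hy₀).resolve_left hy
      rw [Equiv.swap_apply_of_ne_of_ne (Ne.symm hx.1) (Ne.symm hy), ← mul_assoc, hc, neg_mul,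
        mul_assoc, ih hx.2 hY.2 hmem, mul_neg, neg_neg, ← mul_assoc, hc, neg_mul, mul_assoc]

/-- By `mul_prod_sub_self` every term collapses to a scalar times the product of all the c u. The
exchange of x and y₀ costs a sign which turns the difference into a sum, and the scalars are those
of `sum_inv_mul_prod_inv` for the set formed by x and Y. -/
theorem lagrange_list [Algebra ℂ A] {α : Type*} [DecidableEq α] (c : α → A) (t : α → ℂ)
    (hc : ∀ u v, c u * c v = -(c v * c u)) (hc0 : ∀ u, c u * c u = 0) (x : α) (Y : List α)
    (hY : (x :: Y).Nodup) (ht : ∀ u ∈ x :: Y, ∀ v ∈ x :: Y, t u = t v → u = v)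
    (ht0 : ∀ u ∈ x :: Y, t u ≠ 0) :
    ((t x)⁻¹ • c x) * (Y.map fun y => (t y - t x)⁻¹ • (c y - c x)).prod
      - ∑ y₀ ∈ Y.toFinset, ((t y₀)⁻¹ • c y₀) * (Y.map fun y =>
          (t (Equiv.swap x y₀ y) - t y₀)⁻¹ • (c (Equiv.swap x y₀ y) - c y₀)).prod
      = ((t x)⁻¹ • c x) * (Y.map fun y => (t y)⁻¹ • c y).prod := by
  obtain ⟨hxY, hYn⟩ := List.nodup_cons.1 hY
  have key : ∀ (a : ℂ) (b : α → ℂ) (u : α) (f : α → α),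
      (a • c u) * (Y.map fun y => b y • (c (f y) - c u)).prod
        = (a * (Y.map b).prod) • (c u * (Y.map fun y => c (f y)).prod) := by
    intro a b u f
    rw [prod_map_smul_list, smul_mul_smul_comm,
      mul_prod_sub_self (c u) (hc0 u) (fun y => c (f y)) Y (fun y _ => hc _ _)]
  have hx' : x ∉ Y.toFinset := by simpa using hxY
  have hterm : ∀ y₀ ∈ Y.toFinset, ((t y₀)⁻¹ • c y₀) * (Y.map fun y =>
          (t (Equiv.swap x y₀ y) - t y₀)⁻¹ • (c (Equiv.swap x y₀ y) - c y₀)).prod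
      = -(((t y₀)⁻¹ * ∏ v ∈ (insert x Y.toFinset).erase y₀, (t v - t y₀)⁻¹)
        • (c x * (Y.map c).prod)) := by
    intro y₀ hy₀
    rw [key _ (fun y => (t (Equiv.swap x y₀ y) - t y₀)⁻¹),
      mul_prod_swap c hc x y₀ Y hxY hYn (List.mem_toFinset.1 hy₀), smul_neg]
    congr 3
    rw [← List.prod_toFinset _ hYn]
    -- The transposition carries Y onto the node set without y₀.
    refine Finset.prod_equiv (Equiv.swap x y₀) (fun i => ?_) fun _ _ => rfl
    have hne : y₀ ≠ x := ne_of_mem_of_not_mem hy₀ hx'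
    rw [Finset.mem_erase, Finset.mem_insert]
    rcases eq_or_ne i x with rfl | hix
    · simp [hxY]
    rcases eq_or_ne i y₀ with rfl | hiy
    · simp [List.mem_toFinset.1 hy₀, hne.symm]
    · simp [Equiv.swap_apply_of_ne_of_ne hix hiy, hix, hiy]
  rw [Finset.sum_congr rfl hterm, Finset.sum_neg_distrib, sub_neg_eq_add, ← Finset.sum_smul,
    key _ (fun y => (t y - t x)⁻¹) x fun y => y, prod_map_smul_list, smul_mul_smul_comm,
    ← add_smul]
  congr 1
  have hins : ∀ u, u ∈ insert x Y.toFinset ↔ u ∈ x :: Y := by simp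
  have hL := sum_inv_mul_prod_inv (insert x Y.toFinset) ⟨x, Finset.mem_insert_self _ _⟩ t
    (fun u hu v hv h => ht u ((hins u).1 hu) v ((hins v).1 hv) h)
    fun u hu => ht0 u ((hins u).1 hu)
  rw [Finset.sum_insert hx', Finset.prod_insert hx', Finset.erase_insert hx'] at hL
  rw [← List.prod_toFinset _ hYn, ← List.prod_toFinset _ hYn, hL]

end Lagrange
/-! ### Normal monomials -/

/-- The product of the logarithmic forms of a list of edges. -/
def monL (L : List (Fin k × Vertex k j)) : StratumForm k m z j :=
  (L.map fun q => edge (Sum.inl q.1) q.2).prod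

theorem monL_cons (q : Fin k × Vertex k j) (L : List (Fin k × Vertex k j)) :
    monL (m := m) (z := z) (q :: L) = edge (Sum.inl q.1) q.2 * monL L := by
  simp [monL]

theorem monL_append (L L' : List (Fin k × Vertex k j)) :
    monL (m := m) (z := z) (L ++ L') = monL L * monL L' := by
  simp [monL]

theorem edge_mul_comm (u v u' v' : Vertex k j) :
    edge (m := m) (z := z) u v * edge u' v' = -(edge u' v' * edge u v) :=
  oneForm_mul_comm _ _

theorem edge_mul_self (u v : Vertex k j) : edge (m := m) (z := z) u v * edge u v = 0 :=
  oneForm_mul_self _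

/-- The sign is left undetermined, which is enough for membership in spans. -/
theorem monL_perm {L L' : List (Fin k × Vertex k j)} (h : L.Perm L') :
    monL (m := m) (z := z) L = monL L' ∨ monL (m := m) (z := z) L = -monL L' := by
  induction h with
  | nil => exact Or.inl rfl
  | cons q _ ih =>
    rw [monL_cons, monL_cons]
    rcases ih with ih | ih <;> rw [ih]
    · exact Or.inl rfl
    · exact Or.inr (mul_neg _ _)
  | swap q r L =>
    right
    simp only [monL_cons]
    rw [← mul_assoc, edge_mul_comm, neg_mul, mul_assoc]
  | trans _ _ ih₁ ih₂ =>
    rcases ih₁ with ih₁ | ih₁ <;> rcases ih₂ with ih₂ | ih₂ <;> simp [ih₁, ih₂]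

theorem permHom_monL (σ : Equiv.Perm (Fin k)) (L : List (Fin k × Vertex k j)) :
    permHom (m := m) (z := z) σ (monL L) = monL (L.map (Prod.map σ (vperm σ))) := by
  simp only [monL, map_list_prod, List.map_map]
  congr 1
  refine List.map_congr_left fun q _ => ?_
  simp [permHom_edge, vperm_inl]

/-- The position of a vertex in the order in which the constant vertices come first. -/
def rank : Vertex k j → ℕ := Sum.elim (fun i => i.val + 1) fun _ => 0

/-- A list of edges such that every coordinate is joined with at most one lower vertex, which has
the same color. -/
structure Normal (I : j → Finset (Fin k)) (L : List (Fin k × Vertex k j)) : Prop where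
  nodup : (L.map Prod.fst).Nodup
  lower : ∀ q ∈ L, rank q.2 < rank (j := j) (Sum.inl q.1)
  color_eq : ∀ q ∈ L, color I (Sum.inl q.1) = color I q.2

theorem Normal.perm {I : j → Finset (Fin k)} {L L' : List (Fin k × Vertex k j)} (hL : Normal I L)
    (h : L.Perm L') : Normal I L' where
  nodup := (h.map _).nodup_iff.1 hL.nodup
  lower q hq := hL.lower q (h.mem_iff.2 hq)
  color_eq q hq := hL.color_eq q (h.mem_iff.2 hq)

variable (m z) in
/-- The span of the normal monomials of degree `q`. -/
def normalSpan (I : j → Finset (Fin k)) (q : ℕ) : Submodule ℂ (StratumForm k m z j) :=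
  Submodule.span ℂ {w | ∃ L, Normal I L ∧ L.length = q ∧ w = chi I * monL L}

theorem chi_mul_of_mem_normalSpan {I : j → Finset (Fin k)} {q : ℕ} {w : StratumForm k m z j}
    (hw : w ∈ normalSpan m z I q) : chi I * w = w := by
  induction hw using Submodule.span_induction with
  | mem w h =>
    obtain ⟨L, -, -, rfl⟩ := h
    exact chi_mul_chi_mul _ _
  | zero => exact mul_zero _
  | add a b _ _ ha hb => rw [mul_add, ha, hb]
  | smul r a _ ha => rw [mul_smul_comm, ha]

/-- Straightening by induction on v. If v has no lower neighbour yet, the edge is simply added. If v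
is already joined with y, Arnold's relation replaces the two edges from v by the edge between x and
y times monomials in which v has one lower neighbour, and the upper end of the new edge lies below
v. -/
theorem chi_mul_edge_mul_mem (hz : Function.Injective z) (I : j → Finset (Fin k)) :
    ∀ (r : ℕ) (v : Fin k), v.val = r → ∀ x : Vertex k j, rank x < rank (j := j) (Sum.inl v) →
      color I (Sum.inl v) = color I x → ∀ (q : ℕ) (w : StratumForm k m z j),
      w ∈ normalSpan m z I q → edge (Sum.inl v) x * w ∈ normalSpan m z I (q + 1) := by
  intro r
  induction r using Nat.strong_induction_on with
  | _ r ih =>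
  intro v hv x hx hc q w hw
  induction hw using Submodule.span_induction with
  | zero => rw [mul_zero]; exact zero_mem _
  | add a b _ _ ha hb => rw [mul_add]; exact add_mem ha hb
  | smul r a _ ha => rw [mul_smul_comm]; exact Submodule.smul_mem _ _ ha
  | mem w h =>
  obtain ⟨L, hL, rfl, rfl⟩ := h
  rw [mul_chi_mul]
  by_cases hmem : v ∈ L.map Prod.fst
  · obtain ⟨⟨v', y⟩, hq, rfl⟩ := List.mem_map.1 hmem
    obtain ⟨L₁, L₂, hL₁⟩ := List.append_of_mem hq
    have hperm : L.Perm ((v', y) :: (L₁ ++ L₂)) := by rw [hL₁]; exact List.perm_middle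
    have hlen := hperm.length_eq
    have hN := hL.perm hperm
    generalize L₁ ++ L₂ = M at *
    simp only at hx hc hv
    have hN' : Normal I ((v', x) :: M) := by
      refine ⟨hN.nodup, ?_, ?_⟩
      · intro q hq
        rcases List.mem_cons.1 hq with rfl | hq
        · exact hx
        · exact hN.lower q (List.mem_cons_of_mem _ hq)
      · intro q hq
        rcases List.mem_cons.1 hq with rfl | hq
        · exact hc
        · exact hN.color_eq q (List.mem_cons_of_mem _ hq)
    have hy := hN.lower _ List.mem_cons_self
    have hyc := hN.color_eq _ List.mem_cons_self
    simp only at hy hyc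
    have main : chi (m := m) (z := z) I * (edge (Sum.inl v') x * monL ((v', y) :: M))
        ∈ normalSpan m z I (L.length + 1) := by
      rw [monL_cons]
      simp only
      by_cases hxy : x = y
      · subst hxy
        rw [← mul_assoc (edge _ _), edge_mul_self, zero_mul, mul_zero]
        exact zero_mem _
      have hvx : (Sum.inl v' : Vertex k j) ≠ x := fun h => by rw [h] at hx; exact lt_irrefl _ hx
      have hvy : (Sum.inl v' : Vertex k j) ≠ y := fun h => by rw [h] at hy; exact lt_irrefl _ hy
      rw [← mul_assoc, ← mul_assoc, mul_assoc (chi I), arnold hz I hvx hvy hxy hc hyc]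
      have e : chi (m := m) (z := z) I
            * (edge x y * (edge (Sum.inl v') y - edge (Sum.inl v') x)) * monL M
          = edge x y * (chi I * monL ((v', y) :: M) - chi I * monL ((v', x) :: M)) := by
        rw [← mul_sub, mul_chi_mul, monL_cons, monL_cons, ← sub_mul]
        simp only [mul_assoc]
      rw [e]
      have hW : chi (m := m) (z := z) I * monL ((v', y) :: M) - chi I * monL ((v', x) :: M)
          ∈ normalSpan m z I L.length :=
        sub_mem (Submodule.subset_span ⟨_, hN, hlen.symm, rfl⟩)
          (Submodule.subset_span ⟨_, hN', hlen.symm, rfl⟩)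
      generalize chi (m := m) (z := z) I * monL ((v', y) :: M) - chi I * monL ((v', x) :: M) = W
        at hW
      have hxyc : color I x = color I y := hc.symm.trans hyc
      -- The inductive hypothesis is applied at the higher of x and y; an edge between two sites is
      -- zero because both are constant.
      rcases x with x | s
      · rcases lt_trichotomy (rank y) (rank (j := j) (Sum.inl x)) with h | h | h
        · exact ih x.val (by simp [rank] at hx; omega) x rfl y h hxyc _ _ hW
        · rcases y with y | t
          · exact absurd (by simp [rank] at h; exact congr_arg Sum.inl (Fin.ext h.symm)) hxy
          · simp [rank] at h
        · rcases y with y | t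
          · rw [edge_comm]
            exact ih y.val (by simp [rank] at hy; omega) y rfl _ h hxyc.symm _ _ hW
          · simp [rank] at h
      · rcases y with y | t
        · rw [edge_comm]
          exact ih y.val (by simp [rank] at hy; omega) y rfl _ (by simp [rank]) hxyc.symm _ _ hW
        · rw [edge_site_site, zero_mul]
          exact zero_mem _
    rcases monL_perm (m := m) (z := z) hperm with h | h <;> rw [h]
    · exact main
    · rw [mul_neg, mul_neg]; exact neg_mem main
  · refine Submodule.subset_span ⟨(v, x) :: L, ⟨?_, ?_, ?_⟩, rfl, by rw [monL_cons]⟩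
    · exact List.nodup_cons.2 ⟨hmem, hL.nodup⟩
    · intro q hq
      rcases List.mem_cons.1 hq with rfl | hq
      · exact hx
      · exact hL.lower q hq
    · intro q hq
      rcases List.mem_cons.1 hq with rfl | hq
      · exact hc
      · exact hL.color_eq q hq

/-- The normal span is stable under multiplication by logarithmic forms. -/
theorem edge_mul_mem_normalSpan (hz : Function.Injective z) {I : j → Finset (Fin k)} (v : Fin k)
    (x : Vertex k j) (hx : Sum.inl v ≠ x) (hc : color I (Sum.inl v) = color I x) {q : ℕ}
    {w : StratumForm k m z j} (hw : w ∈ normalSpan m z I q) :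
    edge (Sum.inl v) x * w ∈ normalSpan m z I (q + 1) := by
  rcases x with x | s
  · rcases lt_trichotomy x v with h | h | h
    · exact chi_mul_edge_mul_mem hz I _ v rfl _ (by simpa [rank] using h) hc _ _ hw
    · exact absurd (congr_arg Sum.inl h.symm) hx
    · rw [edge_comm]
      exact chi_mul_edge_mul_mem hz I _ x rfl _ (by simpa [rank] using h) hc.symm _ _ hw
  · exact chi_mul_edge_mul_mem hz I _ v rfl _ (by simp [rank]) hc _ _ hw

theorem chi_mem_normalSpan (I : j → Finset (Fin k)) : chi I ∈ normalSpan m z I 0 :=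
  Submodule.subset_span ⟨[], ⟨by simp, by simp, by simp⟩, rfl, by simp [monL]⟩

/-! ### Skew-symmetrization of normal monomials -/

/-- All the neighbours of a vertex can be joined with the vertex to which it is joined. -/
theorem skewHom_star (hz : Function.Injective z) {I : j → Finset (Fin k)} (hI : DisjointI I)
    (x : Fin k) (Y : List (Fin k)) (p : Vertex k j) (hY : (x :: Y).Nodup)
    (hp : ∀ u ∈ x :: Y, Sum.inl u ≠ p)
    (hcol : ∀ u ∈ x :: Y, color I (Sum.inl u) = color I p) (T : StratumForm k m z j)
    (hT : ∀ y ∈ Y, permHom (Equiv.swap x y) T = T) :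
    ((Y.length : ℂ) + 1) • skewHom (chi I * (edge (Sum.inl x) p *
        (Y.map fun y => edge (Sum.inl y) (Sum.inl x)).prod * T))
      = skewHom (chi I * (edge (Sum.inl x) p * (Y.map fun y => edge (Sum.inl y) p).prod * T)) := by
  set W : StratumForm k m z j :=
    edge (Sum.inl x) p * (Y.map fun y => edge (Sum.inl y) (Sum.inl x)).prod with hW
  set S : StratumForm k m z j := edge (Sum.inl x) p * (Y.map fun y => edge (Sum.inl y) p).prod
  have hxY := (List.nodup_cons.1 hY).1
  have hYn := (List.nodup_cons.1 hY).2
  have hperm : ∀ y₀ ∈ Y, permHom (Equiv.swap x y₀) W = edge (Sum.inl y₀) p *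
      (Y.map fun y => edge (Sum.inl (Equiv.swap x y₀ y)) (Sum.inl y₀)).prod := by
    intro y₀ hy₀
    have hp' : vperm (Equiv.swap x y₀) p = p := by
      rcases p with p | s
      · rw [vperm_inl, Equiv.swap_apply_of_ne_of_ne]
        · exact fun h => hp x List.mem_cons_self (by rw [h])
        · exact fun h => hp y₀ (List.mem_cons_of_mem _ hy₀) (by rw [h])
      · rfl
    rw [hW, map_mul, permHom_edge, hp', vperm_inl, Equiv.swap_apply_left, map_list_prod,
      List.map_map]
    congr 2
    refine List.map_congr_left fun y _ => ?_
    simp [permHom_edge, vperm_inl]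
  -- This is `lagrange_list` at each point of the stratum, with the nodes u - p: the differences u -
  -- x are differences of nodes.
  have hid : chi I * W - ∑ y₀ ∈ Y.toFinset, chi I * permHom (Equiv.swap x y₀) W = chi I * S := by
    rw [← Finset.mul_sum, ← mul_sub]
    refine chi_mul_congr ?_
    rintro q rfl
    have hdist : ∀ u ∈ x :: Y, ∀ v ∈ x :: Y,
        vval q (Sum.inl u) - vval q p = vval q (Sum.inl v) - vval q p → u = v := by
      intro u hu v hv h
      by_contra hne
      exact vval_ne hz q (fun h => hne (Sum.inl_injective h)) ((hcol u hu).trans (hcol v hv).symm)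
        (sub_left_injective h)
    have hne0 : ∀ u ∈ x :: Y, vval q (Sum.inl u) - vval q p ≠ 0 := fun u hu =>
      sub_ne_zero.2 (vval_ne hz q (hp u hu) (hcol u hu))
    have hL := lagrange_list (A := Ext k)
      (fun u : Fin k => ExteriorAlgebra.ι ℂ (vdiff (Sum.inl u : Vertex k j) - vdiff p))
      (fun u => vval q (Sum.inl u) - vval q p)
      (fun u v => eq_neg_of_add_eq_zero_left (ExteriorAlgebra.ι_add_mul_swap _ _))
      (fun u => ExteriorAlgebra.ι_sq_zero _) x Y hY hdist hne0
    have hprod : ∀ (f : Fin k → StratumForm k m z j), (Y.map f).prod q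
        = (Y.map fun y => f y q).prod := by
      intro f
      rw [← Pi.evalRingHom_apply (fun _ => Ext k) q (Y.map f).prod, map_list_prod, List.map_map]
      rfl
    have hedge : ∀ u v : Vertex k j, edge (m := m) (z := z) u v q
        = (vval q u - vval q v)⁻¹ • ExteriorAlgebra.ι ℂ (vdiff u - vdiff v) := fun u v =>
      map_smul _ _ _
    rw [Pi.sub_apply, Finset.sum_apply, Finset.sum_congr rfl fun y₀ hy₀ => by
      rw [hperm y₀ (List.mem_toFinset.1 hy₀)]]
    simp only [hW, Pi.mul_apply, hprod, hedge, S]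
    simpa only [sub_sub_sub_cancel_right, ← map_sub] using hL
  clear_value W S
  have hchi : ∀ y₀ ∈ Y.toFinset,
      chi I * permHom (Equiv.swap x y₀) W * T = permHom (Equiv.swap x y₀) (chi I * (W * T)) := by
    intro y₀ hy₀
    have hy := List.mem_toFinset.1 hy₀
    rw [map_mul, map_mul, permHom_chi, mapI_swap hI, hT _ hy, mul_assoc]
    exact (hcol x List.mem_cons_self).trans (hcol y₀ (List.mem_cons_of_mem _ hy)).symm
  rw [← mul_assoc (chi I) S, ← hid, sub_mul, Finset.sum_mul, Finset.sum_congr rfl hchi, map_sub,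
    map_sum, mul_assoc]
  -- Each transposed copy of the left monomial contributes the negative of its skew-symmetrization.
  -- Being subtracted, the copies add up to the factor `Y.length + 1`.
  have : ∀ y₀ ∈ Y.toFinset, skewHom (permHom (Equiv.swap x y₀) (chi I * (W * T)))
      = -skewHom (chi I * (W * T)) := by
    intro y₀ hy₀
    rw [skewHom_permHom, csign_swap (ne_of_mem_of_not_mem (List.mem_toFinset.1 hy₀) hxY).symm,
      neg_one_smul]
  rw [Finset.sum_congr rfl this, Finset.sum_const, List.toFinset_card_of_nodup hYn,
    ← Nat.cast_smul_eq_nsmul ℂ]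
  module

variable (m z) in
/-- The span of the skew-symmetrizations of the products of the forms `d log x_i` and
`d log (t_i - z_b)` which are products of `q` factors. -/
def siteSpan (I : j → Finset (Fin k)) (q : ℕ) : Submodule ℂ (StratumForm k m z j) :=
  Submodule.span ℂ {w | ∃ L : List (Fin k × Vertex k j), Normal I L ∧ L.length = q ∧
    (∀ e ∈ L, ∀ x, e.2 ≠ Sum.inl x) ∧ w = skewHom (chi I * monL L)}

/-- Flattening of forests. The number t bounds the coordinates which occur as lower ends of edges.
If x is the largest one, its upper neighbours Y are leaves. When x has a lower neighbour p,
`skewHom_star` moves the leaves to p, up to a nonzero factor, and x ceases to be a lower end. When x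
is a root, the star around it has the skew-symmetrization zero. -/
theorem skewHom_monL_mem_siteSpan (hz : Function.Injective z) {I : j → Finset (Fin k)}
    (hI : DisjointI I) (t : ℕ) : ∀ L : List (Fin k × Vertex k j), Normal I L →
      (∀ e ∈ L, ∀ x : Fin k, e.2 = Sum.inl x → x.val < t) →
      skewHom (chi I * monL L) ∈ siteSpan m z I L.length := by
  induction t with
  | zero =>
    intro L hL hint
    exact Submodule.subset_span ⟨L, hL, rfl, fun e he x hx => by simpa using hint e he x hx, rfl⟩
  | succ t ih =>
  intro L hL hint
  by_cases hex : ∃ e ∈ L, ∃ x : Fin k, e.2 = Sum.inl x ∧ x.val = t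
  swap
  · push Not at hex
    exact ih L hL fun e he x hx => lt_of_le_of_ne (Nat.lt_succ_iff.1 (hint e he x hx))
      (hex e he x hx)
  obtain ⟨e₀, he₀, x, he₀x, hxt⟩ := hex
  classical
  set C := L.filter fun e => e.2 = Sum.inl x with hC
  set O := L.filter fun e => ¬ e.2 = Sum.inl x with hO
  set Y := C.map Prod.fst with hYdef
  have hCY : C = Y.map fun y => (y, Sum.inl x) := by
    rw [hYdef, List.map_map]
    conv_lhs => rw [← List.map_id C]
    refine List.map_congr_left fun e he => ?_
    have := (List.mem_filter.1 he).2
    exact Prod.ext rfl (by simpa using this)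
  have hLp : L.Perm (C ++ O) := by
    have := List.filter_append_perm (fun e : Fin k × Vertex k j => decide (e.2 = Sum.inl x)) L
    refine this.symm.trans ?_
    rw [hC, hO]
    simp
  have hN := hL.perm hLp
  have hint' : ∀ e ∈ C ++ O, ∀ x : Fin k, e.2 = Sum.inl x → x.val < t + 1 := fun e he =>
    hint e (hLp.mem_iff.2 he)
  have hOx : ∀ e ∈ O, e.2 ≠ Sum.inl x := fun e he => by simpa using (List.mem_filter.1 he).2
  have hlen := hLp.length_eq
  have hY0 : e₀.1 ∈ Y := List.mem_map_of_mem (List.mem_filter.2 ⟨he₀, by simpa using he₀x⟩)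
  clear_value C O Y
  subst hCY
  have hmonC : monL (m := m) (z := z) (Y.map fun y => (y, (Sum.inl x : Vertex k j)))
      = (Y.map fun y => edge (Sum.inl y) (Sum.inl x)).prod := by
    simp [monL, Function.comp_def]
  have hYlow : ∀ y ∈ Y, x < y := fun y hy => by
    have := hN.lower (y, Sum.inl x) (List.mem_append_left _ (List.mem_map.2 ⟨y, hy, rfl⟩))
    simpa [rank] using this
  have hYcol : ∀ y ∈ Y, color I (Sum.inl y) = color I (Sum.inl x) := fun y hy =>
    hN.color_eq (y, Sum.inl x) (List.mem_append_left _ (List.mem_map.2 ⟨y, hy, rfl⟩))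
  have hnd := hN.nodup
  rw [List.map_append, List.map_map] at hnd
  have hidm : (Prod.fst ∘ fun y : Fin k => (y, (Sum.inl x : Vertex k j))) = id := rfl
  rw [hidm, List.map_id] at hnd
  obtain ⟨hYn, hOn, hdisj⟩ := List.nodup_append.1 hnd
  have hxY : x ∉ Y := fun h => lt_irrefl _ (hYlow x h)
  have hswap : ∀ (D : List (Fin k × Vertex k j)), (∀ e ∈ D, e ∈ O ∧ e.1 ≠ x) → ∀ y ∈ Y,
      permHom (m := m) (z := z) (Equiv.swap x y) (monL D) = monL D := by
    intro D hD y hy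
    rw [permHom_monL]
    congr 1
    conv_rhs => rw [← List.map_id D]
    refine List.map_congr_left fun e he => ?_
    obtain ⟨heO, hex⟩ := hD e he
    refine Prod.ext ?_ ?_
    · refine Equiv.swap_apply_of_ne_of_ne hex fun h => ?_
      exact hdisj y hy e.1 (List.mem_map_of_mem heO) h.symm
    · change vperm _ e.2 = e.2
      rcases h2 : e.2 with u | s
      · have hux : u ≠ x := fun h => hOx e heO (by rw [h2, h])
        -- Lower ends have numbers at most t, and y lies above x, whose number is t; hence no edge
        -- ends in y.
        have huy : u ≠ y := fun h => by
          have h3 := hint' e (List.mem_append_right _ heO) u h2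
          have h4 := hYlow y hy
          rw [← h, Fin.lt_def] at h4
          omega
        rw [vperm_inl, Equiv.swap_apply_of_ne_of_ne hux huy]
      · rfl
  have main : skewHom (chi I * monL (Y.map (fun y => (y, Sum.inl x)) ++ O))
      ∈ siteSpan m z I L.length := by
    -- Either x is joined with some p and the leaves move there, or x is the root of its tree.
    by_cases hxO : x ∈ O.map Prod.fst
    · obtain ⟨⟨x', p⟩, hmem, hx'⟩ := List.mem_map.1 hxO
      simp only at hx'
      subst hx'
      obtain ⟨O₁, O₂, rfl⟩ := List.append_of_mem hmem
      have hpO : (O₁ ++ (x', p) :: O₂).Perm ((x', p) :: (O₁ ++ O₂)) := List.perm_middle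
      set D := O₁ ++ O₂ with hD
      have hpN := hN.perm (hpO.append_left _)
      have hxp := hpN.lower (x', p) (by simp)
      have hxpc := hpN.color_eq (x', p) (by simp)
      have hDO : ∀ e ∈ D, e ∈ O₁ ++ (x', p) :: O₂ ∧ e.1 ≠ x' := by
        intro e he
        refine ⟨hpO.mem_iff.2 (List.mem_cons_of_mem _ he), fun h => ?_⟩
        have := (hpO.map Prod.fst).nodup_iff.1 hOn
        rw [List.map_cons, List.nodup_cons] at this
        have he' := List.mem_map_of_mem (f := Prod.fst) he
        rw [h] at he'
        exact this.1 he'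
      have hpl : (Y.map (fun y => (y, (Sum.inl x' : Vertex k j))) ++ (O₁ ++ (x', p) :: O₂)).Perm
          ((x', p) :: (Y.map (fun y => (y, (Sum.inl x' : Vertex k j))) ++ D)) :=
        (hpO.append_left _).trans List.perm_middle
      have hnewN : Normal I ((x', p) :: (Y.map (fun y => (y, p)) ++ D)) := by
        have hold := hN.perm hpl
        refine ⟨?_, ?_, ?_⟩
        · have := hold.nodup
          simpa [Function.comp_def] using this
        · intro q hq
          rcases List.mem_cons.1 hq with rfl | hq
          · exact hxp
          rcases List.mem_append.1 hq with hq | hq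
          · obtain ⟨y, hy, rfl⟩ := List.mem_map.1 hq
            have := hYlow y hy
            refine hxp.trans ?_
            simpa [rank] using this
          · exact hold.lower q (by simp [hq])
        · intro q hq
          rcases List.mem_cons.1 hq with rfl | hq
          · exact hxpc
          rcases List.mem_append.1 hq with hq | hq
          · obtain ⟨y, hy, rfl⟩ := List.mem_map.1 hq
            exact (hYcol y hy).trans hxpc
          · exact hold.color_eq q (by simp [hq])
      have hnewint : ∀ e ∈ (x', p) :: (Y.map (fun y => (y, p)) ++ D), ∀ u : Fin k,
          e.2 = Sum.inl u → u.val < t := by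
        have hpt : ∀ u : Fin k, p = Sum.inl u → u.val < t := by
          rintro u rfl
          simp only [rank, Sum.elim_inl] at hxp
          omega
        intro e he u hu
        rcases List.mem_cons.1 he with rfl | he
        · exact hpt u hu
        rcases List.mem_append.1 he with he | he
        · obtain ⟨y, hy, rfl⟩ := List.mem_map.1 he
          exact hpt u hu
        · have h1 := hint' e (List.mem_append_right _ (hDO e he).1) u hu
          have h2 : u ≠ x' := fun h => hOx e (hDO e he).1 (by rw [hu, h])
          have h3 : u.val ≠ x'.val := fun h => h2 (Fin.ext h)
          omega
      have hstar := skewHom_star (m := m) hz hI x' Y p (List.nodup_cons.2 ⟨hxY, hYn⟩)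
        (fun u hu h => by
          have hup : rank p < rank (j := j) (Sum.inl u) := by
            rcases List.mem_cons.1 hu with rfl | hu
            · exact hxp
            · refine hxp.trans ?_
              simpa [rank] using hYlow u hu
          rw [h] at hup
          exact lt_irrefl _ hup)
        (fun u hu => by
          rcases List.mem_cons.1 hu with rfl | hu
          · exact hxpc
          · exact (hYcol u hu).trans hxpc)
        (monL D) (hswap D hDO)
      have hnew := ih _ hnewN hnewint
      have hlen' : ((x', p) :: (Y.map (fun y => (y, p)) ++ D)).length = L.length := by
        rw [hlen, hpl.length_eq]; simp
      rw [hlen'] at hnew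
      have e1 : monL (m := m) (z := z) ((x', p) :: (Y.map (fun y => (y, p)) ++ D))
          = edge (Sum.inl x') p * (Y.map fun y => edge (Sum.inl y) p).prod * monL D := by
        rw [monL_cons, monL_append, ← mul_assoc]
        simp [monL, Function.comp_def]
      have e2 : monL (m := m) (z := z)
          ((x', p) :: (Y.map (fun y => (y, (Sum.inl x' : Vertex k j))) ++ D))
          = edge (Sum.inl x') p * (Y.map fun y => edge (Sum.inl y) (Sum.inl x')).prod * monL D := by
        rw [monL_cons, monL_append, ← mul_assoc, hmonC]
      rw [← e1, ← e2] at hstar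
      have hne : ((Y.length : ℂ) + 1) ≠ 0 := Nat.cast_add_one_ne_zero _
      have hgoal : skewHom (chi (m := m) (z := z) I *
          monL ((x', p) :: (Y.map (fun y => (y, (Sum.inl x' : Vertex k j))) ++ D)))
          ∈ siteSpan m z I L.length := by
        rw [← hstar] at hnew
        exact (Submodule.smul_mem_iff _ hne).1 hnew
      rcases monL_perm (m := m) (z := z) hpl with h | h <;> rw [h]
      · exact hgoal
      · rw [mul_neg, map_neg]; exact neg_mem hgoal
    -- For a root x one leaf y₀ takes the part of p. The star around y₀ obtained in this way is the
    -- transposed original.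
    · rcases Y with _ | ⟨y₀, Y⟩
      · simp at hY0
      have hO' : ∀ e ∈ O, e ∈ O ∧ e.1 ≠ x := fun e he =>
        ⟨he, fun h => hxO (h ▸ List.mem_map_of_mem he)⟩
      have hT := hswap O hO'
      obtain ⟨hy₀Y, hYn'⟩ := List.nodup_cons.1 hYn
      rw [List.mem_cons, not_or] at hxY
      have hstar := skewHom_star (m := m) hz hI x Y (Sum.inl y₀)
        (List.nodup_cons.2 ⟨hxY.2, hYn'⟩)
        (fun u hu h => by
          rcases List.mem_cons.1 hu with rfl | hu
          · exact hxY.1 (Sum.inl_injective h)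
          · exact hy₀Y (Sum.inl_injective h ▸ hu))
        (fun u hu => by
          rcases List.mem_cons.1 hu with rfl | hu
          · exact (hYcol y₀ List.mem_cons_self).symm
          · exact (hYcol u (List.mem_cons_of_mem _ hu)).trans (hYcol y₀ List.mem_cons_self).symm)
        (monL O) (fun y hy => hT y (List.mem_cons_of_mem _ hy))
      have hw : monL (m := m) (z := z)
          ((y₀ :: Y).map (fun y => (y, (Sum.inl x : Vertex k j))) ++ O)
          = edge (Sum.inl x) (Sum.inl y₀) * (Y.map fun y => edge (Sum.inl y) (Sum.inl x)).prod
            * monL O := by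
        rw [monL_append, hmonC, List.map_cons, List.prod_cons, edge_comm]
      have hsw : permHom (Equiv.swap x y₀) (chi I * (edge (Sum.inl x) (Sum.inl y₀) *
            (Y.map fun y => edge (Sum.inl y) (Sum.inl x)).prod * monL O))
          = chi (m := m) (z := z) I * (edge (Sum.inl x) (Sum.inl y₀) *
            (Y.map fun y => edge (Sum.inl y) (Sum.inl y₀)).prod * monL O) := by
        rw [map_mul, map_mul, map_mul, permHom_chi, mapI_swap hI, hT _ List.mem_cons_self,
          permHom_edge, map_list_prod, List.map_map]
        · rw [vperm_inl, vperm_inl, Equiv.swap_apply_left, Equiv.swap_apply_right, edge_comm]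
          congr 4
          refine List.map_congr_left fun y hy => ?_
          rw [Function.comp_apply, permHom_edge, vperm_inl, vperm_inl, Equiv.swap_apply_left,
            Equiv.swap_apply_of_ne_of_ne (ne_of_mem_of_not_mem hy hxY.2)
              (ne_of_mem_of_not_mem hy hy₀Y)]
        · exact (hYcol y₀ List.mem_cons_self).symm
      rw [← hsw, skewHom_permHom, csign_swap hxY.1, ← hw] at hstar
      -- With r the number of the remaining leaves, r + 1 times the skew-symmetrization equals its
      -- negative, so r + 2 times it vanishes.
      have h0 : ((Y.length : ℂ) + 2) • skewHom (chi (m := m) (z := z) I * monL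
          ((y₀ :: Y).map (fun y => (y, (Sum.inl x : Vertex k j))) ++ O)) = 0 := by
        rw [show ((Y.length : ℂ) + 2) = ((Y.length : ℂ) + 1) - (-1) by ring, sub_smul, hstar,
          sub_self]
      have hne : ((Y.length : ℂ) + 2) ≠ 0 := by
        have := Nat.cast_add_one_ne_zero (R := ℂ) (Y.length + 1)
        push_cast at this
        rwa [show ((Y.length : ℂ) + 2) = Y.length + 1 + 1 by ring]
      have := (Submodule.smul_mem_iff (⊥ : Submodule ℂ (StratumForm k m z j)) hne).1
        (by rw [h0]; exact zero_mem _)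
      rw [(Submodule.mem_bot ℂ).1 this]
      exact zero_mem _
  rcases monL_perm (m := m) (z := z) hLp with h | h <;> rw [h]
  · exact main
  · rw [mul_neg, map_neg]; exact neg_mem main

theorem skewHom_mem_siteSpan (hz : Function.Injective z) {I : j → Finset (Fin k)}
    (hI : DisjointI I) {q : ℕ} {w : StratumForm k m z j} (hw : w ∈ normalSpan m z I q) :
    skewHom w ∈ siteSpan m z I q := by
  induction hw using Submodule.span_induction with
  | mem w h =>
    obtain ⟨L, hL, rfl, rfl⟩ := h
    exact skewHom_monL_mem_siteSpan hz hI k L hL fun _ _ x _ => x.2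
  | zero => rw [map_zero]; exact zero_mem _
  | add a b _ _ ha hb => rw [map_add]; exact add_mem ha hb
  | smul r a _ ha => rw [map_smul]; exact Submodule.smul_mem _ _ ha

/-- A product which does not involve two coordinates of the same color has the
skew-symmetrization zero. -/
theorem skewHom_monL_eq_zero {I : j → Finset (Fin k)} (hI : DisjointI I)
    {L : List (Fin k × Vertex k j)} (hL : ∀ e ∈ L, ∀ x, e.2 ≠ Sum.inl x) {i l : Fin k}
    (hil : i ≠ l) (hc : color I (Sum.inl i) = color I (Sum.inl l)) (hi : i ∉ L.map Prod.fst)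
    (hl : l ∉ L.map Prod.fst) : skewHom (chi (m := m) (z := z) I * monL L) = 0 := by
  refine skewHom_eq_zero_of_swap hil ?_
  rw [map_mul, permHom_chi, mapI_swap hI hc, permHom_monL]
  congr 2
  conv_rhs => rw [← List.map_id L]
  refine List.map_congr_left fun e he => Prod.ext ?_ ?_
  · exact Equiv.swap_apply_of_ne_of_ne (fun h => hi (h ▸ List.mem_map_of_mem he))
      fun h => hl (h ▸ List.mem_map_of_mem he)
  · change vperm _ e.2 = e.2
    rcases h2 : e.2 with u | s
    · exact absurd h2 (hL e he u)
    · rfl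

/-! ### Contraction with the Euler vector fields of the blocks -/

/-- The Euler vector field of the block `I_a`. -/
def eulerVec (a : j) (p : StratumPoint k m z j) : Sp k :=
  fun i => if i ∈ p.I a then p.x i else 0

/-- Evaluation of covectors. -/
def evalAt (v : Sp k) : Module.Dual ℂ (Sp k →L[ℂ] ℂ) :=
  (ContinuousLinearMap.apply ℂ ℂ v).toLinearMap

/-- Contraction with the Euler vector field of the block `I_a`. -/
def contr (a : j) : StratumForm k m z j →ₗ[ℂ] StratumForm k m z j where
  toFun η p := CliffordAlgebra.contractLeft (evalAt (eulerVec a p)) (η p)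
  map_add' η θ := by funext p; exact map_add _ _ _
  map_smul' r η := by
    funext p
    exact LinearMap.map_smul (CliffordAlgebra.contractLeft (evalAt (eulerVec a p))) r (η p)

theorem contr_apply (a : j) (η : StratumForm k m z j) (p : StratumPoint k m z j) :
    contr a η p = CliffordAlgebra.contractLeft (evalAt (eulerVec a p)) (η p) := rfl

theorem contr_one (a : j) : contr a (1 : StratumForm k m z j) = 0 := by
  funext p
  exact CliffordAlgebra.contractLeft_one ..

theorem contr_oneForm_mul_apply (a : j) (w : StratumPoint k m z j → (Sp k →L[ℂ] ℂ))
    (η : StratumForm k m z j) (p : StratumPoint k m z j) :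
    contr a (oneForm w * η) p = w p (eulerVec a p) • η p - oneForm w p * contr a η p :=
  CliffordAlgebra.contractLeft_ι_mul ..

theorem contr_chi_mul (a : j) (I : j → Finset (Fin k)) (η : StratumForm k m z j) :
    contr a (chi I * η) = chi I * contr a η := by
  funext p
  by_cases hp : p.I = I
  · simp [contr_apply, chi_of_eq hp]
  · simp [contr_apply, chi_of_ne hp]

theorem contr_contr (a b : j) (η : StratumForm k m z j) :
    contr a (contr b η) = -contr b (contr a η) := by
  funext p
  exact CliffordAlgebra.contractLeft_comm ..

theorem contractLeft_permPull (σ : Equiv.Perm (Fin k)) (v : Sp k) (w : Ext k) :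
    CliffordAlgebra.contractLeft (evalAt v) (permPull σ w)
      = permPull σ (CliffordAlgebra.contractLeft (evalAt (permMap σ v)) w) := by
  induction w using CliffordAlgebra.left_induction with
  | algebraMap r =>
    rw [CliffordAlgebra.contractLeft_algebraMap, map_zero]
    change CliffordAlgebra.contractLeft _ (permPull σ (algebraMap ℂ (Ext k) r)) = 0
    rw [AlgHom.commutes]
    exact CliffordAlgebra.contractLeft_algebraMap ..
  | add a b ha hb => simp only [map_add, ha, hb]
  | ι_mul w c hw =>
    have e : permPull σ (CliffordAlgebra.ι 0 c * w : Ext k)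
        = ExteriorAlgebra.ι ℂ (c.comp (permMap σ)) * permPull σ w := by
      rw [map_mul]
      congr 1
      exact permPull_ι σ c
    have e' : permPull σ (CliffordAlgebra.ι 0 c : Ext k)
        = ExteriorAlgebra.ι ℂ (c.comp (permMap σ)) := permPull_ι σ c
    rw [e, CliffordAlgebra.contractLeft_ι_mul, CliffordAlgebra.contractLeft_ι_mul, hw]
    refine Eq.trans ?_ (map_sub (permPull σ) _ _).symm
    congr 1
    · exact (map_smul (permPull σ) _ _).symm
    · refine Eq.trans ?_ (map_mul (permPull σ) _ _).symm
      rw [e']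

/-- The blocks move together with the coordinates, so a permutation carries the Euler field of block
a to the Euler field of block a. -/
theorem permHom_contr (σ : Equiv.Perm (Fin k)) (a : j) (η : StratumForm k m z j) :
    permHom σ (contr a η) = contr a (permHom σ η) := by
  funext p
  change permPull σ (contr a η (p.perm σ)) = contr a (permHom σ η) p
  rw [contr_apply, contr_apply]
  have : eulerVec a (p.perm σ) = permMap σ (eulerVec a p) := by
    funext i
    simp [eulerVec, permMap_apply, StratumPoint.perm, Finset.mem_map_equiv]
  rw [this, ← contractLeft_permPull]
  rfl

theorem contr_skewHom (a : j) (η : StratumForm k m z j) :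
    contr a (skewHom η) = skewHom (contr a η) := by
  simp only [skewHom_eq_sum, map_sum, map_smul, permHom_contr]

theorem vdiff_eulerVec (a : j) (p : StratumPoint k m z j) (u : Vertex k j) :
    vdiff u (eulerVec a p) = if color p.I u = some a then vval p u else 0 := by
  rcases u with i | a' | b
  · simp only [color_inl_eq_some (show DisjointI p.I from p.disjoint_I)]
    rfl
  · simp [vdiff, vval]
  · simp [vdiff, color]

/-- Euler's formula: inside block a the difference of two vertices is homogeneous of degree one, so
its logarithmic derivative along the Euler field is 1; vertices of another color are constant along
it. -/
theorem edgeCov_eulerVec (hz : Function.Injective z) (a : j) (p : StratumPoint k m z j)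
    {u v : Vertex k j} (huv : u ≠ v) (hc : color p.I u = color p.I v) :
    edgeCov u v p (eulerVec a p) = if color p.I u = some a then 1 else 0 := by
  have h := sub_ne_zero.2 (vval_ne hz p huv hc)
  rw [edgeCov, smul_apply, sub_apply, vdiff_eulerVec,
    vdiff_eulerVec, ← hc, smul_eq_mul]
  split_ifs
  · exact inv_mul_cancel₀ h
  · simp

theorem contr_edge_mul_same (hz : Function.Injective z) (I : j → Finset (Fin k)) {a : j}
    {u v : Vertex k j} (huv : u ≠ v) (hc : color I u = color I v) (ha : color I u = some a)
    (η : StratumForm k m z j) :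
    contr a (chi I * (edge u v * η)) = chi I * (η - edge u v * contr a η) := by
  rw [contr_chi_mul]
  refine chi_mul_congr ?_
  rintro p rfl
  rw [edge, contr_oneForm_mul_apply, edgeCov_eulerVec hz a p huv hc, if_pos ha, one_smul]
  rfl

theorem contr_edge_mul_other (hz : Function.Injective z) (I : j → Finset (Fin k)) {a : j}
    {u v : Vertex k j} (huv : u ≠ v) (hc : color I u = color I v) (ha : color I u ≠ some a)
    (η : StratumForm k m z j) :
    contr a (chi I * (edge u v * η)) = -(edge u v * contr a (chi I * η)) := by
  rw [contr_chi_mul, contr_chi_mul, mul_chi_mul, ← mul_neg]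
  refine chi_mul_congr ?_
  rintro p rfl
  rw [edge, contr_oneForm_mul_apply, edgeCov_eulerVec hz a p huv hc, if_neg ha, zero_smul,
    zero_sub]
  rfl

/-- Iterated contraction. -/
def contrs (l : List j) : StratumForm k m z j →ₗ[ℂ] StratumForm k m z j :=
  l.foldr (fun a T => contr a ∘ₗ T) LinearMap.id

theorem contrs_nil (η : StratumForm k m z j) : contrs [] η = η := rfl

theorem contrs_cons (a : j) (l : List j) (η : StratumForm k m z j) :
    contrs (a :: l) η = contr a (contrs l η) := rfl

theorem contrs_chi_mul (l : List j) (I : j → Finset (Fin k)) (η : StratumForm k m z j) :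
    contrs l (chi I * η) = chi I * contrs l η := by
  induction l with
  | nil => rfl
  | cons a l ih => rw [contrs_cons, ih, contr_chi_mul, contrs_cons]

theorem contrs_skewHom (l : List j) (η : StratumForm k m z j) :
    contrs l (skewHom η) = skewHom (contrs l η) := by
  induction l with
  | nil => rfl
  | cons a l ih => rw [contrs_cons, ih, contr_skewHom, contrs_cons]

theorem contr_contrs_eq_zero (a : j) (l : List j) {η : StratumForm k m z j}
    (h : contr a η = 0) : contr a (contrs l η) = 0 := by
  induction l with
  | nil => exact h
  | cons b l ih => rw [contrs_cons, contr_contr, ih, map_zero, neg_zero]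

theorem contrs_eq_zero {a : j} {l : List j} (ha : a ∈ l) {η : StratumForm k m z j}
    (h : contr a η = 0) : contrs l η = 0 := by
  induction l with
  | nil => simp at ha
  | cons b l ih =>
    rw [contrs_cons]
    rcases List.mem_cons.1 ha with rfl | ha
    · exact contr_contrs_eq_zero _ _ h
    · rw [ih ha, map_zero]

/-- Every form which is annihilated by the contractions is an iterated contraction. -/
theorem exists_contrs_eq (hz : Function.Injective z) {I : j → Finset (Fin k)} (hI : DisjointI I)
    (hne : ∀ a, (I a).Nonempty) (l : List j) (hl : l.Nodup) :
    ∀ (q : ℕ) (X : StratumForm k m z j), X ∈ normalSpan m z I q → (∀ a ∈ l, contr a X = 0) →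
      ∃ Y ∈ normalSpan m z I (q + l.length), contrs l Y = X := by
  induction l with
  | nil => exact fun q X hX _ => ⟨X, hX, rfl⟩
  | cons a l ih =>
    intro q X hX hk
    obtain ⟨hal, hl⟩ := List.nodup_cons.1 hl
    obtain ⟨i, hi⟩ := hne a
    have hc := (color_inl_eq_some hI).2 hi
    have hX0 := chi_mul_of_mem_normalSpan hX
    -- For i in I_a, d log x_i takes the value 1 on the Euler field of its block and 0 on the
    -- others. The other contractions still vanish on the product, and contraction at a returns X.
    have hX1 := edge_mul_mem_normalSpan hz i (Sum.inr (Sum.inl a)) (by simp) hc hX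
    obtain ⟨Y, hY, hYe⟩ := ih hl _ _ hX1 fun b hb => by
      have hba : color I (Sum.inl i) ≠ some b := by
        rw [hc]; exact fun h => hal (Option.some_inj.1 h ▸ hb)
      rw [← hX0, mul_chi_mul, contr_edge_mul_other hz I (by simp) hc hba, hX0,
        hk b (List.mem_cons_of_mem _ hb), mul_zero, neg_zero]
    refine ⟨Y, by rwa [List.length_cons, ← add_assoc, add_right_comm], ?_⟩
    rw [contrs_cons, hYe, ← hX0, mul_chi_mul, contr_edge_mul_same hz I (by simp) hc hc,
      hk a List.mem_cons_self, mul_zero, sub_zero]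

/-! ### The generators of the Orlik-Solomon spaces -/

variable (z) in
/-- The function of a vertex. -/
def vfun (u : Vertex k j) (x : Sp k) : ℂ := Sum.elim x (Sum.elim (fun _ => 0) z) u

theorem hasFDerivAt_vfun (u : Vertex k j) (x : Sp k) : HasFDerivAt (vfun z u) (vdiff u) x := by
  rcases u with i | a | b
  · exact hasFDerivAt_apply i x
  · exact hasFDerivAt_const _ _
  · exact hasFDerivAt_const _ _

theorem dlogCov_vfun_sub (u v : Vertex k j) (p : StratumPoint k m z j) :
    dlogCov (fun x => vfun z u x - vfun z v x) p.x = edgeCov u v p := by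
  rw [dlogCov, ((hasFDerivAt_vfun u p.x).fun_sub (hasFDerivAt_vfun v p.x)).fderiv]
  rfl

theorem dlog_vfun_sub (u v : Vertex k j) (p : StratumPoint k m z j) :
    dlog (fun x => vfun z u x - vfun z v x) p.x = edge u v p :=
  congr_arg _ (dlogCov_vfun_sub u v p)

theorem dlog_div {g₁ g₂ : Sp k → ℂ} {x : Sp k} (h₁ : DifferentiableAt ℂ g₁ x)
    (h₂ : DifferentiableAt ℂ g₂ x) (hg₁ : g₁ x ≠ 0) (hg₂ : g₂ x ≠ 0) :
    dlog (fun x => g₁ x / g₂ x) x = dlog g₁ x - dlog g₂ x := by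
  rw [dlog, dlog, dlog, ← map_sub]
  congr 1
  have h := h₁.hasFDerivAt.mul ((hasDerivAt_inv hg₂).comp_hasFDerivAt x h₂.hasFDerivAt)
  have e : (fun x => g₁ x / g₂ x) = g₁ * (Inv.inv ∘ g₂) := by
    funext y; simp [div_eq_mul_inv]
  rw [dlogCov, e, h.fderiv, dlogCov, dlogCov]
  ext v
  simp
  field_simp
  ring

theorem exists_vertex_of_mem_projEqs {I : j → Finset (Fin k)}
    (hI : DisjointI I) {a : j} {g : Sp k → ℂ} (hg : g ∈ projEqs (I a)) :
    ∃ (i : Fin k) (v : Vertex k j), Sum.inl i ≠ v ∧ color I (Sum.inl i) = some a ∧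
      color I v = some a ∧ g = fun x => vfun z (Sum.inl i : Vertex k j) x - vfun z v x := by
  rcases hg with ⟨i, hi, rfl⟩ | ⟨i, hi, l, hl, hil, rfl⟩
  · exact ⟨i, Sum.inr (Sum.inl a), by simp, (color_inl_eq_some hI).2 hi, rfl, by simp [vfun]⟩
  · exact ⟨i, Sum.inl l, by simpa using hil, (color_inl_eq_some hI).2 hi,
      (color_inl_eq_some hI).2 hl, by simp [vfun]⟩

theorem edge_mul_mem_and_contr (hz : Function.Injective z) {I : j → Finset (Fin k)}
    {i : Fin k} {v : Vertex k j} (hv : Sum.inl i ≠ v) (hc : color I (Sum.inl i) = none)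
    (hcv : color I v = none) {q : ℕ} {X : StratumForm k m z j} (hX : X ∈ normalSpan m z I q)
    (hX' : ∀ a, contr a X = 0) :
    edge (Sum.inl i) v * X ∈ normalSpan m z I (q + 1) ∧
      ∀ a, contr a (edge (Sum.inl i) v * X) = 0 := by
  refine ⟨edge_mul_mem_normalSpan hz i v hv (hc.trans hcv.symm) hX, fun a => ?_⟩
  rw [← chi_mul_of_mem_normalSpan hX, mul_chi_mul,
    contr_edge_mul_other hz I hv (hc.trans hcv.symm) (by rw [hc]; simp),
    chi_mul_of_mem_normalSpan hX, hX', mul_zero, neg_zero]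

/-- A generator d log(g₁/g₂) is a difference of two edges of one block. Both have the value 1 on the
Euler field of that block and 0 on the others, so the contractions of the difference vanish; the
remaining generators involve no block. -/
theorem osGens_mul_mem (hz : Function.Injective z) {I : j → Finset (Fin k)} (hI : DisjointI I)
    {w : Sp k → Ext k} (hw : w ∈ osGens z I) {q : ℕ} {X : StratumForm k m z j}
    (hX : X ∈ normalSpan m z I q) (hX' : ∀ a, contr a X = 0) :
    (fun p => w p.x) * X ∈ normalSpan m z I (q + 1) ∧ ∀ a, contr a ((fun p => w p.x) * X) = 0 := by
  have hX0 := chi_mul_of_mem_normalSpan hX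
  rcases hw with ⟨a, g₁, hg₁, g₂, hg₂, rfl⟩ | ⟨i, l, hi, hl, hil, rfl⟩ | ⟨i, b, hi, rfl⟩
  · obtain ⟨i, u, hu, ci, cu, rfl⟩ := exists_vertex_of_mem_projEqs (z := z) hI hg₁
    obtain ⟨l, v, hv, cl, cv, rfl⟩ := exists_vertex_of_mem_projEqs (z := z) hI hg₂
    have e : (fun p : StratumPoint k m z j => dlog (fun x =>
        (vfun z (Sum.inl i : Vertex k j) x - vfun z u x) /
          (vfun z (Sum.inl l : Vertex k j) x - vfun z v x)) p.x) * X
        = edge (Sum.inl i) u * X - edge (Sum.inl l) v * X := by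
      rw [← sub_mul]
      conv_lhs => rw [← hX0, mul_chi_mul]
      conv_rhs => rw [← hX0, mul_chi_mul]
      refine chi_mul_congr ?_
      rintro p rfl
      simp only [Pi.mul_apply, Pi.sub_apply]
      rw [dlog_div, dlog_vfun_sub, dlog_vfun_sub]
      · exact ((hasFDerivAt_vfun _ _).fun_sub (hasFDerivAt_vfun _ _)).differentiableAt
      · exact ((hasFDerivAt_vfun _ _).fun_sub (hasFDerivAt_vfun _ _)).differentiableAt
      · exact sub_ne_zero.2 (vval_ne hz p hu (ci.trans cu.symm))
      · exact sub_ne_zero.2 (vval_ne hz p hv (cl.trans cv.symm))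
    rw [e]
    refine ⟨sub_mem (edge_mul_mem_normalSpan hz i u hu (ci.trans cu.symm) hX)
      (edge_mul_mem_normalSpan hz l v hv (cl.trans cv.symm) hX), fun b => ?_⟩
    rw [← hX0, mul_chi_mul, mul_chi_mul, map_sub]
    by_cases hab : a = b
    · subst hab
      rw [contr_edge_mul_same hz I hu (ci.trans cu.symm) ci,
        contr_edge_mul_same hz I hv (cl.trans cv.symm) cl, hX', mul_zero, mul_zero, sub_self]
    · have hab' : some a ≠ some b := fun h => hab (Option.some_inj.1 h)
      rw [contr_edge_mul_other hz I hu (ci.trans cu.symm) (by rwa [ci]),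
        contr_edge_mul_other hz I hv (cl.trans cv.symm) (by rwa [cl]), hX0, hX', mul_zero,
        mul_zero, sub_self]
  · have e : (fun p : StratumPoint k m z j => dlog (fun x => x i - x l) p.x)
        = edge (Sum.inl i) (Sum.inl l) := funext fun p => dlog_vfun_sub (Sum.inl i) (Sum.inl l) p
    rw [e]
    exact edge_mul_mem_and_contr hz (by simpa using hil) (color_inl_eq_none.2 hi)
      (color_inl_eq_none.2 hl) hX hX'
  · have e : (fun p : StratumPoint k m z j => dlog (fun x => x i - z b) p.x)
        = edge (Sum.inl i) (Sum.inr (Sum.inr b)) :=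
      funext fun p => dlog_vfun_sub (Sum.inl i) (Sum.inr (Sum.inr b)) p
    rw [e]
    exact edge_mul_mem_and_contr hz (by simp) (color_inl_eq_none.2 hi) rfl hX hX'

/-- Products of generators are normal forms which descend from homogeneous coordinates to the
projective factors: the contractions annihilate them. -/
theorem extendZero_prod_mem (hz : Function.Injective z) {I : j → Finset (Fin k)}
    (hI : DisjointI I) (l : List (Sp k → Ext k)) (hl : ∀ w ∈ l, w ∈ osGens z I) :
    extendZero m z j I l.prod ∈ normalSpan m z I l.length ∧
      ∀ a, contr a (extendZero m z j I l.prod) = 0 := by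
  induction l with
  | nil =>
    exact ⟨chi_mem_normalSpan I, fun a => by
      have : extendZero m z j I ([] : List (Sp k → Ext k)).prod = chi I * 1 := (mul_one _).symm
      rw [this, contr_chi_mul, contr_one, mul_zero]⟩
  | cons w l ih =>
    obtain ⟨h1, h2⟩ := ih fun w' hw' => hl w' (List.mem_cons_of_mem _ hw')
    have e : extendZero m z j I (w :: l).prod
        = (fun p => w p.x) * extendZero m z j I l.prod := by
      rw [extendZero_eq, extendZero_eq, mul_chi_mul, List.prod_cons]
      rfl
    rw [e]
    exact osGens_mul_mem hz hI (hl w List.mem_cons_self) h1 h2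

/-! ### Labelings -/

theorem exists_perm_comp_eq {α β : Type*} [Fintype α] [DecidableEq β] (f g : α → β)
    (h : ∀ b, (Finset.univ.filter fun a => f a = b).card
      = (Finset.univ.filter fun a => g a = b).card) : ∃ σ : Equiv.Perm α, f ∘ σ = g := by
  have e : ∀ b, {a // g a = b} ≃ {a // f a = b} := fun b =>
    Fintype.equivOfCardEq (by rw [Fintype.card_subtype, Fintype.card_subtype, h])
  refine ⟨(Equiv.sigmaFiberEquiv g).symm.trans
    ((Equiv.sigmaCongrRight e).trans (Equiv.sigmaFiberEquiv f)), ?_⟩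
  funext a
  exact (e (g a) ⟨a, rfl⟩).2

/-- The number of unlabeled elements is forced by the numbers of the labeled ones. -/
theorem exists_perm_comp_eq_option {α S : Type*} [Fintype α] [Fintype S] [DecidableEq S]
    (f g : α → Option S) (h : ∀ s : S, (Finset.univ.filter fun a => f a = some s).card
      = (Finset.univ.filter fun a => g a = some s).card) : ∃ σ : Equiv.Perm α, f ∘ σ = g := by
  refine exists_perm_comp_eq f g fun b => ?_
  rcases b with _ | s
  · have key : ∀ f : α → Option S, (Finset.univ.filter fun a => f a = none).card
        + ∑ s : S, (Finset.univ.filter fun a => f a = some s).card = Fintype.card α := by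
      intro f
      rw [← Fintype.sum_option (fun o => (Finset.univ.filter fun a => f a = o).card),
        ← Finset.card_eq_sum_card_fiberwise (fun _ _ => Finset.mem_univ _), Finset.card_univ]
    have h1 := key f
    have h2 := key g
    rw [Finset.sum_congr rfl fun s _ => h s] at h1
    omega
  · exact h s

/-- The list of the edges of a labeling of the coordinates with sites. -/
def listOf (lam : Fin k → Option (j ⊕ Fin n)) : List (Fin k × Vertex k j) :=
  (List.finRange k).filterMap fun i => (lam i).map fun s => (i, Sum.inr s)

theorem mem_listOf {lam : Fin k → Option (j ⊕ Fin n)} {e : Fin k × Vertex k j} :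
    e ∈ listOf lam ↔ ∃ s, lam e.1 = some s ∧ e.2 = Sum.inr s := by
  simp only [listOf, List.mem_filterMap, List.mem_finRange, true_and, Option.map_eq_some_iff]
  constructor
  · rintro ⟨i, s, hs, rfl⟩
    exact ⟨s, hs, rfl⟩
  · rintro ⟨s, hs, he⟩
    exact ⟨e.1, s, hs, Prod.ext rfl he.symm⟩

theorem listOf_map_fst (lam : Fin k → Option (j ⊕ Fin n)) :
    (listOf lam).map Prod.fst = (List.finRange k).filter fun i => (lam i).isSome := by
  rw [listOf, List.map_filterMap, ← List.filterMap_eq_filter]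
  congr 1
  funext i
  rcases h : lam i with _ | s <;> simp [Option.guard, h]

theorem pairwise_listOf (lam : Fin k → Option (j ⊕ Fin n)) :
    (listOf lam).Pairwise fun e e' => e.1 < e'.1 := by
  have h : ((listOf lam).map Prod.fst).Pairwise (· < ·) := by
    rw [listOf_map_fst]
    exact (List.pairwise_lt_finRange k).filter _
  rwa [List.pairwise_map] at h

theorem nodup_listOf (lam : Fin k → Option (j ⊕ Fin n)) : (listOf lam).Nodup :=
  (pairwise_listOf lam).imp fun h h' => by rw [h'] at h; exact lt_irrefl _ h

/-- The sets of the coordinates whose labels are the origins of the blocks. -/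
def blocksOf (lam : Fin k → Option (j ⊕ Fin n)) (a : j) : Finset (Fin k) :=
  Finset.univ.filter fun i => lam i = some (Sum.inl a)

theorem mem_blocksOf {lam : Fin k → Option (j ⊕ Fin n)} {a : j} {i : Fin k} :
    i ∈ blocksOf lam a ↔ lam i = some (Sum.inl a) := by simp [blocksOf]

theorem mapI_blocksOf (lam : Fin k → Option (j ⊕ Fin n)) (σ : Equiv.Perm (Fin k)) :
    mapI σ (blocksOf (lam ∘ σ)) = blocksOf lam := by
  funext a
  ext i
  simp [mem_mapI, mem_blocksOf]

variable (m z) in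
/-- The monomial of a labeling. -/
def mono (lam : Fin k → Option (j ⊕ Fin n)) : StratumForm k m z j :=
  chi (blocksOf lam) * monL (listOf lam)

theorem permHom_mono (lam : Fin k → Option (j ⊕ Fin n)) (σ : Equiv.Perm (Fin k)) :
    permHom σ (mono m z (lam ∘ σ)) = mono m z lam ∨
      permHom σ (mono m z (lam ∘ σ)) = -mono m z lam := by
  have hp : ((listOf (lam ∘ σ)).map (Prod.map σ (vperm σ))).Perm (listOf lam) := by
    rw [List.perm_ext_iff_of_nodup _ (nodup_listOf lam)]
    · rintro ⟨i, u⟩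
      simp only [List.mem_map, mem_listOf, Prod.exists]
      constructor
      · rintro ⟨l, v, ⟨s, hs, rfl⟩, h⟩
        simp only [Prod.map_apply, vperm_inr, Prod.mk.injEq] at h
        exact ⟨s, by rw [← h.1]; exact hs, h.2.symm⟩
      · rintro ⟨s, hs, rfl⟩
        exact ⟨σ⁻¹ i, Sum.inr s, ⟨s, by simpa using hs, rfl⟩, by simp [vperm_inr]⟩
    · refine (nodup_listOf _).map_on ?_
      rintro ⟨i, u⟩ hi ⟨l, v⟩ hl h
      obtain ⟨s, -, rfl⟩ := mem_listOf.1 hi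
      obtain ⟨t, -, rfl⟩ := mem_listOf.1 hl
      simpa [vperm_inr] using h
  rw [mono, map_mul, permHom_chi, mapI_blocksOf, permHom_monL, mono]
  rcases monL_perm (m := m) (z := z) hp with h | h <;> rw [h]
  · exact Or.inl rfl
  · exact Or.inr (mul_neg _ _)

/-- Together with `exists_perm_comp_eq_option` this shows that, up to sign, only the number of
coordinates with each label matters. -/
theorem skewHom_mono_eq (lam : Fin k → Option (j ⊕ Fin n)) (σ : Equiv.Perm (Fin k)) :
    skewHom (mono m z lam) = skewHom (mono m z (lam ∘ σ)) ∨
      skewHom (mono m z lam) = -skewHom (mono m z (lam ∘ σ)) := by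
  have h := skewHom_permHom σ (mono m z (lam ∘ σ))
  have hs : csign σ = 1 ∨ csign σ = -1 := by
    rcases Int.units_eq_one_or (Equiv.Perm.sign σ) with h | h <;> simp [csign, h]
  rcases permHom_mono (m := m) (z := z) lam σ with h' | h' <;> rw [h'] at h <;>
    rcases hs with hs | hs <;> rw [hs] at h <;> simp only [one_smul, neg_one_smul, map_neg] at h
  · exact Or.inl h
  · exact Or.inr h
  · exact Or.inr (by rw [← h, neg_neg])
  · exact Or.inl (neg_injective h)

/-- A product of forms `d log x_i` and `d log (t_i - z_b)` which involves all the coordinates of the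
blocks is the monomial of a labeling. -/
theorem exists_labeling {I : j → Finset (Fin k)} (hI : DisjointI I)
    {L : List (Fin k × Vertex k j)} (hL : Normal I L) (hs : ∀ e ∈ L, ∀ x, e.2 ≠ Sum.inl x)
    (hfull : ∀ a, ∀ i ∈ I a, i ∈ L.map Prod.fst) :
    ∃ lam : Fin k → Option (j ⊕ Fin n), blocksOf lam = I ∧ (listOf lam).Perm L := by
  classical
  set lam : Fin k → Option (j ⊕ Fin n) := fun i =>
    if h : ∃ s, (i, Sum.inr s) ∈ L then some h.choose else none with hlam
  have huniq : ∀ i u v, (i, u) ∈ L → (i, v) ∈ L → u = v := by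
    intro i u v hu hv
    have := List.inj_on_of_nodup_map hL.nodup hu hv rfl
    exact congr_arg Prod.snd this
  have hmem : ∀ i s, lam i = some s ↔ (i, Sum.inr s) ∈ L := by
    intro i s
    constructor
    · intro h
      simp only [hlam] at h
      split_ifs at h with h'
      rw [← Option.some_inj.1 h]
      exact h'.choose_spec
    · intro h
      have h' : ∃ s, (i, (Sum.inr s : Vertex k j)) ∈ L := ⟨s, h⟩
      simp only [hlam]
      rw [dif_pos h', Sum.inr_injective (huniq i _ _ h'.choose_spec h)]
  refine ⟨lam, ?_, ?_⟩
  · funext a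
    ext i
    rw [mem_blocksOf, hmem]
    constructor
    · intro h
      exact (color_inl_eq_some hI).1 (hL.color_eq _ h)
    · intro h
      obtain ⟨⟨i', u⟩, he, rfl⟩ := List.mem_map.1 (hfull a i h)
      have hc := hL.color_eq _ he
      simp only at h hc ⊢
      rw [(color_inl_eq_some hI).2 h] at hc
      rcases u with x | a' | b
      · exact absurd rfl (hs _ he x)
      · simp only [color, Sum.elim_inr, Sum.elim_inl, Option.some.injEq] at hc
        rwa [hc]
      · simp [color] at hc
  · rw [List.perm_ext_iff_of_nodup (nodup_listOf lam) (List.Nodup.of_map _ hL.nodup)]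
    rintro ⟨i, u⟩
    rw [mem_listOf]
    constructor
    · rintro ⟨s, h1, h2⟩
      simp only at h2
      rw [h2]
      exact (hmem i s).1 h1
    · intro h
      rcases u with x | s
      · exact absurd rfl (hs _ h x)
      · exact ⟨s, (hmem i s).2 h, rfl⟩

theorem length_listOf (lam : Fin k → Option (j ⊕ Fin n)) :
    (listOf lam).length = ∑ s, (Finset.univ.filter fun i => lam i = some s).card := by
  classical
  have h1 : (listOf lam).length = (Finset.univ.filter fun i => (lam i).isSome).card := by
    rw [← List.length_map (f := Prod.fst), listOf_map_fst, ← List.toFinset_card_of_nodup]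
    · congr 1
      ext i
      simp
    · exact (List.nodup_finRange k).filter _
  have h2 : (Finset.univ.filter fun i => (lam i).isSome)
      = Finset.univ.biUnion fun s => Finset.univ.filter fun i => lam i = some s := by
    ext i
    simp [Option.isSome_iff_exists]
  rw [h1, h2, Finset.card_biUnion]
  intro s _ t _ hst
  rw [Function.onFun, Finset.disjoint_left]
  intro i hi ht
  simp only [Finset.mem_filter] at hi ht
  exact hst (Option.some_inj.1 (hi.2.symm.trans ht.2))

/-! ### Contraction of monomials -/

/-- By the Leibniz rule the contraction deletes, up to sign, one edge of color a at a time. -/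
theorem contr_chi_mul_monL_mem (hz : Function.Injective z) {I : j → Finset (Fin k)} (a : j)
    (L : List (Fin k × Vertex k j)) (hc : ∀ e ∈ L, color I (Sum.inl e.1) = color I e.2)
    (hs : ∀ e ∈ L, ∀ x, e.2 ≠ Sum.inl x) :
    contr a (chi I * monL L) ∈ Submodule.span ℂ {w : StratumForm k m z j | ∃ e L',
      color I (Sum.inl e.1) = some a ∧ L.Perm (e :: L') ∧ w = chi I * monL L'} := by
  induction L with
  | nil =>
    have : contr a (chi I * monL (m := m) (z := z) ([] : List (Fin k × Vertex k j))) = 0 := by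
      rw [contr_chi_mul]
      simp [monL, contr_one]
    rw [this]
    exact zero_mem _
  | cons e L ih =>
    have ih := ih (fun e' he' => hc e' (List.mem_cons_of_mem _ he'))
      fun e' he' => hs e' (List.mem_cons_of_mem _ he')
    have hce := hc e List.mem_cons_self
    have hse : (Sum.inl e.1 : Vertex k j) ≠ e.2 := fun h => hs e List.mem_cons_self e.1 h.symm
    have hmem : edge (Sum.inl e.1) e.2 * contr a (chi I * monL L) ∈
        Submodule.span ℂ {w : StratumForm k m z j | ∃ e' L',
          color I (Sum.inl e'.1) = some a ∧ (e :: L).Perm (e' :: L') ∧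
          w = chi I * monL L'} := by
      refine Submodule.span_induction (p := fun w _ => edge (Sum.inl e.1) e.2 * w ∈ _)
        ?_ ?_ ?_ ?_ ih
      · rintro _ ⟨e', L', h1, h2, rfl⟩
        refine Submodule.subset_span ⟨e', e :: L', h1, (h2.cons e).trans (List.Perm.swap ..), ?_⟩
        rw [mul_chi_mul, monL_cons]
      · rw [mul_zero]; exact zero_mem _
      · intro x y _ _ hx hy; rw [mul_add]; exact add_mem hx hy
      · intro r x _ hx; rw [mul_smul_comm]; exact Submodule.smul_mem _ _ hx
    rw [monL_cons]
    by_cases ha : color I (Sum.inl e.1) = some a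
    · rw [contr_edge_mul_same hz I hse hce ha, mul_sub, ← mul_chi_mul, ← contr_chi_mul]
      exact sub_mem (Submodule.subset_span ⟨e, L, ha, List.Perm.refl _, rfl⟩) hmem
    · rw [contr_edge_mul_other hz I hse hce ha]
      exact neg_mem hmem

/-- Every term of the contraction has lost the edge of a coordinate of block a and also misses i. A
monomial without two coordinates of the same color has the skew-symmetrization zero. -/
theorem contr_skewHom_monL_eq_zero (hz : Function.Injective z) {I : j → Finset (Fin k)}
    (hI : DisjointI I) {a : j} {i : Fin k} (hi : i ∈ I a) {L : List (Fin k × Vertex k j)}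
    (hL : Normal I L) (hs : ∀ e ∈ L, ∀ x, e.2 ≠ Sum.inl x) (hiL : i ∉ L.map Prod.fst) :
    contr a (skewHom (chi (m := m) (z := z) I * monL L)) = 0 := by
  rw [contr_skewHom]
  refine Submodule.span_induction (p := fun w _ => skewHom w = 0) ?_ ?_ ?_ ?_
    (contr_chi_mul_monL_mem hz a L hL.color_eq hs)
  · rintro _ ⟨e, L', he, hp, rfl⟩
    have hnd := (hL.perm hp).nodup
    rw [List.map_cons, List.nodup_cons] at hnd
    have hi' : i ∉ (e :: L').map Prod.fst := fun h => hiL ((hp.map _).mem_iff.2 h)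
    rw [List.map_cons, List.mem_cons, not_or] at hi'
    exact skewHom_monL_eq_zero hI
      (fun e' he' => hs e' (hp.mem_iff.2 (List.mem_cons_of_mem _ he'))) hi'.1
      (((color_inl_eq_some hI).2 hi).trans he.symm) hi'.2 hnd.1
  · exact map_zero _
  · intro x y _ _ hx hy; rw [map_add, hx, hy, add_zero]
  · intro r x _ hx; rw [map_smul, hx, smul_zero]

/-! ### The base labelings -/

variable (k m j) in
/-- The consecutive segments of lengths `K_b` after the blocks. -/
def siteBlock (K : Fin n → ℕ) (b : Fin n) : Finset (Fin k) :=
  Finset.univ.filter fun i : Fin k =>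
    blockTotal m j + ∑ c ∈ Finset.Iio b, K c ≤ i.val ∧
      i.val < blockTotal m j + (∑ c ∈ Finset.Iio b, K c) + K b

theorem mem_siteBlock {K : Fin n → ℕ} {b : Fin n} {i : Fin k} : i ∈ siteBlock k m j K b ↔
    blockTotal m j + ∑ c ∈ Finset.Iio b, K c ≤ i.val ∧
      i.val < blockTotal m j + (∑ c ∈ Finset.Iio b, K c) + K b := by simp [siteBlock]

theorem mem_baseBlock {a : Fin n} {i : Fin k} : i ∈ baseBlock k m j a ↔
    blockTotal m (j.filter (· < a)) ≤ i.val ∧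
      i.val < blockTotal m (j.filter (· < a)) + (m a + 1) := by simp [baseBlock]

theorem blockTotal_filter_add_le {a : Fin n} (ha : a ∈ j) {t : Finset (Fin n)}
    (ht : ∀ b ∈ j, b ≤ a → b ∈ t) :
    blockTotal m (j.filter (· < a)) + (m a + 1) ≤ blockTotal m t := by
  have h1 : a ∉ j.filter (· < a) := by simp
  rw [blockTotal, add_comm, ← Finset.sum_insert h1 (f := fun a => m a + 1)]
  refine Finset.sum_le_sum_of_subset fun b hb => ?_
  rcases Finset.mem_insert.1 hb with rfl | hb
  · exact ht _ ha le_rfl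
  · exact ht b (Finset.mem_filter.1 hb).1 (Finset.mem_filter.1 hb).2.le

theorem sum_Iio_add_le (K : Fin n → ℕ) {a : Fin n} {t : Finset (Fin n)}
    (ht : ∀ b, b ≤ a → b ∈ t) : (∑ c ∈ Finset.Iio a, K c) + K a ≤ ∑ c ∈ t, K c := by
  have h1 : a ∉ Finset.Iio a := by simp
  rw [add_comm, ← Finset.sum_insert h1 (f := K)]
  refine Finset.sum_le_sum_of_subset fun b hb => ?_
  rcases Finset.mem_insert.1 hb with rfl | hb
  · exact ht _ le_rfl
  · exact ht b (Finset.mem_Iio.1 hb).le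

theorem baseBlock_lt_baseBlock {a b : Fin n} (ha : a ∈ j) (hab : a < b) {i l : Fin k}
    (hi : i ∈ baseBlock k m j a) (hl : l ∈ baseBlock k m j b) : i < l := by
  rw [mem_baseBlock] at hi hl
  have := blockTotal_filter_add_le (m := m) ha (t := j.filter (· < b))
    fun c hc hca => Finset.mem_filter.2 ⟨hc, hca.trans_lt hab⟩
  rw [Fin.lt_def]
  omega

theorem lt_blockTotal_of_mem_baseBlock {a : Fin n} (ha : a ∈ j) {i : Fin k}
    (hi : i ∈ baseBlock k m j a) : i.val < blockTotal m j := by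
  rw [mem_baseBlock] at hi
  have := blockTotal_filter_add_le (m := m) ha (t := j) fun c hc _ => hc
  omega

theorem siteBlock_lt_siteBlock {K : Fin n → ℕ} {a b : Fin n} (hab : a < b) {i l : Fin k}
    (hi : i ∈ siteBlock k m j K a) (hl : l ∈ siteBlock k m j K b) : i < l := by
  rw [mem_siteBlock] at hi hl
  have := sum_Iio_add_le K (t := Finset.Iio b) fun c (hc : c ≤ a) =>
    Finset.mem_Iio.2 (hc.trans_lt hab)
  rw [Fin.lt_def]
  omega

theorem lt_of_mem_siteBlock {K : Fin n → ℕ} {b : Fin n} {i : Fin k}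
    (hi : i ∈ siteBlock k m j K b) : i.val < blockTotal m j + ∑ c, K c := by
  rw [mem_siteBlock] at hi
  have := sum_Iio_add_le K (a := b) (t := Finset.univ) fun c _ => Finset.mem_univ c
  omega

theorem baseBlock_lt_siteBlock {K : Fin n → ℕ} {a b : Fin n} (ha : a ∈ j) {i l : Fin k}
    (hi : i ∈ baseBlock k m j a) (hl : l ∈ siteBlock k m j K b) : i < l := by
  have h1 := lt_blockTotal_of_mem_baseBlock ha hi
  rw [mem_siteBlock] at hl
  rw [Fin.lt_def]
  omega

variable (k m j) in
open scoped Classical in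
/-- The labeling of the form `θ_K`. -/
def baseLabel (K : Fin n → ℕ) (i : Fin k) : Option (j ⊕ Fin n) :=
  if h : ∃ a : j, i ∈ baseBlock k m j a then some (Sum.inl h.choose)
  else if h : ∃ b, i ∈ siteBlock k m j K b then some (Sum.inr h.choose) else none

theorem baseLabel_eq_inl {K : Fin n → ℕ} {i : Fin k} {a : j} :
    baseLabel k m j K i = some (Sum.inl a) ↔ i ∈ baseBlock k m j a := by
  rw [baseLabel]
  constructor
  · intro h
    split_ifs at h with h1 h2
    · rw [← Sum.inl_injective (Option.some_inj.1 h)]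
      exact h1.choose_spec
    · simp at h
  · intro h
    have h1 : ∃ a : j, i ∈ baseBlock k m j a := ⟨a, h⟩
    rw [dif_pos h1]
    congr 2
    have hc := h1.choose_spec
    rcases lt_trichotomy h1.choose a with hlt | heq | hlt
    · exact absurd (baseBlock_lt_baseBlock h1.choose.2 hlt hc h) (lt_irrefl _)
    · exact heq
    · exact absurd (baseBlock_lt_baseBlock a.2 hlt h hc) (lt_irrefl _)

theorem baseLabel_eq_inr {K : Fin n → ℕ} {i : Fin k} {b : Fin n} :
    baseLabel k m j K i = some (Sum.inr b) ↔ i ∈ siteBlock k m j K b := by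
  rw [baseLabel]
  constructor
  · intro h
    split_ifs at h with h1 h2
    · simp at h
    · rw [← Sum.inr_injective (Option.some_inj.1 h)]
      exact h2.choose_spec
  · intro h
    have h1 : ¬ ∃ a : j, i ∈ baseBlock k m j a := by
      rintro ⟨a, ha⟩
      exact lt_irrefl _ (baseBlock_lt_siteBlock a.2 ha h)
    have h2 : ∃ b, i ∈ siteBlock k m j K b := ⟨b, h⟩
    rw [dif_neg h1, dif_pos h2]
    congr 2
    have hc := h2.choose_spec
    rcases lt_trichotomy h2.choose b with hlt | heq | hlt
    · exact absurd (siteBlock_lt_siteBlock hlt hc h) (lt_irrefl _)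
    · exact heq
    · exact absurd (siteBlock_lt_siteBlock hlt h hc) (lt_irrefl _)

theorem card_filter_segment {lo len : ℕ} (h : lo + len ≤ k) :
    (Finset.univ.filter fun i : Fin k => lo ≤ i.val ∧ i.val < lo + len).card = len := by
  have : (Finset.univ.filter fun i : Fin k => lo ≤ i.val ∧ i.val < lo + len).map Fin.valEmbedding
      = Finset.Ico lo (lo + len) := by
    ext q
    simp only [Finset.mem_map, Finset.mem_filter, Finset.mem_univ, true_and, Fin.valEmbedding_apply,
      Finset.mem_Ico]
    constructor
    · rintro ⟨i, hi, rfl⟩; exact hi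
    · intro hq; exact ⟨⟨q, by omega⟩, hq, rfl⟩
  rw [← Finset.card_map Fin.valEmbedding, this, Nat.card_Ico, Nat.add_sub_cancel_left]

theorem card_baseBlock (hjk : blockTotal m j ≤ k) {a : Fin n} (ha : a ∈ j) :
    (baseBlock k m j a).card = m a + 1 :=
  card_filter_segment
    ((blockTotal_filter_add_le (m := m) ha (t := j) fun _ hc _ => hc).trans hjk)

theorem card_siteBlock {K : Fin n → ℕ} (hK : blockTotal m j + ∑ c, K c ≤ k) (b : Fin n) :
    (siteBlock k m j K b).card = K b := by
  refine card_filter_segment ?_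
  have := sum_Iio_add_le K (a := b) (t := Finset.univ) fun c _ => Finset.mem_univ c
  omega

variable (k m j) in
/-- The blocks of the stratum of `θ_K`. -/
def baseI (a : j) : Finset (Fin k) := baseBlock k m j a

theorem blocksOf_baseLabel (K : Fin n → ℕ) : blocksOf (baseLabel k m j K) = baseI k m j := by
  funext a
  ext i
  rw [mem_blocksOf, baseLabel_eq_inl, baseI]

theorem sum_blocks (j : Finset (Fin n)) (m : Fin n → ℕ) :
    ∑ a : j, (m a + 1) = blockTotal m j := Finset.sum_coe_sort j fun a => m a + 1

/-- The list of the indices of the blocks. -/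
def blockList (j : Finset (Fin n)) : List j :=
  (j.sort (· ≤ ·)).pmap Subtype.mk fun _ ha => (Finset.mem_sort _).1 ha

theorem blockList_map_val (j : Finset (Fin n)) :
    (blockList j).map Subtype.val = j.sort (· ≤ ·) := by
  rw [blockList, List.map_pmap]
  simp

theorem pairwise_blockList (j : Finset (Fin n)) : (blockList j).Pairwise (· < ·) := by
  have h : ((blockList j).map Subtype.val).Pairwise (· < ·) := by
    rw [blockList_map_val]
    exact Finset.sortedLT_sort j |>.pairwise
  rwa [List.pairwise_map] at h

theorem nodup_blockList (j : Finset (Fin n)) : (blockList j).Nodup :=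
  (pairwise_blockList j).imp fun h => h.ne

theorem length_blockList (j : Finset (Fin n)) : (blockList j).length = j.card := by
  rw [← List.length_map (f := Subtype.val), blockList_map_val, Finset.length_sort]

theorem mem_blockList (a : j) : a ∈ blockList j := by
  have : a.val ∈ (blockList j).map Subtype.val := by
    rw [blockList_map_val]; exact (Finset.mem_sort _).2 a.2
  obtain ⟨b, hb, hab⟩ := List.mem_map.1 this
  rwa [← Subtype.ext hab]

/-- The iterated contractions of the skew-symmetrized products are multiples of those of the
basic ones. -/
theorem contrs_mem_span (hz : Function.Injective z) (hjk : blockTotal m j ≤ k)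
    {I : j → Finset (Fin k)} (hI : DisjointI I) (hcard : ∀ a, (I a).card = m a + 1) {q : ℕ}
    (hq : q ≤ k)
    {w : StratumForm k m z j} (hw : w ∈ siteSpan m z I q) :
    contrs (blockList j) w ∈ Submodule.span ℂ {v | ∃ K : Fin n → ℕ, blockTotal m j + ∑ b, K b = q ∧
      v = contrs (blockList j) (skewHom (mono m z (baseLabel k m j K)))} := by
  induction hw using Submodule.span_induction with
  | zero => rw [map_zero]; exact zero_mem _
  | add a b _ _ ha hb => rw [map_add]; exact add_mem ha hb
  | smul r a _ ha => rw [map_smul]; exact Submodule.smul_mem _ _ ha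
  | mem w h =>
  obtain ⟨L, hL, rfl, hs, rfl⟩ := h
  by_cases hfull : ∀ a, ∀ i ∈ I a, i ∈ L.map Prod.fst
  swap
  -- One contraction already annihilates the form when a coordinate of its block is missing, and
  -- contractions anticommute.
  · push Not at hfull
    obtain ⟨a, i, hi, hiL⟩ := hfull
    rw [contrs_eq_zero (mem_blockList a) (contr_skewHom_monL_eq_zero hz hI hi hL hs hiL)]
    exact zero_mem _
  obtain ⟨lam, hlam, hp⟩ := exists_labeling hI hL hs hfull
  set K : Fin n → ℕ := fun b => (Finset.univ.filter fun i => lam i = some (Sum.inr b)).card with hK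
  have hinl : ∀ a, (Finset.univ.filter fun i => lam i = some (Sum.inl a)).card = m a + 1 := by
    intro a
    rw [← hcard a, ← hlam]
    rfl
  have hsum : blockTotal m j + ∑ b, K b = L.length := by
    rw [← hp.length_eq, length_listOf, Fintype.sum_sum_type, Finset.sum_congr rfl fun a _ => hinl a,
      sum_blocks]
  -- Both labelings have m_a + 1 labels at each origin and K_b at each z_b, so they differ by a
  -- permutation.
  obtain ⟨σ, hσ⟩ := exists_perm_comp_eq_option lam (baseLabel k m j K) fun s => by
    rcases s with a | b
    · rw [hinl, ← card_baseBlock hjk a.2]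
      congr 1
      ext i
      simp [baseLabel_eq_inl]
    · have h1 := card_siteBlock (k := k) (m := m) (j := j) (K := K) (by rw [hsum]; exact hq) b
      refine h1.symm.trans ?_
      congr 1
      ext i
      simp [baseLabel_eq_inr]
  have hw : ∃ r : ℂ, skewHom (chi (m := m) (z := z) I * monL L)
      = r • skewHom (mono m z (baseLabel k m j K)) := by
    have h1 : ∃ r : ℂ, skewHom (chi (m := m) (z := z) I * monL L)
        = r • skewHom (mono m z lam) := by
      rw [mono, hlam]
      rcases monL_perm (m := m) (z := z) hp with h | h <;> rw [h]
      · exact ⟨1, (one_smul _ _).symm⟩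
      · exact ⟨-1, by rw [mul_neg, map_neg, neg_one_smul, neg_neg]⟩
    obtain ⟨r, hr⟩ := h1
    rcases skewHom_mono_eq (m := m) (z := z) lam σ with h | h <;> rw [h, hσ] at hr
    · exact ⟨r, hr⟩
    · exact ⟨-r, by rw [hr, smul_neg, neg_smul]⟩
  obtain ⟨r, hr⟩ := hw
  rw [hr, map_smul]
  exact Submodule.smul_mem _ _ (Submodule.subset_span ⟨K, hsum, rfl⟩)

/-! ### The forms `θ_K` as iterated contractions -/

/-- The edges which join the elements of a set of coordinates with a site. -/
def siteEdges (S : Finset (Fin k)) (s : j ⊕ Fin n) : List (Fin k × Vertex k j) :=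
  (S.sort (· ≤ ·)).map fun i => (i, Sum.inr s)

theorem mem_siteEdges {S : Finset (Fin k)} {s : j ⊕ Fin n} {e : Fin k × Vertex k j} :
    e ∈ siteEdges S s ↔ e.1 ∈ S ∧ e.2 = Sum.inr s := by
  simp only [siteEdges, List.mem_map, Finset.mem_sort]
  constructor
  · rintro ⟨i, hi, rfl⟩; exact ⟨hi, rfl⟩
  · rintro ⟨h1, h2⟩; exact ⟨e.1, h1, Prod.ext rfl h2.symm⟩

theorem pairwise_siteEdges (S : Finset (Fin k)) (s : j ⊕ Fin n) :
    (siteEdges S s).Pairwise fun e e' => e.1 < e'.1 := by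
  rw [siteEdges, List.pairwise_map]
  exact (Finset.sortedLT_sort S).pairwise

/-- Both lists are strictly increasing in the coordinate and have the same members, so even the
order of the factors agrees. This makes the sign in `exists_baseForm_eq` independent of K. -/
theorem listOf_baseLabel (K : Fin n → ℕ) : listOf (baseLabel k m j K)
    = (blockList j).flatMap (fun a : j => siteEdges (baseBlock k m j a) (Sum.inl a)) ++
      (List.finRange n).flatMap fun b => siteEdges (siteBlock k m j K b) (Sum.inr b) := by
  have hp1 : ((blockList j).flatMap fun a : j =>
      siteEdges (baseBlock k m j a) (Sum.inl a : j ⊕ Fin n)).Pairwise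
        fun e e' => e.1 < e'.1 := by
    rw [List.pairwise_flatMap]
    refine ⟨fun a _ => pairwise_siteEdges _ _, ?_⟩
    refine (pairwise_blockList j).imp ?_
    intro a b hab e he e' he'
    exact baseBlock_lt_baseBlock a.2 hab (mem_siteEdges.1 he).1 (mem_siteEdges.1 he').1
  have hp2 : ((List.finRange n).flatMap fun b =>
      siteEdges (j := j) (siteBlock k m j K b) (Sum.inr b)).Pairwise
        fun e e' => e.1 < e'.1 := by
    rw [List.pairwise_flatMap]
    refine ⟨fun a _ => pairwise_siteEdges _ _, ?_⟩
    refine (List.pairwise_lt_finRange n).imp ?_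
    intro a b hab e he e' he'
    exact siteBlock_lt_siteBlock hab (mem_siteEdges.1 he).1 (mem_siteEdges.1 he').1
  have hp : ((blockList j).flatMap (fun a : j => siteEdges (baseBlock k m j a) (Sum.inl a)) ++
      (List.finRange n).flatMap fun b =>
        siteEdges (siteBlock k m j K b) (Sum.inr b : j ⊕ Fin n)).Pairwise
        fun (e e' : Fin k × Vertex k j) => e.1 < e'.1 := by
    rw [List.pairwise_append]
    refine ⟨hp1, hp2, ?_⟩
    intro e he e' he'
    obtain ⟨a, -, ha⟩ := List.mem_flatMap.1 he
    obtain ⟨b, -, hb⟩ := List.mem_flatMap.1 he'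
    exact baseBlock_lt_siteBlock a.2 (mem_siteEdges.1 ha).1 (mem_siteEdges.1 hb).1
  refine List.Perm.eq_of_pairwise (fun e e' _ _ h h' => absurd (h.trans h') (lt_irrefl _))
    (pairwise_listOf _) hp ?_
  rw [List.perm_ext_iff_of_nodup (nodup_listOf _)
    (hp.imp fun h h' => by rw [h'] at h; exact lt_irrefl _ h)]
  rintro ⟨i, u⟩
  simp only [mem_listOf, List.mem_append, List.mem_flatMap, mem_siteEdges, mem_blockList, true_and,
    List.mem_finRange]
  constructor
  · rintro ⟨a | b, h, rfl⟩
    · exact Or.inl ⟨a, baseLabel_eq_inl.1 h, rfl⟩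
    · exact Or.inr ⟨b, baseLabel_eq_inr.1 h, rfl⟩
  · rintro (⟨a, h, rfl⟩ | ⟨b, h, rfl⟩)
    · exact ⟨_, baseLabel_eq_inl.2 h, rfl⟩
    · exact ⟨_, baseLabel_eq_inr.2 h, rfl⟩

theorem monL_flatMap {β : Type*} (l : List β) (f : β → List (Fin k × Vertex k j)) :
    monL (m := m) (z := z) (l.flatMap f) = (l.map fun b => monL (f b)).prod := by
  induction l with
  | nil => rfl
  | cons b l ih => rw [List.flatMap_cons, monL_append, ih, List.map_cons, List.prod_cons]

theorem contr_monL_mul (hz : Function.Injective z) {I : j → Finset (Fin k)} {a : j}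
    (L : List (Fin k × Vertex k j))
    (hL : ∀ e ∈ L, Sum.inl e.1 ≠ e.2 ∧ color I (Sum.inl e.1) = color I e.2 ∧
      color I (Sum.inl e.1) ≠ some a) (X : StratumForm k m z j) :
    contr a (chi I * (monL L * X)) = (-1 : ℂ) ^ L.length • (monL L * contr a (chi I * X)) := by
  induction L with
  | nil => simp [monL]
  | cons e L ih =>
    have ih := ih fun e' he' => hL e' (List.mem_cons_of_mem _ he')
    obtain ⟨h1, h2, h3⟩ := hL e List.mem_cons_self
    rw [monL_cons, mul_assoc, contr_edge_mul_other hz I h1 h2 h3, ih, List.length_cons, pow_succ,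
      mul_smul_comm, mul_assoc, mul_neg_one, neg_smul]

theorem contrs_monL_mul (hz : Function.Injective z) {I : j → Finset (Fin k)} (l : List j)
    (L : List (Fin k × Vertex k j))
    (hL : ∀ e ∈ L, Sum.inl e.1 ≠ e.2 ∧ color I (Sum.inl e.1) = color I e.2 ∧
      ∀ a ∈ l, color I (Sum.inl e.1) ≠ some a) (X : StratumForm k m z j) :
    contrs l (chi I * (monL L * X))
      = (-1 : ℂ) ^ (L.length * l.length) • (monL L * contrs l (chi I * X)) := by
  induction l with
  | nil => simp [contrs_nil, mul_chi_mul]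
  | cons a l ih =>
    have ih := ih fun e he => ⟨(hL e he).1, (hL e he).2.1, fun b hb =>
      (hL e he).2.2 b (List.mem_cons_of_mem _ hb)⟩
    have h1 : contrs l (chi I * X) = chi I * contrs l X := contrs_chi_mul _ _ _
    rw [contrs_cons, ih, map_smul, h1, mul_chi_mul, contr_monL_mul hz L fun e he =>
      ⟨(hL e he).1, (hL e he).2.1, (hL e he).2.2 a List.mem_cons_self⟩, smul_smul, ← h1, contrs_cons,
      List.length_cons, mul_add, mul_one, pow_add]

theorem disjointI_baseI : DisjointI (baseI k m j) := by
  intro a b hab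
  rw [Finset.disjoint_left]
  intro i hi hl
  rcases lt_or_gt_of_ne hab with h | h
  · exact lt_irrefl _ (baseBlock_lt_baseBlock a.2 h hi hl)
  · exact lt_irrefl _ (baseBlock_lt_baseBlock b.2 h hl hi)

/-- The difference of two forms `d log x_i`. -/
def edgeDiff (a : j) (i l : Fin k) : StratumForm k m z j :=
  edge (Sum.inl i) (Sum.inr (Sum.inl a)) - edge (Sum.inl l) (Sum.inr (Sum.inl a))

/-- The difference has the value 1 - 1 = 0 on the Euler field of its own block and 0 - 0 on the
others. -/
theorem contr_edgeDiff_mul (hz : Function.Injective z) {I : j → Finset (Fin k)} {a : j}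
    {i l : Fin k} (hi : color I (Sum.inl i) = some a) (hl : color I (Sum.inl l) = some a) (c : j)
    (X : StratumForm k m z j) :
    contr c (chi I * (edgeDiff a i l * X)) = -(edgeDiff a i l * contr c (chi I * X)) := by
  rw [edgeDiff, sub_mul, mul_sub, map_sub]
  by_cases hac : some a = some c
  · obtain rfl : a = c := Option.some_inj.1 hac
    rw [contr_edge_mul_same hz I (by simp) hi hi, contr_edge_mul_same hz I (by simp) hl hl,
      contr_chi_mul, mul_chi_mul, sub_mul, mul_sub, mul_sub, mul_sub]
    abel
  · rw [contr_edge_mul_other hz I (by simp) hi (by rwa [hi]),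
      contr_edge_mul_other hz I (by simp) hl (by rwa [hl]), sub_mul]
    abel

theorem contr_prod_edgeDiff_mul (hz : Function.Injective z) {I : j → Finset (Fin k)} {a : j}
    {i₀ : Fin k} (hi₀ : color I (Sum.inl i₀) = some a) (c : j) (tl : List (Fin k))
    (htl : ∀ i ∈ tl, color I (Sum.inl i) = some a)
    (X : StratumForm k m z j) (hX : contr c (chi I * X) = 0) :
    contr c (chi I * ((tl.map fun i => edgeDiff a i i₀).prod * X)) = 0 := by
  induction tl with
  | nil => simpa using hX
  | cons i tl ih =>
    rw [List.map_cons, List.prod_cons, mul_assoc,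
      contr_edgeDiff_mul hz (htl i List.mem_cons_self) hi₀,
      ih fun i hi => htl i (List.mem_cons_of_mem _ hi), mul_zero, neg_zero]

theorem chi_mul_prod_congr {β : Type*} (I : j → Finset (Fin k)) (l : List β)
    (f g : β → StratumForm k m z j) (h : ∀ b ∈ l, chi I * f b = chi I * g b) :
    chi I * (l.map f).prod = chi I * (l.map g).prod := by
  induction l with
  | nil => rfl
  | cons b l ih =>
    rw [List.map_cons, List.prod_cons, ← mul_assoc, h b List.mem_cons_self, mul_assoc,
      ← mul_chi_mul, ih fun b' hb' => h b' (List.mem_cons_of_mem _ hb'), mul_chi_mul,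
      List.map_cons, List.prod_cons]

variable (m z) in
/-- The form `μ_S`, on all the strata. -/
def muForm (j : Finset (Fin n)) (S : Finset (Fin k)) : StratumForm k m z j := fun p => mu S p.x

theorem listProd_apply {β : Type*} (l : List β) (f : β → Sp k → Ext k) (x : Sp k) :
    (l.map f).prod x = (l.map fun b => f b x).prod := by
  rw [← Pi.evalRingHom_apply (fun _ => Ext k) x (l.map f).prod, map_list_prod, List.map_map]
  rfl

theorem listProd_apply' {β : Type*} (l : List β) (f : β → StratumForm k m z j)
    (p : StratumPoint k m z j) : (l.map f).prod p = (l.map fun b => f b p).prod := by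
  rw [← Pi.evalRingHom_apply (fun _ => Ext k) p (l.map f).prod, map_list_prod, List.map_map]
  rfl

theorem mu_of_sort {S : Finset (Fin k)} {i₀ : Fin k} {tl : List (Fin k)}
    (h : S.sort (· ≤ ·) = i₀ :: tl) :
    mu S = (tl.map fun i => dlog fun x => x i / x i₀).prod := by
  rw [mu, h]

theorem chi_mul_muForm (hz : Function.Injective z) {I : j → Finset (Fin k)} (hI : DisjointI I)
    {a : j} {i₀ : Fin k} {tl : List (Fin k)} (h : (I a).sort (· ≤ ·) = i₀ :: tl) :
    chi I * muForm m z j (I a) = chi I * (tl.map fun i => edgeDiff a i i₀).prod := by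
  have hcol : ∀ i ∈ i₀ :: tl, color I (Sum.inl i) = some a := fun i hi => by
    rw [← h, Finset.mem_sort] at hi
    exact (color_inl_eq_some hI).2 hi
  have e : muForm m z j (I a) = (tl.map fun i =>
      (fun p : StratumPoint k m z j => dlog (fun x : Sp k => x i / x i₀) p.x)).prod := by
    funext p
    rw [muForm, mu_of_sort h, listProd_apply, listProd_apply']
  rw [e]
  refine chi_mul_prod_congr I tl _ _ fun i hi => chi_mul_congr ?_
  rintro p rfl
  have key : ∀ i ∈ i₀ :: tl, p.x i ≠ 0 := fun i hi =>
    vval_ne hz p (u := Sum.inl i) (v := Sum.inr (Sum.inl a)) (by simp) (hcol i hi)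
  have hd : ∀ i, dlog (fun x : Sp k => x i) p.x
      = edge (m := m) (z := z) (j := j) (Sum.inl i) (Sum.inr (Sum.inl a)) p := fun i => by
    rw [← dlog_vfun_sub]
    congr 1
    funext x
    simp [vfun]
  rw [dlog_div (differentiableAt_apply _ _) (differentiableAt_apply _ _)
    (key i (List.mem_cons_of_mem _ hi)) (key i₀ List.mem_cons_self), hd, hd]
  rfl

/-- The contraction of the product of all the forms `d log x_i` of a block. -/
theorem contr_blockMono_mul (hz : Function.Injective z) {I : j → Finset (Fin k)} (hI : DisjointI I)
    {a : j} (hne : (I a).Nonempty) (X : StratumForm k m z j) (hX : contr a (chi I * X) = 0) :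
    contr a (chi I * (monL (siteEdges (I a) (Sum.inl a)) * X))
      = chi I * (muForm m z j (I a) * X) := by
  obtain ⟨i₀, tl, h⟩ : ∃ i₀ tl, (I a).sort (· ≤ ·) = i₀ :: tl := by
    rcases h : (I a).sort (· ≤ ·) with _ | ⟨i₀, tl⟩
    · have h2 := Finset.length_sort (s := I a) (· ≤ ·)
      rw [h] at h2
      exact absurd h2.symm (Finset.card_pos.2 hne).ne'
    · exact ⟨i₀, tl, rfl⟩
  have hcol : ∀ i ∈ i₀ :: tl, color I (Sum.inl i) = some a := fun i hi => by
    rw [← h, Finset.mem_sort] at hi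
    exact (color_inl_eq_some hI).2 hi
  -- The first factor d log x_{i₀} allows it to be subtracted from all the later ones. These are
  -- then annihilated by the contraction, which just removes the first factor and leaves μ.
  have e1 : monL (siteEdges (I a) (Sum.inl a)) = edge (m := m) (z := z) (Sum.inl i₀)
      (Sum.inr (Sum.inl a)) * (tl.map fun i => edgeDiff a i i₀).prod := by
    have h2 := mul_prod_sub_self (edge (m := m) (z := z) (Sum.inl i₀) (Sum.inr (Sum.inl a)))
      (edge_mul_self _ _) (fun i : Fin k => edge (Sum.inl i) (Sum.inr (Sum.inl a))) tl
      (fun i _ => edge_mul_comm _ _ _ _)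
    rw [siteEdges, h, List.map_cons, monL_cons]
    refine Eq.trans ?_ h2.symm
    simp [monL, Function.comp_def]
  have hc0 := hcol i₀ List.mem_cons_self
  have h0 := contr_prod_edgeDiff_mul hz hc0 a tl
    (fun i hi => hcol i (List.mem_cons_of_mem _ hi)) X hX
  rw [contr_chi_mul] at h0
  rw [e1, mul_assoc, contr_edge_mul_same hz I (by simp) hc0 hc0, mul_sub,
    ← mul_chi_mul I (edge (Sum.inl i₀) (Sum.inr (Sum.inl a))), h0, mul_zero, sub_zero,
    ← mul_assoc, ← mul_assoc, chi_mul_muForm hz hI h]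

theorem contr_muForm_mul (hz : Function.Injective z) {I : j → Finset (Fin k)} (hI : DisjointI I)
    {a : j} (hne : (I a).Nonempty) (c : j) (X : StratumForm k m z j)
    (hX : contr c (chi I * X) = 0) : contr c (chi I * (muForm m z j (I a) * X)) = 0 := by
  obtain ⟨i₀, tl, h⟩ : ∃ i₀ tl, (I a).sort (· ≤ ·) = i₀ :: tl := by
    rcases h : (I a).sort (· ≤ ·) with _ | ⟨i₀, tl⟩
    · have h2 := Finset.length_sort (s := I a) (· ≤ ·)
      rw [h] at h2
      exact absurd h2.symm (Finset.card_pos.2 hne).ne'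
    · exact ⟨i₀, tl, rfl⟩
  have hcol : ∀ i ∈ i₀ :: tl, color I (Sum.inl i) = some a := fun i hi => by
    rw [← h, Finset.mem_sort] at hi
    exact (color_inl_eq_some hI).2 hi
  rw [← mul_assoc, chi_mul_muForm hz hI h, mul_assoc]
  exact contr_prod_edgeDiff_mul hz (hcol i₀ List.mem_cons_self) c tl
    (fun i hi => hcol i (List.mem_cons_of_mem _ hi)) X hX

theorem contr_prod_muForm_mul (hz : Function.Injective z) {I : j → Finset (Fin k)}
    (hI : DisjointI I) (hne : ∀ a, (I a).Nonempty) (c : j) (l : List j) (X : StratumForm k m z j)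
    (hX : contr c (chi I * X) = 0) :
    contr c (chi I * ((l.map fun a => muForm m z j (I a)).prod * X)) = 0 := by
  induction l with
  | nil => simpa using hX
  | cons a l ih =>
    rw [List.map_cons, List.prod_cons, mul_assoc]
    exact contr_muForm_mul hz hI (hne a) c _ ih

/-- Each contraction turns the full monomial of its block into μ. The signs arise when the
contractions of the later blocks pass the monomial of an earlier one; they depend on the blocks
alone and not on the factor X. -/
theorem exists_contrs_blockMono (hz : Function.Injective z) {I : j → Finset (Fin k)}
    (hI : DisjointI I) (hne : ∀ a, (I a).Nonempty) (l : List j) (hl : l.Nodup) :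
    ∃ s : ℂ, s ≠ 0 ∧ ∀ X : StratumForm k m z j, (∀ a, contr a (chi I * X) = 0) →
      contrs l (chi I * ((l.map fun a => monL (siteEdges (I a) (Sum.inl a))).prod * X))
        = s • (chi I * ((l.map fun a => muForm m z j (I a)).prod * X)) := by
  induction l with
  | nil => exact ⟨1, one_ne_zero, fun X _ => by simp [contrs_nil]⟩
  | cons a l ih =>
    obtain ⟨hal, hl⟩ := List.nodup_cons.1 hl
    obtain ⟨s, hs, h⟩ := ih hl
    refine ⟨(-1 : ℂ) ^ ((siteEdges (I a) (Sum.inl a : j ⊕ Fin n)).length * l.length) * s,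
      mul_ne_zero (pow_ne_zero _ (by norm_num)) hs, fun X hX => ?_⟩
    simp only [List.map_cons, List.prod_cons, contrs_cons, mul_assoc]
    rw [contrs_monL_mul hz l, h X hX, mul_smul_comm, mul_chi_mul, map_smul, map_smul,
      contr_blockMono_mul hz hI (hne a), smul_smul]
    · exact contr_prod_muForm_mul hz hI hne a l X (hX a)
    · intro e he
      obtain ⟨h1, h2⟩ := mem_siteEdges.1 he
      have hc := (color_inl_eq_some hI).2 h1
      rw [hc, h2]
      exact ⟨by simp, rfl, fun b hb hab => hal (Option.some_inj.1 hab ▸ hb)⟩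

theorem sort_segment_map_val {lo len : ℕ} (h : lo + len ≤ k) :
    ((Finset.univ.filter fun i : Fin k => lo ≤ i.val ∧ i.val < lo + len).sort (· ≤ ·)).map Fin.val
      = (List.range len).map (lo + ·) := by
  have hp1 : (((Finset.univ.filter fun i : Fin k => lo ≤ i.val ∧ i.val < lo + len).sort
      (· ≤ ·)).map Fin.val).Pairwise (· < ·) := by
    rw [List.pairwise_map]
    exact (Finset.sortedLT_sort _).pairwise
  have hp2 : ((List.range len).map (lo + ·)).Pairwise (· < ·) := by
    rw [List.pairwise_map]
    exact List.pairwise_lt_range.imp fun h => Nat.add_lt_add_left h _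
  refine List.Perm.eq_of_pairwise (fun e e' _ _ h h' => absurd (h.trans h') (lt_irrefl _)) hp1 hp2 ?_
  rw [List.perm_ext_iff_of_nodup (hp1.imp fun h => h.ne) (hp2.imp fun h => h.ne)]
  intro q
  simp only [List.mem_map, Finset.mem_sort, Finset.mem_filter, Finset.mem_univ, true_and,
    List.mem_range]
  constructor
  · rintro ⟨i, hi, rfl⟩; exact ⟨i.val - lo, by omega, by omega⟩
  · rintro ⟨r, hr, rfl⟩; exact ⟨⟨lo + r, by omega⟩, ⟨by simp, by simpa using hr⟩, rfl⟩

theorem etaSite_eq {K : Fin n → ℕ} (hK : blockTotal m j + ∑ c, K c ≤ k) (b : Fin n) :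
    etaSite (k := k) m z j K b = (((siteBlock k m j K b).sort (· ≤ ·)).map fun i =>
      dlog fun x => x i - z b).prod := by
  have hle : (blockTotal m j + ∑ c ∈ Finset.Iio b, K c) + K b ≤ k := by
    have := sum_Iio_add_le K (a := b) (t := Finset.univ) fun c _ => Finset.mem_univ c
    omega
  have h := congr_arg (List.map fun q => dlog fun x : Sp k => coord q x - z b)
    (sort_segment_map_val hle)
  rw [List.map_map, List.map_map] at h
  rw [etaSite, siteBlock]
  refine congr_arg List.prod (h.symm.trans ?_)
  refine List.map_congr_left fun i _ => ?_
  simp [coord]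

theorem etaSite_apply {K : Fin n → ℕ} (hK : blockTotal m j + ∑ c, K c ≤ k) (b : Fin n)
    (p : StratumPoint k m z j) : etaSite m z j K b p.x
      = monL (m := m) (z := z) (j := j) (siteEdges (siteBlock k m j K b) (Sum.inr b)) p := by
  rw [etaSite_eq hK, listProd_apply, monL, listProd_apply', siteEdges, List.map_map]
  refine congr_arg List.prod (List.map_congr_left fun i _ => ?_)
  exact dlog_vfun_sub (Sum.inl i) (Sum.inr (Sum.inr b)) p

theorem nonempty_baseI (hjk : blockTotal m j ≤ k) (a : j) : (baseI k m j a).Nonempty := by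
  rw [← Finset.card_pos, baseI, card_baseBlock hjk a.2]
  exact Nat.succ_pos _

/-- The factor s comes from the blocks and does not depend on K, so it cancels in the differential,
which compares different K. Its value is never needed. -/
theorem exists_baseForm_eq (hz : Function.Injective z) (hjk : blockTotal m j ≤ k) :
    ∃ s : ℂ, s ≠ 0 ∧ ∀ K : Fin n → ℕ, blockTotal m j + ∑ c, K c ≤ k →
      baseForm k m z j K
        = (alphaK m j K * s) • contrs (blockList j) (mono m z (baseLabel k m j K)) := by
  obtain ⟨s, hs, h⟩ := exists_contrs_blockMono (m := m) (z := z) hz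
    (disjointI_baseI (k := k) (m := m) (j := j)) (nonempty_baseI hjk) (blockList j)
    (nodup_blockList j)
  refine ⟨s⁻¹, inv_ne_zero hs, fun K hK => ?_⟩
  set E : StratumForm k m z j := monL ((List.finRange n).flatMap fun b =>
    siteEdges (siteBlock k m j K b) (Sum.inr b)) with hE
  have hEk : ∀ a, contr a (chi (baseI k m j) * E) = 0 := by
    intro a
    rw [← mul_one E, hE, contr_monL_mul hz, contr_chi_mul, contr_one, mul_zero, mul_zero, smul_zero]
    intro e he
    obtain ⟨b, -, hb⟩ := List.mem_flatMap.1 he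
    obtain ⟨h1, h2⟩ := mem_siteEdges.1 hb
    have hc : color (baseI k m j) (Sum.inl e.1) = none :=
      color_inl_eq_none.2 fun a ha => lt_irrefl _ (baseBlock_lt_siteBlock a.2 ha h1)
    rw [hc, h2]
    exact ⟨by simp, rfl, by simp⟩
  have hm : mono m z (baseLabel k m j K) = chi (baseI k m j) * (((blockList j).map fun a =>
      monL (siteEdges (baseI k m j a) (Sum.inl a))).prod * E) := by
    rw [mono, blocksOf_baseLabel, listOf_baseLabel, monL_append, monL_flatMap]
    rfl
  rw [hm, h E hEk, smul_smul, mul_assoc, inv_mul_cancel₀ hs, mul_one, baseForm, extendZero_eq,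
    ← mul_smul_comm (alphaK m j K) (chi (baseI k m j))]
  change chi (baseI k m j) * _ = _
  refine chi_mul_congr fun p hp => ?_
  simp only [Pi.smul_apply, Pi.mul_apply]
  congr 2
  · rw [← blockList_map_val, List.map_map, listProd_apply, listProd_apply']
    rfl
  · rw [hE, monL_flatMap, List.ofFn_eq_map, listProd_apply, listProd_apply']
    congr 1
    refine List.map_congr_left fun b _ => ?_
    exact etaSite_apply hK b p

/-! ### The forms `ω_K` belong to the Orlik-Solomon spaces -/

variable (z) in
/-- Products of `q` generators of the Orlik-Solomon space of a stratum. -/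
def IsGenProd (I : j → Finset (Fin k)) (q : ℕ) (F : Sp k → Ext k) : Prop :=
  ∃ l : List (Sp k → Ext k), l.length = q ∧ (∀ w ∈ l, w ∈ osGens z I) ∧ F = l.prod

theorem IsGenProd.mul {I : j → Finset (Fin k)} {q r : ℕ} {F G : Sp k → Ext k}
    (hF : IsGenProd z I q F) (hG : IsGenProd z I r G) : IsGenProd z I (q + r) (F * G) := by
  obtain ⟨l, rfl, hl, rfl⟩ := hF
  obtain ⟨l', rfl, hl', rfl⟩ := hG
  refine ⟨l ++ l', List.length_append, fun w hw => ?_, List.prod_append.symm⟩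
  rcases List.mem_append.1 hw with hw | hw
  exacts [hl w hw, hl' w hw]

theorem isGenProd_prod {β : Type*} {I : j → Finset (Fin k)} (l : List β) (q : β → ℕ)
    (F : β → Sp k → Ext k) (h : ∀ b ∈ l, IsGenProd z I (q b) (F b)) :
    IsGenProd z I (l.map q).sum (l.map F).prod := by
  induction l with
  | nil => exact ⟨[], rfl, by simp, rfl⟩
  | cons b l ih =>
    rw [List.map_cons, List.map_cons, List.sum_cons, List.prod_cons]
    exact (h b List.mem_cons_self).mul (ih fun b' hb' => h b' (List.mem_cons_of_mem _ hb'))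

theorem isGenProd_mu {I : j → Finset (Fin k)} {a : j} {q : ℕ} (ha : (I a).card = q + 1) :
    IsGenProd z I q (mu (I a)) := by
  obtain ⟨i₀, tl, h⟩ : ∃ i₀ tl, (I a).sort (· ≤ ·) = i₀ :: tl := by
    rcases h : (I a).sort (· ≤ ·) with _ | ⟨i₀, tl⟩
    · have h2 := Finset.length_sort (s := I a) (· ≤ ·)
      rw [h, ha] at h2
      simp at h2
    · exact ⟨i₀, tl, rfl⟩
  have hmem : ∀ i ∈ i₀ :: tl, i ∈ I a := fun i hi => by rwa [← h, Finset.mem_sort] at hi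
  refine ⟨_, ?_, ?_, mu_of_sort h⟩
  · rw [List.length_map]
    have h2 := Finset.length_sort (s := I a) (· ≤ ·)
    rw [h, ha, List.length_cons] at h2
    omega
  · intro w hw
    obtain ⟨i, hi, rfl⟩ := List.mem_map.1 hw
    exact Or.inl ⟨a, _, Or.inl ⟨i, hmem i (List.mem_cons_of_mem _ hi), rfl⟩, _,
      Or.inl ⟨i₀, hmem i₀ List.mem_cons_self, rfl⟩, rfl⟩

theorem isGenProd_etaSite {K : Fin n → ℕ} (hK : blockTotal m j + ∑ c, K c ≤ k) (b : Fin n) :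
    IsGenProd z (baseI k m j) (K b) (etaSite m z j K b) := by
  refine ⟨_, ?_, ?_, etaSite_eq hK b⟩
  · rw [List.length_map, Finset.length_sort, card_siteBlock hK]
  · intro w hw
    obtain ⟨i, hi, rfl⟩ := List.mem_map.1 hw
    rw [Finset.mem_sort] at hi
    exact Or.inr (Or.inr ⟨i, b, fun a ha => lt_irrefl _ (baseBlock_lt_siteBlock a.2 ha hi), rfl⟩)

/-- A block of m_a + 1 coordinates contributes only m_a factors; this is the shift by `j.card`. -/
theorem baseForm_mem_OS (hjk : blockTotal m j ≤ k) {K : Fin n → ℕ} {q : ℕ}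
    (hK : blockTotal m j + ∑ c, K c = q + j.card) (hq : q + j.card ≤ k) :
    baseForm k m z j K ∈ OS k m z j q := by
  have hK' : blockTotal m j + ∑ c, K c ≤ k := hK.trans_le hq
  have h1 : IsGenProd z (baseI k m j) ((blockList j).map fun a : j => m a).sum
      ((blockList j).map fun a => mu (baseI k m j a)).prod :=
    isGenProd_prod (blockList j) (fun a : j => m a) _ fun a _ =>
      isGenProd_mu (card_baseBlock hjk a.2)
  have h2 : IsGenProd z (baseI k m j) ((List.finRange n).map K).sum
      ((List.finRange n).map fun b => etaSite m z j K b).prod :=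
    isGenProd_prod (List.finRange n) K _ fun b _ => isGenProd_etaSite hK' b
  obtain ⟨l, hl, hgen, hprod⟩ := h1.mul h2
  have hlq : l.length = q := by
    rw [hl]
    have e1 : ((blockList j).map fun a : j => m a).sum + j.card = blockTotal m j := by
      have : (blockList j).toFinset = Finset.univ := by
        ext a; simp [mem_blockList]
      rw [← List.sum_toFinset _ (nodup_blockList j), this, ← sum_blocks, Finset.sum_add_distrib]
      simp
    have e2 : ((List.finRange n).map K).sum = ∑ b, K b := by
      rw [← List.ofFn_eq_map, List.sum_ofFn]
    omega
  have e : baseForm k m z j K = alphaK m j K • extendZero m z j (baseI k m j) l.prod := by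
    rw [extendZero_eq, ← mul_smul_comm, baseForm, extendZero_eq, ← hprod]
    rw [← blockList_map_val, List.map_map, List.ofFn_eq_map]
    rfl
  rw [e]
  exact Submodule.smul_mem _ _ (Submodule.subset_span ⟨_, l, hlq, hgen, rfl⟩)

/-! ### Stability of the Orlik-Solomon spaces under permutations -/

theorem permPull_dlog (σ : Equiv.Perm (Fin k)) (g : Sp k → ℂ) (x : Sp k) :
    permPull σ (dlog g (permMap σ x)) = dlog (fun y => g (permMap σ y)) x := by
  rw [dlog, permPull_ι, dlog, dlogCov, dlogCov]
  congr 1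
  -- For composition with a linear equivalence the chain rule holds without any differentiability of
  -- g.
  have e : (fun y => g (permMap σ y)) = g ∘ (ContinuousLinearEquiv.equivOfInverse (permMap σ) (permMap σ⁻¹)
      (fun y => funext fun i => by simp [permMap_apply])
      (fun y => funext fun i => by simp [permMap_apply]) : Sp k ≃L[ℂ] Sp k) := rfl
  rw [e, ContinuousLinearEquiv.comp_right_fderiv]
  rfl

theorem comp_permMap_mem_projEqs {σ : Equiv.Perm (Fin k)} {S : Finset (Fin k)} {g : Sp k → ℂ}
    (hg : g ∈ projEqs S) :
    (fun y => g (permMap σ y)) ∈ projEqs (S.map σ.toEmbedding) := by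
  rcases hg with ⟨i, hi, rfl⟩ | ⟨i, hi, l, hl, hil, rfl⟩
  · exact Or.inl ⟨σ i, by simpa using hi, rfl⟩
  · exact Or.inr ⟨σ i, by simpa using hi, σ l, by simpa using hl, fun h => hil (σ.injective h), rfl⟩

theorem perm_mem_osGens {σ : Equiv.Perm (Fin k)} {I : j → Finset (Fin k)} {w : Sp k → Ext k}
    (hw : w ∈ osGens z I) : (fun x => permPull σ (w (permMap σ x))) ∈ osGens z (mapI σ I) := by
  have hfree : ∀ i, (∀ a, i ∉ I a) → ∀ a, σ i ∉ mapI σ I a := fun i hi a => by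
    simpa [mem_mapI] using hi a
  rcases hw with ⟨a, g₁, hg₁, g₂, hg₂, rfl⟩ | ⟨i, l, hi, hl, hil, rfl⟩ | ⟨i, b, hi, rfl⟩
  · exact Or.inl ⟨a, _, comp_permMap_mem_projEqs (σ := σ) hg₁, _,
      comp_permMap_mem_projEqs (σ := σ) hg₂, funext fun x => permPull_dlog σ _ x⟩
  · exact Or.inr (Or.inl ⟨σ i, σ l, hfree i hi, hfree l hl, fun h => hil (σ.injective h),
      funext fun x => permPull_dlog σ _ x⟩)
  · exact Or.inr (Or.inr ⟨σ i, b, hfree i hi, funext fun x => permPull_dlog σ _ x⟩)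

theorem permHom_mem_OS (σ : Equiv.Perm (Fin k)) {q : ℕ} {η : StratumForm k m z j}
    (hη : η ∈ OS k m z j q) : permHom σ η ∈ OS k m z j q := by
  induction hη using Submodule.span_induction with
  | zero => rw [map_zero]; exact zero_mem _
  | add a b _ _ ha hb => rw [map_add]; exact add_mem ha hb
  | smul r a _ ha => rw [map_smul]; exact Submodule.smul_mem _ _ ha
  | mem w h =>
    obtain ⟨I, l, rfl, hl, rfl⟩ := h
    refine Submodule.subset_span ⟨mapI σ I, l.map fun w x => permPull σ (w (permMap σ x)),
      List.length_map _, ?_, ?_⟩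
    · intro w hw
      obtain ⟨w', hw', rfl⟩ := List.mem_map.1 hw
      exact perm_mem_osGens (hl w' hw')
    · rw [extendZero_eq, extendZero_eq, map_mul, permHom_chi]
      congr 1
      funext p
      change permPull σ (l.prod (permMap σ p.x)) = _
      rw [listProd_apply]
      conv_lhs => rw [← List.map_id l, listProd_apply]
      rw [map_list_prod, List.map_map]
      rfl

theorem skewHom_mem_OSskew {q : ℕ} {η : StratumForm k m z j} (hη : η ∈ OS k m z j q) :
    skewHom η ∈ OSskew k m z j q := by
  refine ⟨?_, fun σ => permHom_skewHom σ η⟩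
  rw [skewHom_eq_sum]
  exact Submodule.sum_mem _ fun σ _ => Submodule.smul_mem _ _ (permHom_mem_OS σ hη)

/-- The skew-symmetric forms are combinations of the iterated contractions of the
skew-symmetrizations of the basic monomials. -/
theorem OSskew_le_span (hz : Function.Injective z) (hjk : blockTotal m j ≤ k) {q : ℕ}
    (hq : q + j.card ≤ k) : OSskew k m z j q ≤ Submodule.span ℂ {v | ∃ K : Fin n → ℕ,
      blockTotal m j + ∑ b, K b = q + j.card ∧
      v = contrs (blockList j) (skewHom (mono m z (baseLabel k m j K)))} := by
  rintro η ⟨hη, hsk⟩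
  have h1 : skewHom η = (k.factorial : ℂ) • η := skewHom_of_skew hsk
  have hf : (k.factorial : ℂ) ≠ 0 := Nat.cast_ne_zero.2 (Nat.factorial_ne_zero k)
  refine (Submodule.smul_mem_iff _ hf).1 ?_
  rw [← h1]
  clear h1 hsk
  induction hη using Submodule.span_induction with
  | zero => rw [map_zero]; exact zero_mem _
  | add a b _ _ ha hb => rw [map_add]; exact add_mem ha hb
  | smul r a _ ha => rw [map_smul]; exact Submodule.smul_mem _ _ ha
  | mem w h =>
    obtain ⟨I, l, rfl, hl, rfl⟩ := h
    -- Families I with wrong cardinalities or with overlaps are admitted in `OS`, but they have no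
    -- points and contribute the zero form.
    by_cases hp : ∃ p : StratumPoint k m z j, p.I = I
    · obtain ⟨p, rfl⟩ := hp
      have hI : DisjointI p.I := p.disjoint_I
      have hne : ∀ a, (p.I a).Nonempty := fun a => by
        rw [← Finset.card_pos, p.card_I]; exact Nat.succ_pos _
      obtain ⟨h1, h2⟩ := extendZero_prod_mem (m := m) hz hI l hl
      obtain ⟨Y, hY, hYe⟩ := exists_contrs_eq hz hI hne (blockList j) (nodup_blockList j) _ _ h1
        fun a _ => h2 a
      rw [length_blockList] at hY
      rw [← hYe, ← contrs_skewHom]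
      exact contrs_mem_span hz hjk hI p.card_I hq (skewHom_mem_siteSpan hz hI hY)
    · have : extendZero m z j I l.prod = 0 := by
        funext p
        exact if_neg fun h => hp ⟨p, h⟩
      rw [this, map_zero]
      exact zero_mem _

/-! ### Monomials of maximal degree -/

/-- The covector `d log (x_i - y_s)`, or `d x_i` if there is no site. -/
def optCov (o : Option (j ⊕ Fin n)) (i : Fin k) (p : StratumPoint k m z j) : Sp k →L[ℂ] ℂ :=
  match o with
  | none => vdiff (j := j) (Sum.inl i)
  | some s => edgeCov (Sum.inl i) (Sum.inr s) p

theorem optCov_comp (σ : Equiv.Perm (Fin k)) (o : Option (j ⊕ Fin n)) (i : Fin k)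
    (p : StratumPoint k m z j) :
    (optCov o i (p.perm σ)).comp (permMap σ) = optCov o (σ i) p := by
  rcases o with _ | s
  · rfl
  · have hd : (vdiff (Sum.inl i : Vertex k j)).comp (permMap σ) = vdiff (Sum.inl (σ i) : Vertex k j) :=
      rfl
    have hd' : (vdiff (Sum.inr s : Vertex k j)).comp (permMap σ) = vdiff (Sum.inr s : Vertex k j) :=
      ContinuousLinearMap.zero_comp _
    have hv : vval (p.perm σ) (Sum.inr s) = vval p (Sum.inr s) := rfl
    simp only [optCov, edgeCov, ContinuousLinearMap.smul_comp, ContinuousLinearMap.sub_comp, hd,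
      hd', hv]
    rfl

variable (m z) in
/-- The product of the forms `d log (x_i - y_s)` and `d x_i` of a labeling. -/
def fullMono (lam : Fin k → Option (j ⊕ Fin n)) : StratumForm k m z j :=
  chi (blocksOf lam) * fun p => ExteriorAlgebra.ιMulti ℂ k fun i => optCov (lam i) i p

/-- All k coordinates occur, in their natural order, so reordering the wedge product gives exactly
the sign of σ. -/
theorem permHom_fullMono (lam : Fin k → Option (j ⊕ Fin n)) (σ : Equiv.Perm (Fin k)) :
    permHom σ (fullMono m z (lam ∘ σ)) = csign σ • fullMono m z lam := by
  rw [fullMono, map_mul, permHom_chi, mapI_blocksOf, fullMono, ← mul_smul_comm]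
  congr 1
  funext p
  change permPull σ (ExteriorAlgebra.ιMulti ℂ k fun i => optCov (lam (σ i)) i (p.perm σ))
    = csign σ • _
  rw [permPull, ExteriorAlgebra.map_apply_ιMulti]
  have h := (ExteriorAlgebra.ιMulti ℂ k).map_perm (fun i => optCov (lam i) i p) σ
  refine Eq.trans ?_ (h.trans ?_)
  · congr 1
    funext i
    exact optCov_comp σ (lam (σ i)) i p
  · rw [csign, Units.smul_def, Int.cast_smul_eq_zsmul]

/-- The sign in the skew-symmetrization cancels the sign of the reordering; what remains is a plain
sum over relabelings. -/
theorem skewHom_fullMono (lam : Fin k → Option (j ⊕ Fin n)) :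
    skewHom (fullMono m z lam) = ∑ σ : Equiv.Perm (Fin k), fullMono m z (lam ∘ σ) := by
  rw [skewHom_eq_sum]
  refine Fintype.sum_equiv (Equiv.inv _) _ _ fun σ => ?_
  have h := permHom_fullMono (m := m) (z := z) (lam ∘ (σ⁻¹ : Equiv.Perm (Fin k))) σ
  rw [show (lam ∘ (σ⁻¹ : Equiv.Perm (Fin k))) ∘ σ = lam by funext i; simp] at h
  rw [h, smul_smul, csign_mul_self, one_smul]
  rfl

theorem skewHom_fullMono_comp (lam : Fin k → Option (j ⊕ Fin n)) (σ : Equiv.Perm (Fin k)) :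
    skewHom (fullMono m z (lam ∘ σ)) = skewHom (fullMono m z lam) := by
  rw [skewHom_fullMono, skewHom_fullMono]
  exact Fintype.sum_equiv (Equiv.mulLeft σ) _ _ fun τ => rfl

theorem mono_eq_fullMono {lam : Fin k → Option (j ⊕ Fin n)} (h : ∀ i, lam i ≠ none) :
    mono m z lam = fullMono m z lam := by
  choose s hs using fun i => Option.ne_none_iff_exists'.1 (h i)
  have hl : listOf lam = (List.finRange k).map fun i => (i, Sum.inr (s i)) := by
    rw [listOf, ← List.filterMap_eq_map]
    congr 1
    funext i
    simp [hs]
  rw [mono, fullMono]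
  congr 1
  funext p
  rw [hl, monL, List.map_map, listProd_apply', ExteriorAlgebra.ιMulti_apply, List.ofFn_eq_map]
  congr 1
  refine List.map_congr_left fun i _ => ?_
  simp only [optCov, hs]
  rfl

theorem oneForm_mul_prod_comm (w : StratumPoint k m z j → (Sp k →L[ℂ] ℂ)) {β : Type*} (l : List β)
    (f : β → StratumPoint k m z j → (Sp k →L[ℂ] ℂ)) :
    oneForm w * (l.map fun b => oneForm (f b)).prod
      = (-1 : ℂ) ^ l.length • ((l.map fun b => oneForm (f b)).prod * oneForm w) := by
  induction l with
  | nil => simp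
  | cons b l ih =>
    rw [List.map_cons, List.prod_cons, ← mul_assoc, oneForm_mul_comm, neg_mul, mul_assoc, ih,
      mul_smul_comm, List.length_cons, pow_succ, mul_neg_one, neg_smul, mul_assoc]

/-- The new factor belongs at the last place and moves past the other k ones. The label of a block
origin is excluded because it would change the stratum. -/
theorem oneForm_mul_mono {k : ℕ} {lam : Fin (k + 1) → Option (j ⊕ Fin n)}
    (h : ∀ i : Fin k, lam i.castSucc ≠ none) (hlast : lam (Fin.last k) = none)
    (o : Option (j ⊕ Fin n)) (ho : ∀ a, o ≠ some (Sum.inl a)) :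
    oneForm (optCov o (Fin.last k)) * mono m z lam
      = (-1 : ℂ) ^ k • fullMono m z (Function.update lam (Fin.last k) o) := by
  choose s hs using fun i => Option.ne_none_iff_exists'.1 (h i)
  have hl : listOf lam = (List.finRange k).map fun i => (i.castSucc, Sum.inr (s i)) := by
    rw [listOf, List.finRange_succ_last, List.filterMap_append, List.filterMap_map,
      ← List.filterMap_eq_map]
    simp only [List.filterMap_cons, hlast, Option.map_none, List.filterMap_nil, List.append_nil]
    congr 1
    funext i
    simp [hs]
  have hb : blocksOf (Function.update lam (Fin.last k) o) = blocksOf lam := by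
    funext a
    ext i
    rw [mem_blocksOf, mem_blocksOf]
    by_cases hi : i = Fin.last k
    · subst hi
      simp [hlast, ho]
    · rw [Function.update_of_ne hi]
  rw [mono, mul_chi_mul, fullMono, hb, ← mul_smul_comm]
  congr 1
  have hm : monL (m := m) (z := z) (listOf lam)
      = ((List.finRange k).map fun i => oneForm (optCov (lam i.castSucc) i.castSucc)).prod := by
    rw [hl, monL, List.map_map]
    congr 1
    refine List.map_congr_left fun i _ => ?_
    rw [hs]
    rfl
  rw [hm, oneForm_mul_prod_comm, List.length_finRange]
  congr 1
  funext p
  rw [Pi.mul_apply, listProd_apply', ExteriorAlgebra.ιMulti_apply, List.ofFn_eq_map,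
    List.finRange_succ_last, List.map_append, List.prod_append, List.map_map]
  congr 1
  · congr 1
    refine List.map_congr_left fun i _ => ?_
    have hne : i.castSucc ≠ Fin.last k := (Fin.castSucc_lt_last i).ne
    simp only [Function.comp_apply, Function.update_of_ne hne]
    rfl
  · simp [oneForm]

/-! ### Linear independence -/

/-- The value of the function of a site. -/
def sval (z : Fin n → ℂ) : j ⊕ Fin n → ℂ := Sum.elim (fun _ => 0) z

/-- The coefficient of the form `d log (x_i - y_s)`. -/
def optCoef (z : Fin n → ℂ) (o : Option (j ⊕ Fin n)) (t : ℂ) : ℂ :=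
  match o with
  | none => 1
  | some s => (t - sval z s)⁻¹

theorem optCov_eq (o : Option (j ⊕ Fin n)) (i : Fin k) (p : StratumPoint k m z j) :
    optCov o i p = optCoef z o (p.x i) • vdiff (j := j) (Sum.inl i) := by
  rcases o with _ | s
  · exact (one_smul _ _).symm
  · simp only [optCov, edgeCov]
    rw [show vdiff (Sum.inr s : Vertex k j) = 0 from rfl, sub_zero]
    rfl

variable (k) in
/-- The form `d x_1 ∧ ⋯ ∧ d x_k`. -/
def volForm : Ext k :=
  ExteriorAlgebra.ιMulti ℂ k fun i => ContinuousLinearMap.proj i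

/-- The determinant of the coordinates of the covectors is an alternating form with the value 1 on
dx_1, ..., dx_k; it extends to a functional on the exterior algebra. -/
theorem eq_zero_of_smul_volForm {r : ℂ} (h : r • volForm k = 0) : r = 0 := by
  set rows : (Sp k →L[ℂ] ℂ) →ₗ[ℂ] (Fin k → ℂ) :=
    { toFun := fun c l => c (Pi.single l 1)
      map_add' := fun _ _ => rfl
      map_smul' := fun _ _ => rfl }
  set g : (Sp k →L[ℂ] ℂ) [⋀^Fin k]→ₗ[ℂ] ℂ :=
    (Matrix.detRowAlternating (R := ℂ) (n := Fin k)).compLinearMap rows with hg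
  have h1 := congr_arg (ExteriorAlgebra.liftAlternating (R := ℂ) (Pi.single k g)) h
  rw [map_smul, map_zero, volForm, ExteriorAlgebra.liftAlternating_apply_ιMulti,
    Pi.single_eq_same] at h1
  have h2 : g (fun i : Fin k => ContinuousLinearMap.proj i) = 1 := by
    rw [hg, AlternatingMap.compLinearMap_apply]
    refine Eq.trans ?_ (Matrix.det_one (n := Fin k) (R := ℂ))
    change Matrix.det _ = _
    congr 1
    ext i l
    simp [rows, Matrix.one_apply, Pi.single_apply]
  rwa [h2, smul_eq_mul, mul_one] at h1

theorem fullMono_apply_of_eq {lam : Fin k → Option (j ⊕ Fin n)} {p : StratumPoint k m z j}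
    (h : p.I = blocksOf lam) :
    fullMono m z lam p = (∏ i, optCoef z (lam i) (p.x i)) • volForm k := by
  rw [fullMono, Pi.mul_apply, chi_of_eq h, one_mul, volForm, ← AlternatingMap.map_smul_univ]
  congr 1
  funext i
  exact optCov_eq (lam i) i p

theorem fullMono_apply_of_ne {lam : Fin k → Option (j ⊕ Fin n)} {p : StratumPoint k m z j}
    (h : p.I ≠ blocksOf lam) : fullMono m z lam p = 0 := by
  rw [fullMono, Pi.mul_apply, chi_of_ne h, zero_mul]

theorem card_none_add (lam : Fin k → Option (j ⊕ Fin n)) :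
    (Finset.univ.filter fun i => lam i = none).card
      + ∑ s, (Finset.univ.filter fun i => lam i = some s).card = k := by
  rw [← Fintype.sum_option (fun o => (Finset.univ.filter fun a => lam a = o).card),
    ← Finset.card_eq_sum_card_fiberwise (fun _ _ => Finset.mem_univ _), Finset.card_univ,
    Fintype.card_fin]

theorem card_none_baseLabel (hjk : blockTotal m j ≤ k) {K : Fin n → ℕ}
    (hK : blockTotal m j + ∑ b, K b ≤ k) :
    (Finset.univ.filter fun i => baseLabel k m j K i = none).card
      + (blockTotal m j + ∑ b, K b) = k := by
  have h := card_none_add (baseLabel k m j K)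
  have h1 : ∀ a : j, (Finset.univ.filter fun i => baseLabel k m j K i = some (Sum.inl a)).card
      = m a + 1 := fun a => by
    rw [← card_baseBlock hjk a.2]; congr 1; ext i; simp [baseLabel_eq_inl]
  have h2 : ∀ b, (Finset.univ.filter fun i => baseLabel k m j K i = some (Sum.inr b)).card
      = K b := fun b => by
    rw [← card_siteBlock hK b]; congr 1; ext i; simp [baseLabel_eq_inr]
  rw [Fintype.sum_sum_type] at h
  simp only [h1, h2, sum_blocks] at h
  exact h

theorem eventually_add_mul_ne_zero (A B : ℂ) (hB : B ≠ 0) : ∀ᶠ t : ℂ in 𝓝[≠] 0, A + t * B ≠ 0 := by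
  by_cases hA : A = 0
  · filter_upwards [self_mem_nhdsWithin] with t ht
    rw [hA, zero_add]
    exact mul_ne_zero ht hB
  · have : Filter.Tendsto (fun t : ℂ => A + t * B) (𝓝[≠] 0) (𝓝 (A + 0 * B)) :=
      (Continuous.tendsto (by fun_prop) 0).mono_left nhdsWithin_le_nhds
    rw [zero_mul, add_zero] at this
    exact this.eventually_ne hA

/-- The inverse of the coefficient. -/
def optFactor (z : Fin n → ℂ) (o : Option (j ⊕ Fin n)) (t : ℂ) : ℂ :=
  match o with
  | none => 1
  | some s => t - sval z s

/-- The path which approaches the zero of the denominators of the coefficient of a labeling. -/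
def labelPath (z : Fin n → ℂ) (w : ℂ) (lam : Fin k → Option (j ⊕ Fin n)) (t : ℂ) : Sp k :=
  fun i => (lam i).elim w (sval z) + t * (i.val + 1)

theorem val_add_one_ne_zero (i : Fin k) : ((i.val : ℂ) + 1) ≠ 0 := Nat.cast_add_one_ne_zero _

/-- Coordinate i has speed i + 1 along the path. The speeds are distinct and nonzero, so for small t
≠ 0 coordinates with the same limit separate and none stays at a site. -/
theorem eventually_exists_point (w : ℂ) (lam : Fin k → Option (j ⊕ Fin n))
    (hcard : ∀ a, (blocksOf lam a).card = m a + 1) :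
    ∀ᶠ t : ℂ in 𝓝[≠] 0, ∃ p : StratumPoint k m z j, p.I = blocksOf lam ∧
      p.x = labelPath z w lam t := by
  have h1 : ∀ᶠ t : ℂ in 𝓝[≠] 0, ∀ i l : Fin k, i ≠ l →
      labelPath z w lam t i ≠ labelPath z w lam t l := by
    rw [Filter.eventually_all]; intro i
    rw [Filter.eventually_all]; intro l
    by_cases hil : i = l
    · exact Filter.Eventually.of_forall fun t h => absurd hil h
    · have hB : ((i.val : ℂ) - l.val) ≠ 0 := sub_ne_zero.2 fun h => hil (Fin.ext (Nat.cast_injective h))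
      filter_upwards [eventually_add_mul_ne_zero ((lam i).elim w (sval z) - (lam l).elim w (sval z))
        _ hB] with t ht _ he
      refine ht ?_
      rw [← sub_eq_zero.2 he, labelPath, labelPath]
      ring
  have h2 : ∀ᶠ t : ℂ in 𝓝[≠] 0, ∀ (i : Fin k) (s : j ⊕ Fin n),
      labelPath z w lam t i ≠ sval z s := by
    rw [Filter.eventually_all]; intro i
    rw [Filter.eventually_all]; intro s
    filter_upwards [eventually_add_mul_ne_zero ((lam i).elim w (sval z) - sval z s) _
      (val_add_one_ne_zero i)] with t ht he
    refine ht ?_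
    rw [← sub_eq_zero.2 he, labelPath]
    ring
  filter_upwards [h1, h2] with t h1 h2
  refine ⟨⟨blocksOf lam, labelPath z w lam t, hcard, ?_, ?_, ?_, ?_, ?_⟩, rfl, rfl⟩
  · intro a b hab
    rw [Finset.disjoint_left]
    intro i hi hl
    rw [mem_blocksOf] at hi hl
    rw [hi] at hl
    exact hab (Sum.inl_injective (Option.some_inj.1 hl))
  · exact fun a i _ => h2 i (Sum.inl a)
  · exact fun a i _ l _ hil => h1 i l hil
  · exact fun i l _ _ hil => h1 i l hil
  · exact fun i _ b => h2 i (Sum.inr b)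

/-- If i has a label in lam₀, the path brings x_i to that site, and the factor vanishing there
cancels the pole of the same label and kills any other. Labels at block origins agree since the
strata do, and the remaining sites z_b are distinct. An unlabeled coordinate goes to w, away from
all z_b, where the limit need only be finite. -/
theorem tendsto_factor_mul_coef (hz : Function.Injective z) {w : ℂ} (hw : ∀ b, w ≠ z b)
    (lam₀ lam : Fin k → Option (j ⊕ Fin n)) (hb : blocksOf lam = blocksOf lam₀) (i : Fin k) :
    ∃ r : ℂ, Filter.Tendsto (fun t => optFactor z (lam₀ i) (labelPath z w lam₀ t i) *
        optCoef z (lam i) (labelPath z w lam₀ t i)) (𝓝[≠] 0) (𝓝 r) ∧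
      (lam i = lam₀ i → r = 1) ∧ (lam₀ i ≠ none → lam i ≠ lam₀ i → r = 0) := by
  have hb' : ∀ a, lam i = some (Sum.inl a) ↔ lam₀ i = some (Sum.inl a) := fun a => by
    rw [← mem_blocksOf, ← mem_blocksOf, hb]
  have hpath : Filter.Tendsto (fun t => labelPath z w lam₀ t i) (𝓝[≠] 0)
      (𝓝 ((lam₀ i).elim w (sval z))) := by
    have : Filter.Tendsto (fun t : ℂ => (lam₀ i).elim w (sval z) + t * ((i.val : ℂ) + 1)) (𝓝[≠] 0)
        (𝓝 ((lam₀ i).elim w (sval z) + 0 * ((i.val : ℂ) + 1))) :=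
      (Continuous.tendsto (by fun_prop) 0).mono_left nhdsWithin_le_nhds
    rwa [zero_mul, add_zero] at this
  by_cases heq : lam i = lam₀ i
  · refine ⟨1, ?_, fun _ => rfl, fun _ h => absurd heq h⟩
    refine Filter.Tendsto.congr' ?_ tendsto_const_nhds
    filter_upwards [self_mem_nhdsWithin] with t ht
    rw [heq]
    rcases h : lam₀ i with _ | s
    · simp [optFactor, optCoef]
    · simp only [optFactor, optCoef]
      rw [mul_inv_cancel₀]
      simp only [labelPath, h, Option.elim_some, add_sub_cancel_left]
      exact mul_ne_zero ht (val_add_one_ne_zero i)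
  · rcases h₀ : lam₀ i with _ | s₀
    · rcases h : lam i with _ | s
      · exact absurd (h.trans h₀.symm) heq
      · rcases s with a | b
        · exact absurd ((hb' a).1 h) (by rw [h₀]; simp)
        · refine ⟨1 * (w - z b)⁻¹, ?_, fun h => by simp at h, fun h _ => absurd rfl h⟩
          rw [h₀] at hpath
          refine Filter.Tendsto.mul tendsto_const_nhds ?_
          exact (hpath.sub_const _).inv₀ (sub_ne_zero.2 (hw b))
    · refine ⟨0, ?_, fun h => absurd (h.trans h₀.symm) heq, fun _ _ => rfl⟩
      rw [h₀] at hpath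
      have hf : Filter.Tendsto (fun t => labelPath z w lam₀ t i - sval z s₀) (𝓝[≠] 0) (𝓝 0) := by
        have := hpath.sub_const (sval z s₀)
        simpa using this
      rcases h : lam i with _ | s
      · simpa [optFactor, optCoef] using hf
      · rcases s with a | b
        · exact absurd ((h.trans ((hb' a).1 h).symm)) heq
        · rcases s₀ with a | b₀
          · exact absurd (((hb' a).2 h₀).trans h₀.symm) heq
          · have hbb : z b₀ - z b ≠ 0 := sub_ne_zero.2 fun h' => heq (by rw [h, h₀, hz h'])
            have := hf.mul ((hpath.sub_const (z b)).inv₀ hbb)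
            rw [zero_mul] at this
            exact this

/-- If lam agreed with lam₀ wherever lam₀ has a label, its unlabeled coordinates would be unlabeled
in lam₀, and the equal cardinalities would give lam = lam₀. So for different labelings some factor
tends to 0. -/
theorem tendsto_prod_factor_mul_coef (hz : Function.Injective z) {w : ℂ} (hw : ∀ b, w ≠ z b)
    (lam₀ lam : Fin k → Option (j ⊕ Fin n)) (hb : blocksOf lam = blocksOf lam₀)
    (hcard : (Finset.univ.filter fun i => lam i = none).card
      = (Finset.univ.filter fun i => lam₀ i = none).card) [Decidable (lam = lam₀)] :
    Filter.Tendsto (fun t => (∏ i, optFactor z (lam₀ i) (labelPath z w lam₀ t i)) *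
        ∏ i, optCoef z (lam i) (labelPath z w lam₀ t i)) (𝓝[≠] 0)
      (𝓝 (if lam = lam₀ then 1 else 0)) := by
  choose r hr h1 h0 using tendsto_factor_mul_coef hz hw lam₀ lam hb
  have h := tendsto_finsetProd Finset.univ fun i _ => hr i
  simp only [Finset.prod_mul_distrib] at h
  convert h using 2
  split_ifs with heq
  · rw [Finset.prod_eq_one fun i _ => h1 i (by rw [heq])]
  · have : ∃ i, lam₀ i ≠ none ∧ lam i ≠ lam₀ i := by
      by_contra hcon
      push Not at hcon
      have hsub : (Finset.univ.filter fun i => lam i = none)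
          ⊆ Finset.univ.filter fun i => lam₀ i = none := by
        intro i hi
        simp only [Finset.mem_filter, Finset.mem_univ, true_and] at hi ⊢
        by_contra hne
        exact hne ((hcon i hne).symm.trans hi)
      have hE := Finset.eq_of_subset_of_card_le hsub hcard.ge
      refine heq (funext fun i => ?_)
      by_cases hi : lam₀ i = none
      · have : i ∈ Finset.univ.filter fun i => lam i = none := by rw [hE]; simpa using hi
        rw [hi]
        simpa using this
      · exact hcon i hi
    obtain ⟨i, hi, hne⟩ := this
    exact (Finset.prod_eq_zero (Finset.mem_univ i) (h0 i hi hne)).symm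

/-- An iterated residue: multiply the coefficient of the volume form by the denominators of the
labeling of K₀ and let the coordinates tend to their sites. Only relabelings equal to that labeling
survive; they occur only for K₀, and their number is positive because the identity is one of them.
-/
theorem eq_zero_of_sum_fullMono (hz : Function.Injective z) (hjk : blockTotal m j ≤ k) {N : ℕ}
    (hN : N ≤ k) (s : Finset {K : Fin n → ℕ // blockTotal m j + ∑ b, K b = N})
    (g : {K : Fin n → ℕ // blockTotal m j + ∑ b, K b = N} → ℂ)
    (h : chi (baseI k m j) * ∑ K ∈ s, g K • skewHom (fullMono m z (baseLabel k m j K.1)) = 0)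
    {K₀} (hK₀ : K₀ ∈ s) : g K₀ = 0 := by
  classical
  obtain ⟨w, hw⟩ : ∃ w : ℂ, ∀ b, w ≠ z b := by
    obtain ⟨w, hw⟩ := (Set.finite_range z).infinite_compl.nonempty
    exact ⟨w, fun b hb => hw ⟨b, hb.symm⟩⟩
  have hKk : ∀ K : {K : Fin n → ℕ // blockTotal m j + ∑ b, K b = N},
      blockTotal m j + ∑ b, K.1 b ≤ k := fun K => K.2.trans_le hN
  set lam₀ := baseLabel k m j K₀.1 with hlam₀
  have hb₀ : blocksOf lam₀ = baseI k m j := blocksOf_baseLabel _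
  have hnone : ∀ K : {K : Fin n → ℕ // blockTotal m j + ∑ b, K b = N},
      (Finset.univ.filter fun i => baseLabel k m j K.1 i = none).card = k - N := fun K => by
    have := card_none_baseLabel hjk (hKk K)
    rw [K.2] at this
    omega
  have hnone' : ∀ (K : {K : Fin n → ℕ // blockTotal m j + ∑ b, K b = N}) (σ : Equiv.Perm (Fin k)),
      (Finset.univ.filter fun i => (baseLabel k m j K.1 ∘ σ) i = none).card
        = (Finset.univ.filter fun i => lam₀ i = none).card := fun K σ => by
    rw [hlam₀, hnone, ← hnone K]
    refine Finset.card_equiv σ fun i => ?_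
    simp
  have heq : ∀ p : StratumPoint k m z j, p.I = baseI k m j →
      ∑ K ∈ s, g K * ∑ σ : Equiv.Perm (Fin k), (if blocksOf (baseLabel k m j K.1 ∘ σ) = baseI k m j
        then ∏ i, optCoef z ((baseLabel k m j K.1 ∘ σ) i) (p.x i) else 0) = 0 := by
    intro p hp
    have h1 := congr_fun h p
    rw [Pi.mul_apply, chi_of_eq hp, one_mul, Finset.sum_apply, Pi.zero_apply] at h1
    refine eq_zero_of_smul_volForm (k := k) (Eq.trans ?_ h1)
    rw [Finset.sum_smul]
    refine Finset.sum_congr rfl fun K _ => ?_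
    rw [Pi.smul_apply, skewHom_fullMono, Finset.sum_apply, mul_smul, Finset.sum_smul]
    congr 1
    refine Finset.sum_congr rfl fun σ _ => ?_
    split_ifs with hb
    · rw [fullMono_apply_of_eq (hp.trans hb.symm)]
    · rw [fullMono_apply_of_ne (fun h' => hb (h'.symm.trans hp)), zero_smul]
  have hlim : Filter.Tendsto (fun t => (∏ i, optFactor z (lam₀ i) (labelPath z w lam₀ t i)) *
      ∑ K ∈ s, g K * ∑ σ : Equiv.Perm (Fin k), (if blocksOf (baseLabel k m j K.1 ∘ σ) = baseI k m j
        then ∏ i, optCoef z ((baseLabel k m j K.1 ∘ σ) i) (labelPath z w lam₀ t i) else 0)) (𝓝[≠] 0)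
      (𝓝 (∑ K ∈ s, g K * ∑ σ : Equiv.Perm (Fin k),
        if baseLabel k m j K.1 ∘ σ = lam₀ then 1 else 0)) := by
    simp only [Finset.mul_sum]
    refine tendsto_finsetSum _ fun K _ => tendsto_finsetSum _ fun σ _ => ?_
    simp only [mul_left_comm _ (g K)]
    refine Filter.Tendsto.const_mul _ ?_
    by_cases hb : blocksOf (baseLabel k m j K.1 ∘ σ) = baseI k m j
    · simp only [if_pos hb]
      exact tendsto_prod_factor_mul_coef hz hw lam₀ _ (hb.trans hb₀.symm) (hnone' K σ)
    · have hne : baseLabel k m j K.1 ∘ σ ≠ lam₀ := fun h => hb (by rw [h, hb₀])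
      simp only [if_neg hb, if_neg hne, mul_zero]
      exact tendsto_const_nhds
  have hzero : Filter.Tendsto (fun t => (∏ i, optFactor z (lam₀ i) (labelPath z w lam₀ t i)) *
      ∑ K ∈ s, g K * ∑ σ : Equiv.Perm (Fin k), (if blocksOf (baseLabel k m j K.1 ∘ σ) = baseI k m j
        then ∏ i, optCoef z ((baseLabel k m j K.1 ∘ σ) i) (labelPath z w lam₀ t i) else 0)) (𝓝[≠] 0)
      (𝓝 0) := by
    refine Filter.Tendsto.congr' ?_ tendsto_const_nhds
    have hcard : ∀ a, (blocksOf lam₀ a).card = m a + 1 := fun a => by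
      rw [hb₀]; exact card_baseBlock hjk a.2
    filter_upwards [eventually_exists_point (m := m) (z := z) w lam₀ hcard] with t ht
    obtain ⟨p, hpI, hpx⟩ := ht
    have := heq p (hpI.trans hb₀)
    rw [hpx] at this
    rw [this, mul_zero]
  have hsum := tendsto_nhds_unique hlim hzero
  rw [Finset.sum_eq_single_of_mem K₀ hK₀] at hsum
  · refine (mul_eq_zero.1 hsum).resolve_right ?_
    rw [Finset.sum_boole]
    refine Nat.cast_ne_zero.2 (Finset.card_pos.2 ⟨1, ?_⟩).ne'
    simp [hlam₀]
  · intro K _ hK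
    rw [Finset.sum_eq_zero, mul_zero]
    intro σ _
    -- K is recovered from the labeling by counting, and counts are invariant under permutations.
    refine if_neg fun hσ => hK (Subtype.ext (funext fun b => ?_))
    rw [← card_siteBlock (hKk K) b, ← card_siteBlock (hKk K₀) b]
    refine (Finset.card_equiv σ fun i => ?_).symm
    rw [← baseLabel_eq_inr, ← baseLabel_eq_inr, ← hlam₀, ← hσ, Function.comp_apply]

/-! ### Linear independence of the iterated contractions -/

theorem oneForm_mul_monL_eq_zero {w : StratumPoint k m z j → (Sp k →L[ℂ] ℂ)}
    {q : Fin k × Vertex k j} {L : List (Fin k × Vertex k j)} (hq : q ∈ L)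
    (h : oneForm w * edge (Sum.inl q.1) q.2 = 0) : oneForm w * monL L = 0 := by
  induction L with
  | nil => simp at hq
  | cons q' L ih =>
    rw [monL_cons]
    rcases List.mem_cons.1 hq with rfl | hq
    · rw [← mul_assoc, h, zero_mul]
    · rw [← mul_assoc, edge, oneForm_mul_comm, neg_mul, mul_assoc, ih hq, mul_zero, neg_zero]

/-- On its own stratum the monomial already contains d log x_i for every i in a block. -/
theorem edge_mul_chi_mul_mono {I : j → Finset (Fin k)} {a : j} {i : Fin k} (hi : i ∈ I a)
    (lam : Fin k → Option (j ⊕ Fin n)) :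
    edge (Sum.inl i) (Sum.inr (Sum.inl a)) * (chi I * mono m z lam) = 0 := by
  by_cases hI : blocksOf lam = I
  · subst hI
    have hmem : ((i, Sum.inr (Sum.inl a)) : Fin k × Vertex k j) ∈ listOf lam :=
      mem_listOf.2 ⟨_, mem_blocksOf.1 hi, rfl⟩
    have h0 := oneForm_mul_monL_eq_zero (m := m) (z := z) hmem (edge_mul_self _ _)
    rw [mono, chi_mul_chi_mul, mul_chi_mul, edge, h0, mul_zero]
  · have h0 : chi I * mono m z lam = 0 := by
      rw [← mul_zero (chi I)]
      refine chi_mul_congr fun p hp => ?_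
      rw [mono, Pi.mul_apply, chi_of_ne (fun h => hI (h.symm.trans hp)), zero_mul, Pi.zero_apply]
    rw [h0, mul_zero]

theorem edge_mul_chi_mul_skewHom_mono {I : j → Finset (Fin k)} {a : j} {i : Fin k} (hi : i ∈ I a)
    (lam : Fin k → Option (j ⊕ Fin n)) :
    edge (Sum.inl i) (Sum.inr (Sum.inl a)) * (chi I * skewHom (mono m z lam)) = 0 := by
  rw [skewHom_eq_sum, Finset.mul_sum, Finset.mul_sum]
  refine Finset.sum_eq_zero fun σ _ => ?_
  rw [mul_smul_comm, mul_smul_comm]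
  have h := permHom_mono (m := m) (z := z) (lam ∘ (σ⁻¹ : Equiv.Perm (Fin k))) σ
  rw [show (lam ∘ (σ⁻¹ : Equiv.Perm (Fin k))) ∘ σ = lam by funext i; simp] at h
  rcases h with h | h <;> rw [h]
  · rw [edge_mul_chi_mul_mono hi, smul_zero]
  · rw [mul_neg, mul_neg, edge_mul_chi_mul_mono hi, neg_zero, smul_zero]

/-- Contractions can be undone on forms W with d log x_i ∧ W = 0. For i in I_a, d log x_i ∧ `contrs
l W` vanishes too; contracting it at a gives `contrs l W` - d log x_i ∧ `contrs (a :: l) W`, whose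
last term is zero by hypothesis. So the contractions can be removed one after another. -/
theorem eq_zero_of_contrs_eq_zero (hz : Function.Injective z) {I : j → Finset (Fin k)}
    (hI : DisjointI I) (hne : ∀ a, (I a).Nonempty) {W : StratumForm k m z j} (hW : chi I * W = W)
    (he : ∀ a, ∀ i ∈ I a, edge (Sum.inl i) (Sum.inr (Sum.inl a)) * W = 0) {l : List j}
    (hl : l.Nodup) (h : contrs l W = 0) : W = 0 := by
  induction l with
  | nil => exact h
  | cons a l ih =>
    rw [List.nodup_cons] at hl
    refine ih hl.2 ?_
    obtain ⟨i, hi⟩ := hne a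
    have hc : color I (Sum.inl i) = some a := (color_inl_eq_some hI).2 hi
    have hne' : (Sum.inl i : Vertex k j) ≠ Sum.inr (Sum.inl a) := Sum.inl_ne_inr
    have h1 := contrs_monL_mul (m := m) hz l [((i, Sum.inr (Sum.inl a)) : Fin k × Vertex k j)]
      (I := I) (by
        intro e he
        rw [List.mem_singleton] at he
        subst he
        refine ⟨hne', hc, fun b hb => ?_⟩
        rw [hc]
        rintro ⟨⟩
        exact hl.1 hb) W
    rw [monL_cons, show monL (m := m) (z := z) ([] : List (Fin k × Vertex k j)) = 1 from rfl,
      mul_one, he a i hi, mul_zero, map_zero, hW] at h1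
    have h2 := (smul_eq_zero.1 h1.symm).resolve_left (pow_ne_zero _ (neg_ne_zero.2 one_ne_zero))
    have h3 := contr_edge_mul_same (m := m) hz I hne' hc hc (contrs l W)
    rw [contrs_cons] at h
    rw [h2, mul_zero, map_zero, h, mul_zero, sub_zero, ← contrs_chi_mul, hW] at h3
    exact h3.symm

/-- Multiplication of a monomial by a covector depends only on the coordinates of the covector
which do not occur in the monomial. -/
theorem oneForm_mul_mono_congr {lam : Fin k → Option (j ⊕ Fin n)}
    {w w' : StratumPoint k m z j → (Sp k →L[ℂ] ℂ)}
    (h : ∀ p, p.I = blocksOf lam → ∀ i, lam i = none → w p (Pi.single i 1) = w' p (Pi.single i 1)) :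
    oneForm w * mono m z lam = oneForm w' * mono m z lam := by
  rw [mono, mul_chi_mul, mul_chi_mul]
  refine chi_mul_congr fun p hp => ?_
  have hterm : ∀ i, (w p (Pi.single i 1) - w' p (Pi.single i 1)) •
      (ExteriorAlgebra.ι ℂ (vdiff (j := j) (Sum.inl i)) * monL (m := m) (z := z) (listOf lam) p)
        = 0 := by
    intro i
    rcases hi : lam i with _ | s
    · rw [h p hp i hi, sub_self, zero_smul]
    · have h0 := oneForm_mul_monL_eq_zero (m := m) (z := z) (w := fun _ => vdiff (j := j) (Sum.inl i))
        (mem_listOf.2 ⟨s, hi, rfl⟩ : ((i, Sum.inr s) : Fin k × Vertex k j) ∈ listOf lam) (by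
          funext p
          simp only [Pi.mul_apply, oneForm, edge, edgeCov]
          rw [show vdiff (Sum.inr s : Vertex k j) = 0 from rfl, sub_zero, map_smul,
            mul_smul_comm, ExteriorAlgebra.ι_sq_zero, smul_zero]
          rfl)
      have h1 := congr_fun h0 p
      simp only [Pi.mul_apply, oneForm, Pi.zero_apply] at h1
      rw [h1, smul_zero]
  have hdec : w p - w' p
      = ∑ i, (w p (Pi.single i 1) - w' p (Pi.single i 1)) • vdiff (j := j) (Sum.inl i) := by
    refine ContinuousLinearMap.coe_injective (LinearMap.pi_ext' fun i => LinearMap.ext_ring ?_)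
    simp [vdiff, Pi.single_apply]
  rw [Pi.mul_apply, Pi.mul_apply, ← sub_eq_zero, ← sub_mul, oneForm, oneForm, ← map_sub, hdec,
    map_sum, Finset.sum_mul]
  refine Finset.sum_eq_zero fun i _ => ?_
  rw [map_smul, smul_mul_assoc, hterm]

theorem baseLabel_ne_none (hjk : blockTotal m j ≤ k) {K : Fin n → ℕ}
    (hK : blockTotal m j + ∑ b, K b = k) (i : Fin k) : baseLabel k m j K i ≠ none := by
  have h := card_none_baseLabel hjk hK.le
  rw [hK, Nat.add_eq_right, Finset.card_eq_zero] at h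
  intro hi
  have : i ∈ Finset.univ.filter fun i => baseLabel k m j K i = none := by simpa using hi
  rw [h] at this
  simp at this

theorem baseLabel_last {k : ℕ} {K : Fin n → ℕ} (hK : blockTotal m j + ∑ b, K b = k) :
    baseLabel (k + 1) m j K (Fin.last k) = none := by
  rcases h : baseLabel (k + 1) m j K (Fin.last k) with _ | a | b
  · rfl
  · have := lt_blockTotal_of_mem_baseBlock a.2 (baseLabel_eq_inl.1 h)
    rw [Fin.val_last] at this
    omega
  · have := lt_of_mem_siteBlock (baseLabel_eq_inr.1 h)
    rw [Fin.val_last] at this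
    omega

theorem baseLabel_castSucc_ne_none {k : ℕ} (hjk : blockTotal m j ≤ k + 1) {K : Fin n → ℕ}
    (hK : blockTotal m j + ∑ b, K b = k) (i : Fin k) :
    baseLabel (k + 1) m j K i.castSucc ≠ none := by
  have h := card_none_baseLabel hjk (hK.trans_le (Nat.le_succ k))
  rw [hK, add_comm, Nat.add_left_cancel_iff, Finset.card_eq_one] at h
  obtain ⟨i₀, h⟩ := h
  have h1 : ∀ i, baseLabel (k + 1) m j K i = none → i = i₀ := fun i hi => by
    rw [← Finset.mem_singleton, ← h]; simpa using hi
  intro hi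
  exact (Fin.castSucc_lt_last i).ne ((h1 _ hi).trans (h1 _ (baseLabel_last hK)).symm)

/-- A vanishing combination of the contracted forms also vanishes before contraction on the base
stratum, and there the poles separate the coefficients. -/
theorem linearIndependent_contrs (hz : Function.Injective z) (hjk : blockTotal m j ≤ k) {N : ℕ}
    (hN : N = k ∨ N + 1 = k) :
    LinearIndependent ℂ fun K : {K : Fin n → ℕ // blockTotal m j + ∑ b, K b = N} =>
      contrs (blockList j) (skewHom (mono m z (baseLabel k m j K.1))) := by
  rw [linearIndependent_iff']
  intro s g hsum K₀ hK₀
  have hW : chi (baseI k m j) * ∑ K ∈ s, g K • skewHom (mono m z (baseLabel k m j K.1)) = 0 := by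
    refine eq_zero_of_contrs_eq_zero hz (disjointI_baseI (k := k) (m := m)) (nonempty_baseI hjk)
      (chi_mul_chi_mul _ _) (fun a i hi => ?_) (nodup_blockList j) ?_
    · rw [Finset.mul_sum, Finset.mul_sum]
      refine Finset.sum_eq_zero fun K _ => ?_
      rw [mul_smul_comm, mul_smul_comm, edge_mul_chi_mul_skewHom_mono hi, smul_zero]
    · rw [contrs_chi_mul, map_sum]
      simp only [map_smul]
      rw [hsum, mul_zero]
  rcases hN with rfl | rfl
  · refine eq_zero_of_sum_fullMono hz hjk le_rfl s g (Eq.trans ?_ hW) hK₀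
    congr 1
    refine Finset.sum_congr rfl fun K _ => ?_
    rw [mono_eq_fullMono (baseLabel_ne_none hjk K.2)]
  -- One coordinate is unlabeled here. The invariant form Σ dx_i passes through the
  -- skew-symmetrization and, on each monomial, supplies the missing differential, which leads back
  -- to degree k.
  · set Θ : StratumForm (N + 1) m z j := oneForm fun _ => ∑ i, vdiff (j := j) (Sum.inl i) with hΘ
    have hinv : ∀ σ, permHom σ Θ = Θ := fun σ => by
      rw [hΘ, permHom_oneForm]
      congr 1
      funext p
      ext x
      simp only [ContinuousLinearMap.comp_apply, sum_apply]
      exact Fintype.sum_equiv σ _ _ fun i => rfl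
    have hmul : ∀ K : {K : Fin n → ℕ // blockTotal m j + ∑ b, K b = N},
        Θ * mono m z (baseLabel (N + 1) m j K.1)
          = (-1 : ℂ) ^ N • fullMono m z (baseLabel (N + 1) m j K.1) := fun K => by
      have hl := baseLabel_last (m := m) (j := j) K.2
      rw [← Function.update_eq_self (Fin.last N) (baseLabel (N + 1) m j K.1), hl,
        ← oneForm_mul_mono (baseLabel_castSucc_ne_none hjk K.2) hl none (by simp), ← hl,
        Function.update_eq_self, hl]
      refine oneForm_mul_mono_congr fun p _ i hi => ?_
      have hi' : i = Fin.last N := by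
        rcases Fin.eq_castSucc_or_eq_last i with ⟨l, rfl⟩ | h
        · exact absurd hi (baseLabel_castSucc_ne_none hjk K.2 l)
        · exact h
      subst hi'
      simp [optCov, vdiff, Pi.single_apply]
    refine eq_zero_of_sum_fullMono hz hjk (Nat.le_succ N) s g ?_ hK₀
    have h := congr_arg (fun X => (-1 : ℂ) ^ N • (Θ * X)) hW
    simp only [mul_zero, smul_zero] at h
    rw [← h, mul_chi_mul, ← mul_smul_comm]
    congr 1
    rw [Finset.mul_sum, Finset.smul_sum]
    refine Finset.sum_congr rfl fun K _ => ?_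
    rw [mul_smul_comm, ← skewHom_mul_of_invariant hinv, hmul, map_smul, smul_smul,
      smul_smul, mul_right_comm, ← mul_pow, neg_mul_neg, one_mul, one_pow, one_mul]

/-! ### The form `ω̃` -/

theorem edgeCov_comp (σ : Equiv.Perm (Fin k)) (u v : Vertex k j) (p : StratumPoint k m z j) :
    (edgeCov u v (p.perm σ)).comp (permMap σ) = edgeCov (vperm σ u) (vperm σ v) p := by
  have hv : ∀ u, vval (p.perm σ) u = vval p (vperm σ u) := by
    rintro (i | a | b) <;> rfl
  have hd : ∀ u : Vertex k j, (vdiff u).comp (permMap σ) = vdiff (vperm σ u) := by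
    rintro (i | s)
    · rfl
    · exact ContinuousLinearMap.zero_comp _
  simp only [edgeCov, ContinuousLinearMap.smul_comp, ContinuousLinearMap.sub_comp, hv, hd]

/-- The vertex of `ℂ^e` which is the image of a coordinate under the blow-down. -/
def center (I : j → Finset (Fin k)) (i : Fin k) : Vertex k j :=
  (color I (Sum.inl i)).elim (Sum.inl i) fun a => Sum.inr (Sum.inr a.1)

theorem center_of_none {I : j → Finset (Fin k)} {i : Fin k} (h : color I (Sum.inl i) = none) :
    center I i = Sum.inl i := by rw [center, h]; rfl

theorem center_of_some {I : j → Finset (Fin k)} {i : Fin k} {a : j}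
    (h : color I (Sum.inl i) = some a) : center I i = Sum.inr (Sum.inr a.1) := by
  rw [center, h]; rfl

theorem color_center (I : j → Finset (Fin k)) (i : Fin k) : color I (center I i) = none := by
  rcases h : color I (Sum.inl i) with _ | a
  · rw [center_of_none h, h]
  · rw [center_of_some h]; rfl

open scoped Classical in
/-- The restriction of `d log (t_i - t_l)` to the strata, without the logarithmic differentials of
the equations of the exceptional divisors. -/
def pairCov (i l : Fin k) (p : StratumPoint k m z j) : Sp k →L[ℂ] ℂ :=
  if color p.I (Sum.inl i) = color p.I (Sum.inl l) then edgeCov (Sum.inl i) (Sum.inl l) p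
  else edgeCov (center p.I i) (center p.I l) p

open scoped Classical in
/-- The restriction of `d log (t_i - z_b)` to the strata, without the logarithmic differentials of
the equations of the exceptional divisors. -/
def pointCov (i : Fin k) (b : Fin n) (p : StratumPoint k m z j) : Sp k →L[ℂ] ℂ :=
  if h : ∃ a : j, color p.I (Sum.inl i) = some a ∧ a.1 = b then
    edgeCov (Sum.inl i) (Sum.inr (Sum.inl h.choose)) p
  else edgeCov (center p.I i) (Sum.inr (Sum.inr b)) p

theorem pointCov_of_some {i : Fin k} {a : j} {p : StratumPoint k m z j}
    (h : color p.I (Sum.inl i) = some a) :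
    pointCov i a.1 p = edgeCov (Sum.inl i) (Sum.inr (Sum.inl a)) p := by
  have h' : ∃ a' : j, color p.I (Sum.inl i) = some a' ∧ a'.1 = a.1 := ⟨a, h, rfl⟩
  rw [pointCov, dif_pos h', Subtype.ext h'.choose_spec.2]

theorem pointCov_of_ne {i : Fin k} {b : Fin n} {p : StratumPoint k m z j}
    (h : ∀ a : j, color p.I (Sum.inl i) = some a → a.1 ≠ b) :
    pointCov i b p = edgeCov (center p.I i) (Sum.inr (Sum.inr b)) p := by
  rw [pointCov, dif_neg]
  rintro ⟨a, h1, h2⟩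
  exact h a h1 h2

/-- The form `ω̃`, explicitly. -/
def limitCov (κ : ℂ) (p : StratumPoint k m z j) : Sp k →L[ℂ] ℂ :=
  (∑ i : Fin k, ∑ l : Fin k, (1 / κ) • pairCov i l p)
    + ∑ i : Fin k, ∑ b : Fin n, (-(m b : ℂ) / κ) • pointCov i b p

theorem pairCov_comm (i l : Fin k) (p : StratumPoint k m z j) : pairCov i l p = pairCov l i p := by
  unfold pairCov
  by_cases h : color p.I (Sum.inl i) = color p.I (Sum.inl l)
  · rw [if_pos h, if_pos h.symm, edgeCov_comm]
  · rw [if_neg h, if_neg fun h' => h h'.symm, edgeCov_comm]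

theorem edgeCov_self (u : Vertex k j) (p : StratumPoint k m z j) : edgeCov u u p = 0 := by
  rw [edgeCov, sub_self (vdiff u), smul_zero]

theorem pairCov_self (i : Fin k) (p : StratumPoint k m z j) : pairCov i i p = 0 := by
  rw [pairCov, if_pos rfl, edgeCov_self]

/-- It relates the sum over i < l with weight 2/κ to the sum over ordered pairs with weight 1/κ, for
which invariance under S_k is only a reindexing. -/
theorem sum_sum_eq_two_nsmul {M : Type*} [AddCommMonoid M] (f : Fin k → Fin k → M)
    (hc : ∀ i l, f i l = f l i) (h0 : ∀ i, f i i = 0) :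
    ∑ i, ∑ l, f i l = 2 • ∑ i, ∑ l ∈ Finset.Ioi i, f i l := by
  have h1 : ∀ i, ∑ l, f i l = ∑ l ∈ Finset.Ioi i, f i l + ∑ l ∈ Finset.Iio i, f i l := by
    intro i
    have hd : Disjoint (Finset.Ioi i) (Finset.Iio i) := by
      rw [Finset.disjoint_left]
      intro l h1 h2
      exact absurd (Finset.mem_Ioi.1 h1) (Finset.mem_Iio.1 h2).asymm
    rw [← Finset.sum_union hd]
    refine (Finset.sum_subset (Finset.subset_univ _) fun l _ hl => ?_).symm
    have : l = i := by
      rw [Finset.mem_union, Finset.mem_Ioi, Finset.mem_Iio, not_or, not_lt, not_lt] at hl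
      exact le_antisymm hl.1 hl.2
    rw [this, h0]
  have h2 : ∑ i, ∑ l ∈ Finset.Iio i, f i l = ∑ i, ∑ l ∈ Finset.Ioi i, f i l := by
    rw [Finset.sum_comm' (t' := Finset.univ) (s' := fun l => Finset.Ioi l) (by simp)]
    exact Finset.sum_congr rfl fun l _ => Finset.sum_congr rfl fun i _ => hc i l
  simp only [h1]
  rw [Finset.sum_add_distrib, h2, two_nsmul]

/-! ### The limit -/

theorem choose_eq_of_color {I : j → Finset (Fin k)} (hI : DisjointI I) {i : Fin k} {a : j}
    (hc : color I (Sum.inl i) = some a) (h : ∃ a, i ∈ I a) : h.choose = a := by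
  have := (color_inl_eq_some hI).2 h.choose_spec
  rw [hc] at this
  exact (Option.some_inj.1 this).symm

/-- The value of the function `t_i` after the blow-down. -/
def blowVal (p : StratumPoint k m z j) (i : Fin k) (s : j → ℂ) : ℂ :=
  (color p.I (Sum.inl i)).elim (p.x i) fun a => z a + s a * p.x i

/-- The differential of the function `t_i` after the blow-down. -/
def blowDiff (p : StratumPoint k m z j) (i : Fin k) (s : j → ℂ) : Sp k →L[ℂ] ℂ :=
  (color p.I (Sum.inl i)).elim 1 s • ContinuousLinearMap.proj i

theorem blowDown_apply (p : StratumPoint k m z j) (s : j → ℂ) (x : Sp k) (i : Fin k) :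
    blowDown z p.I s x i
      = (color p.I (Sum.inl i)).elim (x i) fun a => z a + s a * x i := by
  rcases h : color p.I (Sum.inl i) with _ | a
  · have : ¬ ∃ a, i ∈ p.I a := fun ⟨a, ha⟩ => color_inl_eq_none.1 h a ha
    rw [blowDown, dif_neg this]
    rfl
  · have : ∃ a, i ∈ p.I a := ⟨a, (color_inl_eq_some p.disjoint_I).1 h⟩
    rw [blowDown, dif_pos this, choose_eq_of_color p.disjoint_I h]
    rfl

theorem hasFDerivAt_coord (i : Fin k) (x : Sp k) :
    HasFDerivAt (fun t : Sp k => t i) (ContinuousLinearMap.proj i : Sp k →L[ℂ] ℂ) x :=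
  hasFDerivAt_apply i x

theorem hasFDerivAt_blowDown (p : StratumPoint k m z j) (s : j → ℂ) :
    HasFDerivAt (blowDown z p.I s) (ContinuousLinearMap.pi fun i => blowDiff p i s) p.x := by
  rw [hasFDerivAt_pi']
  intro i
  have e : (fun x => blowDown z p.I s x i)
      = fun x => (color p.I (Sum.inl i)).elim (x i) fun a => z a + s a * x i :=
    funext fun x => blowDown_apply p s x i
  rw [e]
  have hi := hasFDerivAt_coord i p.x
  change HasFDerivAt _ (blowDiff p i s) _
  rw [blowDiff]
  rcases color p.I (Sum.inl i) with _ | a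
  · simpa using hi
  · simpa using (hi.const_mul (s a)).const_add (z a)

theorem pullCov_pair (p : StratumPoint k m z j) (s : j → ℂ) (i l : Fin k) :
    pullCov (blowDown z p.I s) (dlogCov fun t : Sp k => t i - t l) p.x
      = (blowVal p i s - blowVal p l s)⁻¹ • (blowDiff p i s - blowDiff p l s) := by
  have h1 : HasFDerivAt (fun t : Sp k => t i - t l)
      (ContinuousLinearMap.proj i - ContinuousLinearMap.proj l : Sp k →L[ℂ] ℂ)
      (blowDown z p.I s p.x) :=
    (hasFDerivAt_coord i _).fun_sub (hasFDerivAt_coord l _)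
  rw [pullCov, (hasFDerivAt_blowDown p s).fderiv, dlogCov, h1.fderiv, blowDown_apply,
    blowDown_apply]
  rfl

theorem pullCov_point (p : StratumPoint k m z j) (s : j → ℂ) (i : Fin k) (b : Fin n) :
    pullCov (blowDown z p.I s) (dlogCov fun t : Sp k => t i - z b) p.x
      = (blowVal p i s - z b)⁻¹ • blowDiff p i s := by
  have h1 : HasFDerivAt (fun t : Sp k => t i - z b)
      (ContinuousLinearMap.proj i : Sp k →L[ℂ] ℂ) (blowDown z p.I s p.x) :=
    (hasFDerivAt_coord i _).sub_const _
  rw [pullCov, (hasFDerivAt_blowDown p s).fderiv, dlogCov, h1.fderiv, blowDown_apply]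
  rfl

theorem tendsto_coord_offDivisors (a : j) :
    Filter.Tendsto (fun s : j → ℂ => s a) (offDivisors j) (𝓝 0) :=
  ((continuous_apply a).tendsto (0 : j → ℂ)).mono_left nhdsWithin_le_nhds

theorem tendsto_smul_offDivisors (a : j) (A : Sp k →L[ℂ] ℂ) :
    Filter.Tendsto (fun s : j → ℂ => s a • A) (offDivisors j) (𝓝 0) := by
  have := (tendsto_coord_offDivisors a).smul_const A
  rwa [show (0 : ℂ) • A = 0 from zero_smul ℂ A] at this

theorem tendsto_blowVal (p : StratumPoint k m z j) (i : Fin k) :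
    Filter.Tendsto (blowVal p i) (offDivisors j) (𝓝 (vval p (center p.I i))) := by
  unfold blowVal
  rcases h : color p.I (Sum.inl i) with _ | a
  · rw [center_of_none h]
    exact tendsto_const_nhds
  · rw [center_of_some h]
    have := ((tendsto_coord_offDivisors a).mul_const (p.x i)).const_add (z a)
    rwa [zero_mul, add_zero] at this

theorem tendsto_blowDiff (p : StratumPoint k m z j) (i : Fin k) :
    Filter.Tendsto (blowDiff p i) (offDivisors j) (𝓝 (vdiff (center p.I i))) := by
  unfold blowDiff
  rcases h : color p.I (Sum.inl i) with _ | a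
  · rw [center_of_none h]
    simp only [Option.elim_none, one_smul]
    exact tendsto_const_nhds
  · rw [center_of_some h]
    exact tendsto_smul_offDivisors a _

theorem inv_mul_smul_smul_sub {r d : ℂ} (hr : r ≠ 0) (A B : Sp k →L[ℂ] ℂ) :
    (r * d)⁻¹ • (r • A - r • B) = d⁻¹ • (A - B) := by
  ext v
  simp only [smul_apply, sub_apply, smul_eq_mul]
  rw [← mul_sub, mul_inv_rev, mul_assoc, inv_mul_cancel_left₀ hr]

/-- For equal colors the parameter s_a cancels, or is absent, and the pull-back does not depend on
s. For different colors the two images tend to distinct vertices without a block, so the denominator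
has a nonzero limit. The parameters s are fixed in the pull-back, hence no d log s_a appears. -/
theorem tendsto_pair (hz : Function.Injective z) (p : StratumPoint k m z j) (i l : Fin k) :
    Filter.Tendsto (fun s => pullCov (blowDown z p.I s) (dlogCov fun t : Sp k => t i - t l) p.x)
      (offDivisors j) (𝓝 (pairCov i l p)) := by
  simp only [pullCov_pair]
  unfold pairCov
  split_ifs with hc
  · refine Filter.Tendsto.congr' ?_ tendsto_const_nhds
    filter_upwards [self_mem_nhdsWithin] with s hs
    rcases h : color p.I (Sum.inl l) with _ | a
    · simp only [blowVal, blowDiff, hc, h, Option.elim_none, one_smul]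
      rfl
    · simp only [blowVal, blowDiff, hc, h, Option.elim_some]
      rw [add_sub_add_left_eq_sub, ← mul_sub, inv_mul_smul_smul_sub (hs a)]
      rfl
  · have hne : center p.I i ≠ center p.I l := by
      rcases h : color p.I (Sum.inl i) with _ | a <;> rcases h' : color p.I (Sum.inl l) with _ | a'
      · exact absurd (h.trans h'.symm) hc
      · rw [center_of_none h, center_of_some h']; exact Sum.inl_ne_inr
      · rw [center_of_some h, center_of_none h']; exact Sum.inr_ne_inl
      · rw [center_of_some h, center_of_some h']
        intro he
        rw [h, h'] at hc
        exact hc (congr_arg some (Subtype.ext (Sum.inr_injective (Sum.inr_injective he))))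
    have hv := vval_ne hz p hne ((color_center _ _).trans (color_center _ _).symm)
    exact (((tendsto_blowVal p i).sub (tendsto_blowVal p l)).inv₀ (sub_ne_zero.2 hv)).smul
      ((tendsto_blowDiff p i).sub (tendsto_blowDiff p l))

theorem tendsto_point (hz : Function.Injective z) (p : StratumPoint k m z j) (i : Fin k)
    (b : Fin n) :
    Filter.Tendsto (fun s => pullCov (blowDown z p.I s) (dlogCov fun t : Sp k => t i - z b) p.x)
      (offDivisors j) (𝓝 (pointCov i b p)) := by
  simp only [pullCov_point]
  by_cases hc : ∃ a : j, color p.I (Sum.inl i) = some a ∧ a.1 = b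
  · obtain ⟨a, h, rfl⟩ := hc
    rw [pointCov_of_some h]
    refine Filter.Tendsto.congr' ?_ tendsto_const_nhds
    filter_upwards [self_mem_nhdsWithin] with s hs
    simp only [blowVal, blowDiff, h, Option.elim_some]
    rw [add_sub_cancel_left, smul_smul, mul_inv_rev, mul_assoc, inv_mul_cancel₀ (hs a), mul_one,
      edgeCov, show vdiff (Sum.inr (Sum.inl a) : Vertex k j) = 0 from rfl, sub_zero,
      show vval p (Sum.inr (Sum.inl a)) = 0 from rfl, sub_zero]
    rfl
  · have hc' : ∀ a : j, color p.I (Sum.inl i) = some a → a.1 ≠ b := fun a h1 h2 => hc ⟨a, h1, h2⟩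
    rw [pointCov_of_ne hc']
    have hne : center p.I i ≠ Sum.inr (Sum.inr b) := by
      rcases h : color p.I (Sum.inl i) with _ | a
      · rw [center_of_none h]; exact Sum.inl_ne_inr
      · rw [center_of_some h]
        exact fun he => hc' a h (Sum.inr_injective (Sum.inr_injective he))
    have hv := vval_ne hz p hne (color_center _ _)
    have h0 : edgeCov (center p.I i) (Sum.inr (Sum.inr b)) p
        = (vval p (center p.I i) - z b)⁻¹ • vdiff (center p.I i) := by
      rw [edgeCov, show vdiff (Sum.inr (Sum.inr b) : Vertex k j) = 0 from rfl, sub_zero]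
      rfl
    rw [h0]
    exact (((tendsto_blowVal p i).sub_const _).inv₀ (sub_ne_zero.2 hv)).smul (tendsto_blowDiff p i)

theorem pullCov_omegaA (b : Sp k → Sp k) (κ : ℂ) (x : Sp k) : pullCov b (omegaA m z κ) x
    = (∑ i : Fin k, ∑ l ∈ Finset.Ioi i,
        (2 / κ) • pullCov b (dlogCov fun t : Sp k => t i - t l) x)
      + ∑ i : Fin k, ∑ a : Fin n,
        (-(m a : ℂ) / κ) • pullCov b (dlogCov fun t : Sp k => t i - z a) x := by
  ext v
  simp [pullCov, omegaA, sum_apply]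

theorem tendsto_limitCov (hz : Function.Injective z) (κ : ℂ) (p : StratumPoint k m z j) :
    Filter.Tendsto (fun s => pullCov (blowDown z p.I s) (omegaA m z κ) p.x) (offDivisors j)
      (𝓝 (limitCov κ p)) := by
  have h2 : ∑ i : Fin k, ∑ l : Fin k, (1 / κ) • pairCov i l p
      = ∑ i : Fin k, ∑ l ∈ Finset.Ioi i, (2 / κ) • pairCov i l p := by
    rw [sum_sum_eq_two_nsmul (fun i l => (1 / κ) • pairCov i l p)
      (fun i l => by rw [pairCov_comm]) (fun i => by
        rw [pairCov_self]; exact smul_zero (M := ℂ) (A := Sp k →L[ℂ] ℂ) _), Finset.smul_sum]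
    refine Finset.sum_congr rfl fun i _ => ?_
    rw [Finset.smul_sum]
    refine Finset.sum_congr rfl fun l _ => ?_
    rw [← Nat.cast_smul_eq_nsmul ℂ, smul_smul]
    congr 1
    push_cast
    ring
  simp only [pullCov_omegaA]
  rw [limitCov, h2]
  refine Filter.Tendsto.add ?_ ?_
  · refine tendsto_finsetSum _ fun i _ => tendsto_finsetSum _ fun l _ => ?_
    exact (tendsto_pair hz p i l).const_smul _
  · refine tendsto_finsetSum _ fun i _ => tendsto_finsetSum _ fun b _ => ?_
    exact (tendsto_point hz p i b).const_smul _

/-- The diagonal s = (t, ..., t) with t ≠ 0 reaches the origin off all the divisors. Nontriviality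
makes the limit, and so `limUnder`, determined. -/
theorem offDivisors_neBot (j : Finset (Fin n)) : (offDivisors j).NeBot := by
  rw [offDivisors, ← mem_closure_iff_nhdsWithin_neBot]
  have h : Filter.Tendsto (fun t : ℂ => fun _ : j => t) (𝓝[≠] 0) (𝓝 (0 : j → ℂ)) :=
    (Continuous.tendsto (by fun_prop) (0 : ℂ)).mono_left nhdsWithin_le_nhds
  refine mem_closure_of_tendsto h ?_
  filter_upwards [self_mem_nhdsWithin] with t ht a
  exact ht

theorem omegaTildeCov_eq (hz : Function.Injective z) (κ : ℂ) (p : StratumPoint k m z j) :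
    omegaTildeCov κ p = limitCov κ p :=
  haveI := offDivisors_neBot j
  (tendsto_limitCov hz κ p).limUnder_eq

theorem omegaTilde_eq (hz : Function.Injective z) (κ : ℂ) :
    omegaTilde (k := k) m z j κ = oneForm (limitCov κ) :=
  funext fun p => congr_arg _ (omegaTildeCov_eq hz κ p)

/-! ### Properties of the form `ω̃` -/

theorem color_perm (σ : Equiv.Perm (Fin k)) (p : StratumPoint k m z j) (u : Vertex k j) :
    color (p.perm σ).I u = color p.I (vperm σ u) := by
  rw [← color_mapI (p.perm σ).disjoint_I σ u, ← perm_I_eq_iff.1 (rfl : (p.perm σ).I = (p.perm σ).I)]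

theorem vperm_center (σ : Equiv.Perm (Fin k)) (p : StratumPoint k m z j) (i : Fin k) :
    vperm σ (center (p.perm σ).I i) = center p.I (σ i) := by
  rcases h : color p.I (Sum.inl (σ i)) with _ | a
  · rw [center_of_none h, center_of_none ((color_perm σ p _).trans h), vperm_inl]
  · rw [center_of_some h, center_of_some ((color_perm σ p _).trans h), vperm_inr]

theorem pairCov_comp (σ : Equiv.Perm (Fin k)) (i l : Fin k) (p : StratumPoint k m z j) :
    (pairCov i l (p.perm σ)).comp (permMap σ) = pairCov (σ i) (σ l) p := by
  unfold pairCov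
  rw [color_perm, color_perm, vperm_inl, vperm_inl]
  split_ifs
  · rw [edgeCov_comp, vperm_inl, vperm_inl]
  · rw [edgeCov_comp, vperm_center, vperm_center]

theorem pointCov_comp (σ : Equiv.Perm (Fin k)) (i : Fin k) (b : Fin n) (p : StratumPoint k m z j) :
    (pointCov i b (p.perm σ)).comp (permMap σ) = pointCov (σ i) b p := by
  have hc := color_perm σ p (Sum.inl i)
  rw [vperm_inl] at hc
  by_cases h : ∃ a : j, color p.I (Sum.inl (σ i)) = some a ∧ a.1 = b
  · obtain ⟨a, ha, rfl⟩ := h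
    rw [pointCov_of_some ha, pointCov_of_some (hc.trans ha), edgeCov_comp, vperm_inl, vperm_inr]
  · have h' : ∀ a : j, color p.I (Sum.inl (σ i)) = some a → a.1 ≠ b := fun a h1 h2 => h ⟨a, h1, h2⟩
    rw [pointCov_of_ne h', pointCov_of_ne fun a ha => h' a (hc.symm.trans ha), edgeCov_comp,
      vperm_center, vperm_inr]

theorem limitCov_apply (κ : ℂ) (p : StratumPoint k m z j) (v : Sp k) :
    limitCov κ p v = ∑ i, ∑ l, 1 / κ * pairCov i l p v
      + ∑ i, ∑ b, -(m b : ℂ) / κ * pointCov i b p v := by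
  simp only [limitCov, add_apply, sum_apply, smul_apply, smul_eq_mul]

theorem limitCov_comp (κ : ℂ) (σ : Equiv.Perm (Fin k)) (p : StratumPoint k m z j) :
    (limitCov κ (p.perm σ)).comp (permMap σ) = limitCov κ p := by
  refine ContinuousLinearMap.ext fun v => ?_
  change limitCov κ (p.perm σ) (permMap σ v) = limitCov κ p v
  have h1 : ∀ i l, pairCov i l (p.perm σ) (permMap σ v) = pairCov (σ i) (σ l) p v := fun i l =>
    DFunLike.congr_fun (pairCov_comp σ i l p) v
  have h2 : ∀ i b, pointCov i b (p.perm σ) (permMap σ v) = pointCov (σ i) b p v := fun i b =>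
    DFunLike.congr_fun (pointCov_comp σ i b p) v
  have e1 : ∀ i, ∑ l, 1 / κ * pairCov i (σ l) p v = ∑ l, 1 / κ * pairCov i l p v := fun i =>
    Equiv.sum_comp σ fun l => 1 / κ * pairCov i l p v
  rw [limitCov_apply, limitCov_apply]
  simp only [h1, h2, e1]
  rw [Equiv.sum_comp σ fun i => ∑ l, 1 / κ * pairCov i l p v,
    Equiv.sum_comp σ fun i => ∑ b, -(m b : ℂ) / κ * pointCov i b p v]

theorem permHom_limitForm (κ : ℂ) (σ : Equiv.Perm (Fin k)) :
    permHom σ (oneForm (limitCov (m := m) (z := z) (j := j) κ)) = oneForm (limitCov κ) := by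
  rw [permHom_oneForm]
  exact congr_arg _ (funext fun p => limitCov_comp κ σ p)

theorem edgeCov_eulerVec_of_none {u v : Vertex k j} (a : j) (p : StratumPoint k m z j)
    (hu : color p.I u = none) (hv : color p.I v = none) : edgeCov u v p (eulerVec a p) = 0 := by
  rw [edgeCov, smul_apply, sub_apply, vdiff_eulerVec, vdiff_eulerVec, hu, hv]
  simp

theorem pairCov_eulerVec (hz : Function.Injective z) (a : j) (p : StratumPoint k m z j)
    (i l : Fin k) : pairCov i l p (eulerVec a p)
      = if i ∈ p.I a ∧ l ∈ p.I a ∧ i ≠ l then 1 else 0 := by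
  classical
  by_cases hil : i = l
  · subst hil
    rw [pairCov_self, if_neg (by simp)]
    rfl
  unfold pairCov
  split_ifs with hc h h
  · rw [edgeCov_eulerVec hz a p (fun h => hil (Sum.inl_injective h)) hc,
      if_pos ((color_inl_eq_some p.disjoint_I).2 h.1)]
  · rw [edgeCov_eulerVec hz a p (fun h => hil (Sum.inl_injective h)) hc, if_neg]
    intro hi
    exact h ⟨(color_inl_eq_some p.disjoint_I).1 hi,
      (color_inl_eq_some p.disjoint_I).1 (hc.symm.trans hi), hil⟩
  · exact absurd (((color_inl_eq_some p.disjoint_I).2 h.1).trans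
      ((color_inl_eq_some p.disjoint_I).2 h.2.1).symm) hc
  · exact edgeCov_eulerVec_of_none a p (color_center _ _) (color_center _ _)

theorem pointCov_eulerVec (hz : Function.Injective z) (a : j) (p : StratumPoint k m z j)
    (i : Fin k) (b : Fin n) : pointCov i b p (eulerVec a p)
      = if b = a.1 then (if i ∈ p.I a then 1 else 0) else 0 := by
  by_cases h : ∃ a' : j, color p.I (Sum.inl i) = some a' ∧ a'.1 = b
  · obtain ⟨a', ha', rfl⟩ := h
    rw [pointCov_of_some ha', edgeCov_eulerVec hz a p Sum.inl_ne_inr ha', ha', ← ite_and]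
    congr 1
    rw [← color_inl_eq_some p.disjoint_I, ha', Option.some_inj, Subtype.ext_iff, and_self]
  · have h' : ∀ a : j, color p.I (Sum.inl i) = some a → a.1 ≠ b := fun a h1 h2 => h ⟨a, h1, h2⟩
    rw [pointCov_of_ne h', edgeCov_eulerVec_of_none a p (color_center _ _) rfl, ← ite_and, if_neg]
    rintro ⟨rfl, hi⟩
    exact h' a ((color_inl_eq_some p.disjoint_I).2 hi) rfl

/-- The block contributes (m_a + 1)m_a ordered pairs of weight 1/κ and m_a + 1 points of weight
-m_a/κ, with the sum zero. This resonance is the reason for |I_a| = m_a + 1. -/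
theorem limitCov_eulerVec (hz : Function.Injective z) (κ : ℂ) (a : j)
    (p : StratumPoint k m z j) : limitCov κ p (eulerVec a p) = 0 := by
  classical
  have hcard := p.card_I a
  have h1 : ∑ i : Fin k, ∑ l : Fin k, (if i ∈ p.I a ∧ l ∈ p.I a ∧ i ≠ l then (1 : ℂ) else 0)
      = (m a + 1) * m a := by
    have : ∀ i : Fin k, ∑ l : Fin k, (if i ∈ p.I a ∧ l ∈ p.I a ∧ i ≠ l then (1 : ℂ) else 0)
        = if i ∈ p.I a then (m a : ℂ) else 0 := by
      intro i
      split_ifs with hi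
      · rw [Finset.sum_boole]
        congr 1
        rw [show (Finset.univ.filter fun l => i ∈ p.I a ∧ l ∈ p.I a ∧ i ≠ l) = (p.I a).erase i by
          ext l; simp [hi, and_comm, eq_comm], Finset.card_erase_of_mem hi, hcard,
          Nat.add_sub_cancel]
      · simp [hi]
    simp only [this]
    rw [← Finset.sum_filter, Finset.sum_const, Finset.filter_univ_mem, hcard, nsmul_eq_mul]
    push_cast
    rfl
  have h2 : ∀ i : Fin k, ∑ b : Fin n,
      (-(m b : ℂ) / κ) * (if b = a.1 then (if i ∈ p.I a then (1 : ℂ) else 0) else 0)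
        = (-(m a : ℂ) / κ) * (if i ∈ p.I a then 1 else 0) := by
    intro i
    simp [Finset.sum_ite_eq']
  simp only [limitCov, add_apply, sum_apply, smul_apply, smul_eq_mul, pairCov_eulerVec hz,
    pointCov_eulerVec hz, h2]
  simp only [← Finset.mul_sum]
  rw [h1, Finset.sum_boole, Finset.filter_univ_mem, hcard]
  push_cast
  ring

theorem contr_limitForm_mul (hz : Function.Injective z) (κ : ℂ) (a : j) (X : StratumForm k m z j) :
    contr a (oneForm (limitCov κ) * X) = -(oneForm (limitCov κ) * contr a X) := by
  funext p
  rw [contr_oneForm_mul_apply, limitCov_eulerVec hz, zero_smul, zero_sub]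
  rfl

/-- Since ω̃ vanishes on the Euler fields, it anticommutes with each contraction. -/
theorem limitForm_mul_contrs (hz : Function.Injective z) (κ : ℂ) (l : List j)
    (X : StratumForm k m z j) : oneForm (limitCov κ) * contrs l X
      = (-1 : ℂ) ^ l.length • contrs l (oneForm (limitCov κ) * X) := by
  induction l with
  | nil => simp [contrs_nil]
  | cons a l ih =>
    rw [contrs_cons, contrs_cons, ← neg_neg (oneForm _ * contr a _), ← contr_limitForm_mul hz, ih,
      map_smul, List.length_cons, pow_succ, mul_neg_one, neg_smul]

/-! ### The coordinates of `ω̃` at a free variable -/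

theorem edgeCov_single_of_ne {u v : Vertex k j} {f : Fin k} (hu : u ≠ Sum.inl f)
    (hv : v ≠ Sum.inl f) (p : StratumPoint k m z j) : edgeCov u v p (Pi.single f 1) = 0 := by
  have h : ∀ u : Vertex k j, u ≠ Sum.inl f → vdiff u (Pi.single f 1) = 0 := by
    rintro (i | s) hu
    · exact Pi.single_eq_of_ne (fun h => hu (by rw [h])) _
    · rfl
  rw [edgeCov, smul_apply, sub_apply, h u hu, h v hv, sub_zero, smul_zero]

theorem center_ne {I : j → Finset (Fin k)} {i f : Fin k} (h : i ≠ f) : center I i ≠ Sum.inl f := by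
  rcases hc : color I (Sum.inl i) with _ | a
  · rw [center_of_none hc]; exact fun h' => h (Sum.inl_injective h')
  · rw [center_of_some hc]; exact Sum.inr_ne_inl

theorem pairCov_single_of_ne {i l f : Fin k} (hi : i ≠ f) (hl : l ≠ f)
    (p : StratumPoint k m z j) : pairCov i l p (Pi.single f 1) = 0 := by
  unfold pairCov
  split_ifs
  · exact edgeCov_single_of_ne (fun h => hi (Sum.inl_injective h))
      (fun h => hl (Sum.inl_injective h)) p
  · exact edgeCov_single_of_ne (center_ne hi) (center_ne hl) p

theorem pointCov_single_of_ne {i f : Fin k} (hi : i ≠ f) (b : Fin n)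
    (p : StratumPoint k m z j) : pointCov i b p (Pi.single f 1) = 0 := by
  unfold pointCov
  split_ifs
  · exact edgeCov_single_of_ne (fun h => hi (Sum.inl_injective h)) Sum.inr_ne_inl p
  · exact edgeCov_single_of_ne (center_ne hi) Sum.inr_ne_inl p

open scoped Classical in
/-- The part of `ω̃` which contains the differential of a free variable. -/
def freeCov (κ : ℂ) (I : j → Finset (Fin k)) (f : Fin k) (p : StratumPoint k m z j) :
    Sp k →L[ℂ] ℂ :=
  (∑ l ∈ Finset.univ.filter fun l => color I (Sum.inl l) = none,
      (2 / κ) • edgeCov (Sum.inl f) (Sum.inl l) p)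
    + ∑ b, (-reflWeight m j b / κ) • edgeCov (Sum.inl f) (Sum.inr (Sum.inr b)) p

/-- The m_a + 1 coordinates of a block are all seen from the free variable at z_a. Their edges add
2(m_a + 1)/κ to the coefficient -m_a/κ, and the total (m_a + 2)/κ is -m^j_a/κ for the reflected
weight. -/
theorem limitCov_single (κ : ℂ) {I : j → Finset (Fin k)} {f : Fin k}
    (hf : color I (Sum.inl f) = none) (p : StratumPoint k m z j) (hp : p.I = I) :
    limitCov κ p (Pi.single f 1) = freeCov κ I f p (Pi.single f 1) := by
  classical
  subst hp
  set v : Sp k := Pi.single f 1 with hv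
  set E : Fin n → ℂ := fun b => edgeCov (Sum.inl f) (Sum.inr (Sum.inr b)) p v with hE
  -- Only pairs containing f contribute, and the sum over ordered pairs meets each of them twice.
  have hpair : ∑ i, ∑ l, pairCov i l p v = 2 * ∑ l, pairCov f l p v := by
    have h1 : ∀ i, i ≠ f → ∑ l, pairCov i l p v = pairCov f i p v := fun i hi => by
      rw [Finset.sum_eq_single f (fun l _ hl => pairCov_single_of_ne hi hl p) (by simp),
        pairCov_comm]
    rw [← Finset.add_sum_erase _ _ (Finset.mem_univ f),
      Finset.sum_congr rfl fun i hi => h1 i (Finset.ne_of_mem_erase hi), two_mul]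
    congr 1
    refine Finset.sum_erase _ ?_
    rw [pairCov_self]
    rfl
  have hfree : ∀ l, color p.I (Sum.inl l) = none →
      pairCov f l p = edgeCov (Sum.inl f) (Sum.inl l) p := fun l hl => by
    rw [pairCov, if_pos (hf.trans hl.symm)]
  have hblock : ∀ (l : Fin k) (a : j), color p.I (Sum.inl l) = some a → pairCov f l p v = E a :=
    fun l a hl => by
      rw [pairCov, if_neg (by rw [hf, hl]; simp), center_of_none hf, center_of_some hl]
  have hsum : ∑ l, pairCov f l p v
      = ∑ l ∈ Finset.univ.filter (fun l => color p.I (Sum.inl l) = none),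
          edgeCov (Sum.inl f) (Sum.inl l) p v + ∑ a : j, ((m a : ℂ) + 1) * E a := by
    have h0 := Finset.sum_fiberwise (s := Finset.univ) (fun l : Fin k => color p.I (Sum.inl l))
      (fun l => pairCov f l p v)
    rw [← h0, Fintype.sum_option]
    congr 1
    · refine Finset.sum_congr rfl fun l hl => ?_
      rw [hfree l (Finset.mem_filter.1 hl).2]
    · refine Finset.sum_congr rfl fun a _ => ?_
      rw [Finset.sum_congr rfl fun l hl => hblock l a (Finset.mem_filter.1 hl).2,
        Finset.sum_const, nsmul_eq_mul]
      congr 1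
      have : (Finset.univ.filter fun l => color p.I (Sum.inl l) = some a) = p.I a := by
        ext l; simp [color_inl_eq_some (show DisjointI p.I from p.disjoint_I)]
      rw [this, p.card_I]
      push_cast
      rfl
  have hpoint : ∀ b, pointCov f b p v = E b := fun b => by
    rw [pointCov_of_ne (fun a ha => by rw [hf] at ha; simp at ha), center_of_none hf]
  have hpoints : ∑ i, ∑ b, (-(m b : ℂ) / κ) * pointCov i b p v
      = ∑ b, (-(m b : ℂ) / κ) * E b := by
    rw [Finset.sum_eq_single f (fun i _ hi => Finset.sum_eq_zero fun b _ => by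
      rw [pointCov_single_of_ne hi, mul_zero]) (by simp)]
    exact Finset.sum_congr rfl fun b _ => by rw [hpoint]
  have hj : ∑ a : j, ((m a : ℂ) + 1) * E a = ∑ b, if b ∈ j then ((m b : ℂ) + 1) * E b else 0 := by
    rw [Finset.sum_coe_sort j fun b => ((m b : ℂ) + 1) * E b, Finset.sum_ite_mem, Finset.univ_inter]
  simp only [limitCov, freeCov, add_apply, sum_apply, smul_apply, smul_eq_mul]
  rw [hpoints]
  simp only [← Finset.mul_sum]
  rw [hpair, hsum, hj, mul_add, mul_add, add_assoc]
  congr 1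
  · ring
  · rw [Finset.mul_sum, Finset.mul_sum, ← Finset.sum_add_distrib]
    refine Finset.sum_congr rfl fun b _ => ?_
    rw [reflWeight]
    split_ifs <;> ring

/-! ### The differential on the basic forms -/

theorem disjointI_blocksOf (lam : Fin k → Option (j ⊕ Fin n)) : DisjointI (blocksOf lam) := by
  intro a b hab
  rw [Finset.disjoint_left]
  intro i hi hl
  rw [mem_blocksOf] at hi hl
  rw [hi] at hl
  exact hab (Sum.inl_injective (Option.some_inj.1 hl))

theorem color_blocksOf_eq_none {lam : Fin k → Option (j ⊕ Fin n)} {i : Fin k}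
    (h : ∀ a, lam i ≠ some (Sum.inl a)) : color (blocksOf lam) (Sum.inl i) = none :=
  color_inl_eq_none.2 fun a ha => h a (mem_blocksOf.1 ha)

/-- Arnold's relation for the triangle of z_b, f and l writes the product with the edge from f to
z_b as a difference of two terms. The exchange of f and l carries one to the other, so under
skew-symmetrization they add up. -/
theorem skewHom_edge_mul_mono (hz : Function.Injective z) {lam : Fin k → Option (j ⊕ Fin n)}
    {f l : Fin k} {b : Fin n} (hf : lam f = none) (hl : lam l = some (Sum.inr b)) :
    (2 : ℂ) • skewHom (edge (Sum.inl f) (Sum.inl l) * mono m z lam)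
      = skewHom (edge (Sum.inl f) (Sum.inr (Sum.inr b)) * mono m z lam) := by
  set v : Vertex k j := Sum.inr (Sum.inr b) with hv
  have hfl : f ≠ l := fun h => by rw [h, hl] at hf; simp at hf
  have hI := disjointI_blocksOf lam
  set I := blocksOf lam with hIdef
  have cf : color I (Sum.inl f) = none := color_blocksOf_eq_none fun a => by rw [hf]; simp
  have cl : color I (Sum.inl l) = none := color_blocksOf_eq_none fun a => by rw [hl]; simp
  have hmem : (l, v) ∈ listOf lam := mem_listOf.2 ⟨_, hl, rfl⟩
  obtain ⟨L', hperm⟩ : ∃ L', (listOf lam).Perm ((l, v) :: L') := by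
    obtain ⟨s, t, h⟩ := List.append_of_mem hmem
    exact ⟨s ++ t, h ▸ List.perm_middle⟩
  have hsub : ∀ e ∈ L', e ∈ listOf lam := fun e he => hperm.mem_iff.2 (List.mem_cons_of_mem _ he)
  have hnd : ((listOf lam).map Prod.fst).Nodup := by
    rw [listOf_map_fst]; exact (List.nodup_finRange k).filter _
  have hl' : l ∉ L'.map Prod.fst := by
    have := (hperm.map Prod.fst).nodup_iff.1 hnd
    rw [List.map_cons, List.nodup_cons] at this
    exact this.1
  have hf' : f ∉ L'.map Prod.fst := fun h => by
    obtain ⟨e, he, hef⟩ := List.mem_map.1 h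
    obtain ⟨s, hs, -⟩ := mem_listOf.1 (hsub e he)
    rw [hef, hf] at hs
    simp at hs
  have hτ : permHom (Equiv.swap f l) (monL (m := m) (z := z) L') = monL L' := by
    rw [permHom_monL]
    congr 1
    refine (List.map_congr_left fun e he => ?_).trans (List.map_id _)
    obtain ⟨s, -, hs⟩ := mem_listOf.1 (hsub e he)
    refine Prod.ext ?_ ?_
    · refine Equiv.swap_apply_of_ne_of_ne (fun h => hf' ?_) fun h => hl' ?_
      · rw [← h]; exact List.mem_map_of_mem he
      · rw [← h]; exact List.mem_map_of_mem he
    · change vperm _ e.2 = e.2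
      rw [hs, vperm_inr]
  obtain ⟨ε, hε⟩ : ∃ ε : ℂ, monL (m := m) (z := z) (listOf lam)
      = ε • (edge (Sum.inl l) v * monL L') := by
    rcases monL_perm (m := m) (z := z) hperm with h | h
    · exact ⟨1, by rw [h, monL_cons, one_smul]⟩
    · exact ⟨-1, by rw [h, monL_cons, neg_one_smul]⟩
  set M : StratumForm k m z j := monL L' with hM
  have hX : ∀ e : StratumForm k m z j, skewHom (e * mono m z lam)
      = ε • skewHom (chi I * (e * (edge (Sum.inl l) v * M))) := fun e => by
    rw [mono, mul_chi_mul, hε, mul_smul_comm, mul_smul_comm, map_smul]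
  rw [hX, hX, smul_comm]
  congr 1
  have hA : chi I * (edge (Sum.inl f) v * (edge (Sum.inl l) v * M))
      = chi I * (edge (Sum.inl f) (Sum.inl l) * (edge (Sum.inl l) v * M))
        - chi I * (edge (Sum.inl f) (Sum.inl l) * (edge (Sum.inl f) v * M)) := by
    have h := arnold (m := m) hz I (v := v) (x := Sum.inl f) (y := Sum.inl l) Sum.inr_ne_inl
      Sum.inr_ne_inl (fun h => hfl (Sum.inl_injective h)) cf.symm cl.symm
    have h' := congr_arg (· * M) h
    simp only [mul_assoc, sub_mul, mul_sub] at h'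
    rwa [edge_comm v (Sum.inl f), edge_comm v (Sum.inl l)] at h'
  have hswap : permHom (Equiv.swap f l)
      (chi I * (edge (Sum.inl f) (Sum.inl l) * (edge (Sum.inl l) v * M)))
        = chi I * (edge (Sum.inl f) (Sum.inl l) * (edge (Sum.inl f) v * M)) := by
    rw [map_mul, map_mul, map_mul, permHom_chi, mapI_swap hI (cf.trans cl.symm), permHom_edge,
      permHom_edge, hτ, vperm_inl, vperm_inl, Equiv.swap_apply_left, Equiv.swap_apply_right, hv,
      vperm_inr, edge_comm (Sum.inl l) (Sum.inl f)]
  rw [hA, map_sub, ← hswap, skewHom_permHom, csign_swap hfl, neg_one_smul, sub_neg_eq_add,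
    two_smul]

/-- Only the component of ω̃ at the unlabeled last coordinate survives. Each of the K_b coordinates
attached to z_b gives 1/κ by `skewHom_edge_mul_mono`, and the direct edge to z_b gives minus the
reflected weight over κ. -/
theorem skewHom_limitForm_mul_mono {k : ℕ} (hz : Function.Injective z)
    (hjk : blockTotal m j ≤ k + 1) (κ : ℂ) {K : Fin n → ℕ} (hK : blockTotal m j + ∑ b, K b = k) :
    skewHom (oneForm (limitCov κ) * mono m z (baseLabel (k + 1) m j K))
      = ∑ b, (((K b : ℂ) - reflWeight m j b) / κ) •
        skewHom (edge (Sum.inl (Fin.last k)) (Sum.inr (Sum.inr b))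
          * mono m z (baseLabel (k + 1) m j K)) := by
  classical
  set lam := baseLabel (k + 1) m j K with hlam
  set f := Fin.last k with hf
  have hnone : ∀ i, lam i = none → i = f := fun i hi => by
    rcases Fin.eq_castSucc_or_eq_last i with ⟨l, rfl⟩ | h
    · exact absurd hi (baseLabel_castSucc_ne_none hjk hK l)
    · exact h
  have hlast : lam f = none := baseLabel_last hK
  have hcf : color (blocksOf lam) (Sum.inl f) = none :=
    color_blocksOf_eq_none fun a => by rw [hlast]; simp
  have h1 : oneForm (limitCov κ) * mono m z lam
      = oneForm (freeCov κ (blocksOf lam) f) * mono m z lam :=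
    oneForm_mul_mono_congr fun p hp i hi => by
      rw [hnone i hi, limitCov_single κ hcf p hp]
  have h2 : oneForm (m := m) (z := z) (freeCov κ (blocksOf lam) f)
      = (∑ l, if color (blocksOf lam) (Sum.inl l) = none then
          (2 / κ) • edge (Sum.inl f) (Sum.inl l) else 0)
        + ∑ b, (-reflWeight m j b / κ) • edge (Sum.inl f) (Sum.inr (Sum.inr b)) := by
    rw [← Finset.sum_filter]
    funext p
    simp only [oneForm, freeCov, map_add, map_sum, map_smul, Pi.add_apply, Finset.sum_apply,
      Pi.smul_apply, edge]
  set S : Fin n → StratumForm (k + 1) m z j := fun b =>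
    skewHom (edge (Sum.inl f) (Sum.inr (Sum.inr b)) * mono m z lam) with hS
  have h3 : ∀ l b, lam l = some (Sum.inr b) →
      skewHom ((if color (blocksOf lam) (Sum.inl l) = none then
        (2 / κ) • edge (Sum.inl f) (Sum.inl l) else 0) * mono m z lam) = (1 / κ) • S b := by
    intro l b hl
    rw [if_pos (color_blocksOf_eq_none fun a => by rw [hl]; simp), smul_mul_assoc, map_smul, hS]
    dsimp only
    rw [← skewHom_edge_mul_mono hz hlast hl, smul_smul]
    congr 1
    ring
  have h4 : ∑ l, skewHom ((if color (blocksOf lam) (Sum.inl l) = none then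
      (2 / κ) • edge (Sum.inl f) (Sum.inl l) else 0) * mono m z lam)
        = ∑ b, ((K b : ℂ) / κ) • S b := by
    -- The sum is grouped by the label of l. Block coordinates carry no edge to f, and the only
    -- unlabeled l is f itself, whose edge is zero.
    rw [← Finset.sum_fiberwise (s := Finset.univ) lam, Fintype.sum_option, Fintype.sum_sum_type]
    rw [Finset.sum_eq_zero, zero_add, Finset.sum_eq_zero, zero_add]
    · refine Finset.sum_congr rfl fun b _ => ?_
      rw [Finset.sum_congr rfl fun l hl => h3 l b (Finset.mem_filter.1 hl).2, Finset.sum_const,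
        ← Nat.cast_smul_eq_nsmul ℂ, smul_smul, mul_one_div]
      congr 3
      rw [← card_siteBlock (hK.trans_le (Nat.le_succ k)) b]
      congr 1
      ext i
      simp [hlam, baseLabel_eq_inr]
    · intro a _
      refine Finset.sum_eq_zero fun l hl => ?_
      rw [if_neg, zero_mul, map_zero]
      rw [color_inl_eq_none, not_forall]
      exact ⟨a, not_not.2 (mem_blocksOf.2 (Finset.mem_filter.1 hl).2)⟩
    · intro l hl
      rw [hnone l (Finset.mem_filter.1 hl).2, if_pos hcf]
      have h0 : edge (m := m) (z := z) (j := j) (Sum.inl f) (Sum.inl f) = 0 := by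
        funext p
        simp only [edge, oneForm, edgeCov_self, map_zero, Pi.zero_apply]
      rw [h0, smul_zero, zero_mul, map_zero]
  rw [h1, h2, add_mul, Finset.sum_mul, Finset.sum_mul, map_add, map_sum, map_sum, h4,
    ← Finset.sum_add_distrib]
  refine Finset.sum_congr rfl fun b _ => ?_
  rw [smul_mul_assoc, map_smul, ← add_smul]
  congr 1
  ring

theorem sum_add_single (K : Fin n → ℕ) (b : Fin n) :
    ∑ c, (K + Pi.single b 1 : Fin n → ℕ) c = (∑ c, K c) + 1 := by
  simp [Finset.sum_add_distrib]

/-- After the last coordinate receives the label b, the counts are those of K + 1_b. In degree k the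
passage to the base labeling costs no sign, so only the (-1)^k of `oneForm_mul_mono` is left. -/
theorem skewHom_edge_mul_mono_baseLabel {k : ℕ} (hjk : blockTotal m j ≤ k + 1) {K : Fin n → ℕ}
    (hK : blockTotal m j + ∑ b, K b = k) (b : Fin n) :
    skewHom (edge (Sum.inl (Fin.last k)) (Sum.inr (Sum.inr b))
        * mono m z (baseLabel (k + 1) m j K))
      = (-1 : ℂ) ^ k • skewHom (mono m z (baseLabel (k + 1) m j (K + Pi.single b 1))) := by
  classical
  have hK' : blockTotal m j + ∑ c, (K + Pi.single b 1 : Fin n → ℕ) c = k + 1 := by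
    rw [sum_add_single, ← add_assoc, hK]
  have hl := baseLabel_last (m := m) (j := j) hK
  have h := oneForm_mul_mono (m := m) (z := z) (baseLabel_castSucc_ne_none hjk hK) hl
    (some (Sum.inr b)) (by simp)
  have he : edge (m := m) (z := z) (j := j) (Sum.inl (Fin.last k)) (Sum.inr (Sum.inr b))
      = oneForm (optCov (some (Sum.inr b)) (Fin.last k)) := rfl
  obtain ⟨σ, hσ⟩ := exists_perm_comp_eq_option
    (Function.update (baseLabel (k + 1) m j K) (Fin.last k) (some (Sum.inr b)))
    (baseLabel (k + 1) m j (K + Pi.single b 1)) (by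
      rintro (a | c)
      · congr 1
        ext i
        by_cases hi : i = Fin.last k
        · subst hi
          simp only [Finset.mem_filter, Finset.mem_univ, true_and, Function.update_self]
          rw [baseLabel_eq_inl, ← baseLabel_eq_inl (K := K), hl]
          simp
        · simp only [Finset.mem_filter, Finset.mem_univ, true_and, Function.update_of_ne hi]
          rw [baseLabel_eq_inl, baseLabel_eq_inl]
      · have e1 : (Finset.univ.filter fun i =>
            baseLabel (k + 1) m j (K + Pi.single b 1) i = some (Sum.inr c)).card
              = (K + Pi.single b 1 : Fin n → ℕ) c := by
          rw [← card_siteBlock hK'.le c]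
          congr 1
          ext i
          simp [baseLabel_eq_inr]
        have e2 : (Finset.univ.filter fun i => baseLabel (k + 1) m j K i = some (Sum.inr c)).card
            = K c := by
          rw [← card_siteBlock (hK.trans_le (Nat.le_succ k)) c]
          congr 1
          ext i
          simp [baseLabel_eq_inr]
        rw [e1, Pi.add_apply, ← e2]
        by_cases hc : c = b
        · subst hc
          have hni : Fin.last k ∉ Finset.univ.filter fun i =>
              baseLabel (k + 1) m j K i = some (Sum.inr c) := by simp [hl]
          rw [Pi.single_eq_same, ← Finset.card_insert_of_notMem hni]
          congr 1
          ext i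
          by_cases hi : i = Fin.last k
          · subst hi; simp
          · simp [hi]
        · rw [Pi.single_eq_of_ne hc, add_zero]
          congr 1
          ext i
          by_cases hi : i = Fin.last k
          · subst hi; simp [hl, Ne.symm hc]
          · simp [Function.update_of_ne hi])
  rw [he, h, map_smul, ← skewHom_fullMono_comp _ σ, hσ,
    mono_eq_fullMono (baseLabel_ne_none (hjk) hK')]

/-! ### The matrix of the differential -/

variable (k m z j) in
/-- The iterated contraction of a skew-symmetrized monomial. -/
def contracted (K : Fin n → ℕ) : StratumForm k m z j :=
  contrs (blockList j) (skewHom (mono m z (baseLabel k m j K)))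

/-- The sign (-1)^p comes from moving ω̃ through the p contractions, and (-1)^k from moving the new
factor to the last place. -/
theorem omegaTilde_mul_contracted {k : ℕ} (hz : Function.Injective z)
    (hjk : blockTotal m j ≤ k + 1) (κ : ℂ) {K : Fin n → ℕ} (hK : blockTotal m j + ∑ b, K b = k) :
    omegaTilde m z j κ * contracted (k + 1) m z j K
      = ∑ b, ((-1 : ℂ) ^ j.card * (-1) ^ k * (((K b : ℂ) - reflWeight m j b) / κ)) •
        contracted (k + 1) m z j (K + Pi.single b 1) := by
  rw [omegaTilde_eq hz, contracted, limitForm_mul_contrs hz,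
    ← skewHom_mul_of_invariant (permHom_limitForm κ), skewHom_limitForm_mul_mono hz hjk κ hK,
    length_blockList, map_sum, Finset.smul_sum]
  refine Finset.sum_congr rfl fun b _ => ?_
  rw [skewHom_edge_mul_mono_baseLabel hjk hK, map_smul, map_smul, smul_smul, smul_smul, contracted]
  congr 1
  ring

theorem exists_omega_eq (hz : Function.Injective z) (hjk : blockTotal m j ≤ k) (κ : ℂ) :
    ∃ s : ℂ, s ≠ 0 ∧ ∀ K : Fin n → ℕ, blockTotal m j + ∑ c, K c ≤ k →
      omegaTop k m z j κ K = ((κ ^ k)⁻¹ * (alphaK m j K * s)) • contracted k m z j K ∧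
      omegaSub k m z j κ K = ((-1) ^ (k - j.card) * (κ ^ (k - 1))⁻¹ * (alphaK m j K * s)) •
        contracted k m z j K := by
  obtain ⟨s, hs, h⟩ := exists_baseForm_eq (m := m) hz hjk
  refine ⟨s, hs, fun K hK => ?_⟩
  rw [omegaTop, omegaSub, ← skewHom_apply, ← skewHom_apply, h K hK, smul_smul, smul_smul, map_smul,
    map_smul, contracted, contrs_skewHom]
  exact ⟨rfl, rfl⟩

theorem alphaK_ne_zero (K : Fin n → ℕ) : alphaK m j K ≠ 0 := by
  refine mul_ne_zero (pow_ne_zero _ (neg_ne_zero.2 one_ne_zero)) (inv_ne_zero (mul_ne_zero ?_ ?_))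
  · exact Finset.prod_ne_zero_iff.2 fun a _ => Nat.cast_ne_zero.2 (Nat.factorial_ne_zero _)
  · exact Finset.prod_ne_zero_iff.2 fun a _ => Nat.cast_ne_zero.2 (Nat.factorial_ne_zero _)

/-- The factorial of k_b in α_K is the source of the factor k_b + 1 in the action of f on the dual
basis. -/
theorem alphaK_eq (K : Fin n → ℕ) (b : Fin n) :
    alphaK m j K = ((K b : ℂ) + 1) * alphaK m j (K + Pi.single b 1) := by
  have h : ∏ a, (((K + Pi.single b 1 : Fin n → ℕ) a).factorial : ℂ)
      = ((K b : ℂ) + 1) * ∏ a, ((K a).factorial : ℂ) := by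
    rw [← Finset.mul_prod_erase _ _ (Finset.mem_univ b),
      ← Finset.mul_prod_erase _ (fun a => ((K a).factorial : ℂ)) (Finset.mem_univ b), ← mul_assoc]
    congr 1
    · rw [Pi.add_apply, Pi.single_eq_same, Nat.factorial_succ]
      push_cast
      rfl
    · refine Finset.prod_congr rfl fun a ha => ?_
      rw [Pi.add_apply, Pi.single_eq_of_ne (Finset.ne_of_mem_erase ha), add_zero]
  rw [alphaK, alphaK, h, mul_left_comm _ ((K b : ℂ) + 1), mul_inv_rev ((K b : ℂ) + 1)]
  have h0 : (K b : ℂ) + 1 ≠ 0 := Nat.cast_add_one_ne_zero _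
  field_simp

/-- The action of the differential on the forms `ω_K`. -/
theorem omegaTilde_mul_omegaSub (hz : Function.Injective z) (hk : 0 < k)
    (hjk : blockTotal m j ≤ k) (hcard : j.card ≤ k) (κ : ℂ) {K : Fin n → ℕ}
    (hK : blockTotal m j + ∑ b, K b + 1 = k) :
    omegaTilde m z j κ * omegaSub k m z j κ K
      = ∑ b, (((K b : ℂ) + 1) * (reflWeight m j b - K b)) •
        omegaTop k m z j κ (K + Pi.single b 1) := by
  obtain ⟨k, rfl⟩ := Nat.exists_eq_succ_of_ne_zero hk.ne'
  obtain ⟨s, -, hω⟩ := exists_omega_eq (m := m) hz hjk κ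
  rw [(hω K (by omega)).2, mul_smul_comm, omegaTilde_mul_contracted hz hjk κ (Nat.succ_injective hK),
    Finset.smul_sum]
  refine Finset.sum_congr rfl fun b _ => ?_
  rw [(hω (K + Pi.single b 1) (by rw [sum_add_single]; omega)).1, smul_smul, smul_smul,
    alphaK_eq K b]
  congr 1
  -- Here the original k is `k.succ`. The sign in the normalization of ω_K leaves a total of -1,
  -- which turns k_b - m^j_b into m^j_b - k_b.
  have hsign : (-1 : ℂ) ^ (k.succ - j.card) * (-1) ^ j.card * (-1) ^ k = -1 := by
    rw [← pow_add, Nat.sub_add_cancel hcard, pow_succ, mul_right_comm, ← mul_pow]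
    simp
  rw [Nat.succ_sub_one, Nat.succ_eq_add_one, pow_succ κ, mul_inv]
  linear_combination ((κ ^ k)⁻¹ * κ⁻¹ * ((K b : ℂ) + 1) * alphaK m j (K + Pi.single b 1) * s
    * ((K b : ℂ) - reflWeight m j b)) * hsign

/-! ### Bases of the spaces of skew-symmetric forms -/

/-- The number N is the degree before the p contractions. The family F rescales the contracted
forms, which span by `OSskew_le_span` and are independent for N = k and N = k - 1. The predicate P
allows the index types to be those of the weight spaces. -/
theorem exists_basis_OSskew (hz : Function.Injective z) (hjk : blockTotal m j ≤ k) {N q : ℕ}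
    (hNq : N = q + j.card) (hN : N = k ∨ N + 1 = k) {P : (Fin n → ℕ) → Prop}
    (hP : ∀ K, P K ↔ blockTotal m j + ∑ b, K b = N) (c : (Fin n → ℕ) → ℂ) (hc : ∀ K, c K ≠ 0)
    (F : (Fin n → ℕ) → StratumForm k m z j) (hF : ∀ K, P K → F K = c K • contracted k m z j K)
    (hmem : ∀ K, P K → F K ∈ OSskew k m z j q) :
    ∃ B : Module.Basis {K // P K} ℂ (OSskew k m z j q),
      ∀ K, (B K : StratumForm k m z j) = F K := by
  set v : {K // P K} → OSskew k m z j q := fun K => ⟨F K, hmem K K.2⟩ with hv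
  have hli : LinearIndependent ℂ v := by
    have h1 := (linearIndependent_contrs (m := m) hz hjk hN).comp
      (fun K : {K // P K} => (⟨K.1, (hP K.1).1 K.2⟩ :
        {K : Fin n → ℕ // blockTotal m j + ∑ b, K b = N}))
      (fun K K' h => Subtype.ext (Subtype.mk.inj h))
    have h2 := h1.units_smul fun K : {K // P K} => Units.mk0 (c K.1) (hc K.1)
    refine LinearIndependent.of_comp (OSskew k m z j q).subtype ?_
    convert h2 using 1
    funext K
    exact hF K K.2
  have hq : q + j.card ≤ k := by omega
  refine ⟨Module.Basis.mk hli ?_, fun K => by rw [Module.Basis.mk_apply]⟩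
  rintro η -
  have hle : Submodule.span ℂ {v : StratumForm k m z j | ∃ K : Fin n → ℕ,
      blockTotal m j + ∑ b, K b = q + j.card ∧
      v = contrs (blockList j) (skewHom (mono m z (baseLabel k m j K)))}
        ≤ (Submodule.span ℂ (Set.range v)).map (OSskew k m z j q).subtype := by
    rw [Submodule.span_le]
    rintro _ ⟨K, hK, rfl⟩
    have hPK := (hP K).2 (hK.trans hNq.symm)
    refine ⟨(c K)⁻¹ • v ⟨K, hPK⟩, Submodule.smul_mem _ _ (Submodule.subset_span ⟨_, rfl⟩), ?_⟩
    rw [map_smul]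
    change (c K)⁻¹ • F K = _
    rw [hF K hPK, smul_smul, inv_mul_cancel₀ (hc K), one_smul]
    rfl
  obtain ⟨η', hη', he⟩ := hle (OSskew_le_span hz hjk hq η.2)
  rwa [← Subtype.ext he]

theorem skew_smul_baseForm_mem (hjk : blockTotal m j ≤ k) {K : Fin n → ℕ} {q : ℕ}
    (hK : blockTotal m j + ∑ c, K c = q + j.card) (hq : q + j.card ≤ k) (r : ℂ) :
    skew (r • baseForm k m z j K) ∈ OSskew k m z j q := by
  rw [← skewHom_apply]
  exact skewHom_mem_OSskew (Submodule.smul_mem _ _ (baseForm_mem_OS hjk hK hq))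

/-- Every block has at least two elements, so 2p ≤ k with p > 0. Hence the subtractions in the
degrees k - p and k - p - 1 are not truncated. -/
theorem card_lt_of_blockTotal_le (hm : ∀ a, 0 < m a) (hj : j.Nonempty)
    (hjk : blockTotal m j ≤ k) : j.card < k := by
  have h1 : j.card • 2 ≤ blockTotal m j :=
    Finset.card_nsmul_le_sum _ _ _ fun a _ => Nat.succ_le_succ (hm a)
  have h2 := hj.card_pos
  rw [smul_eq_mul] at h1
  omega

/-- Reflection lowers the total weight by twice the number of the block coordinates; thus |m| - 2k
is the weight of φ^K with |K| = e. -/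
theorem sum_reflWeight : ∑ a, reflWeight m j a = (∑ a, (m a : ℂ)) - 2 * (blockTotal m j : ℂ) := by
  have h : ∀ a, reflWeight m j a = (m a : ℂ) - 2 * (if a ∈ j then ((m a : ℂ) + 1) else 0) := by
    intro a
    rw [reflWeight]
    split_ifs <;> ring
  rw [Finset.sum_congr rfl fun a _ => h a, Finset.sum_sub_distrib, ← Finset.mul_sum,
    Finset.sum_ite_mem, Finset.univ_inter, blockTotal]
  push_cast
  rfl

end Strata

/-! ### Weight spaces of the dual of a tensor product of Verma modules -/

namespace Sl2Module

variable {n : ℕ}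

/-- The vector `f^{k_1} v ⊗ ⋯ ⊗ f^{k_n} v`. -/
def vermaVector (K : Fin n → ℕ) : ⨂[ℂ] _i : Fin n, (ℕ →₀ ℂ) :=
  PiTensorProduct.tprod ℂ fun i => Finsupp.single (K i) (1 : ℂ)

theorem dual_ext {φ ψ : Module.Dual ℂ (⨂[ℂ] _i : Fin n, (ℕ →₀ ℂ))}
    (h : ∀ K, φ (vermaVector K) = ψ (vermaVector K)) : φ = ψ := by
  apply PiTensorProduct.ext
  refine Module.Basis.ext_multilinear (fun _ => Finsupp.basisSingleOne) fun K => ?_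
  simpa [vermaVector] using h K

theorem phiFunctional_vermaVector (K K' : Fin n → ℕ) :
    phiFunctional K (vermaVector K') = if K' = K then 1 else 0 := by
  rw [phiFunctional, vermaVector, PiTensorProduct.lift.tprod]
  simp only [MultilinearMap.compLinearMap_apply, MultilinearMap.mkPiAlgebra_apply,
    Finsupp.lapply_apply, Finsupp.single_apply]
  rw [Finset.prod_ite_zero]
  simp [funext_iff]

theorem h_vermaVector (w : Fin n → ℂ) (K : Fin n → ℕ) :
    (vermaTensor w).h (vermaVector K)
      = ((∑ i, w i) - 2 * ((∑ i, K i : ℕ) : ℂ)) • vermaVector K := by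
  have hsum : ((∑ i, w i) - 2 * ((∑ i, K i : ℕ) : ℂ)) = ∑ i, (w i - 2 * (K i : ℂ)) := by
    rw [Finset.sum_sub_distrib, ← Finset.mul_sum]; push_cast; rfl
  rw [hsum, Finset.sum_smul]
  simp only [vermaTensor, tensor, sumPlaces, LinearMap.sum_apply, vermaVector, atPlace_tprod]
  refine Finset.sum_congr rfl fun a _ => ?_
  have h1 : (verma (w a)).h (Finsupp.single (K a) 1)
      = (w a - 2 * K a) • Finsupp.single (K a) (1 : ℂ) := by
    simp [verma]
  rw [h1, MultilinearMap.map_update_smul, Function.update_eq_self_iff.2 rfl]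

/-- This is the transpose of e f^{q+1}v = (q + 1)(c - q) f^q v, applied at one tensor factor at a
time. -/
theorem phiFunctional_e (w : Fin n → ℂ) (K : Fin n → ℕ) :
    phiFunctional K ∘ₗ (vermaTensor w).e
      = ∑ b, (((K b : ℂ) + 1) * (w b - K b)) • phiFunctional (K + Pi.single b 1) := by
  have hcoord : ∀ (r : ℂ) (q : ℕ) (x : ℕ →₀ ℂ),
      (verma r).e x q = ((q : ℂ) + 1) * (r - q) * x (q + 1) := by
    intro r q x
    have : Finsupp.lapply q ∘ₗ (verma r).e
        = (((q : ℂ) + 1) * (r - q)) • Finsupp.lapply (R := ℂ) (q + 1) := by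
      refine Finsupp.lhom_ext' fun i => LinearMap.ext_ring ?_
      rcases i with _ | i
      · simp [verma]
      · by_cases hi : i = q
        · subst hi
          simp only [LinearMap.comp_apply, Finsupp.lsingle_apply, verma,
            Finsupp.linearCombination_single, one_smul, LinearMap.smul_apply, Finsupp.lapply_apply,
            Nat.add_sub_cancel, Finsupp.single_eq_same, smul_eq_mul]
          push_cast
          ring
        · simp [verma, hi]
    simpa using LinearMap.congr_fun this x
  apply PiTensorProduct.ext
  ext v
  simp only [LinearMap.compMultilinearMap_apply, LinearMap.comp_apply, LinearMap.smul_apply,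
    vermaTensor, tensor, sumPlaces, LinearMap.sum_apply, atPlace_tprod, map_sum, phiFunctional,
    PiTensorProduct.lift.tprod, MultilinearMap.compLinearMap_apply, MultilinearMap.mkPiAlgebra_apply,
    Finsupp.lapply_apply, smul_eq_mul]
  refine Finset.sum_congr rfl fun a _ => ?_
  have he : ∏ i, v i ((K + Pi.single a 1 : Fin n → ℕ) i)
      = v a ((K + Pi.single a 1 : Fin n → ℕ) a)
        * ∏ i ∈ Finset.univ.erase a, v i ((K + Pi.single a 1 : Fin n → ℕ) i) :=
    (Finset.mul_prod_erase _ _ (Finset.mem_univ a)).symm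
  refine Eq.trans ?_ (congr_arg (fun t => ((K a : ℂ) + 1) * (w a - K a) * t) he).symm
  rw [← Finset.mul_prod_erase _ _ (Finset.mem_univ a), ← mul_assoc, Function.update_self, hcoord,
    Pi.add_apply, Pi.single_eq_same]
  congr 1
  refine Finset.prod_congr rfl fun i hi => ?_
  rw [Function.update_of_ne (Finset.ne_of_mem_erase hi), Pi.add_apply,
    Pi.single_eq_of_ne (Finset.ne_of_mem_erase hi), add_zero]

theorem f_phi (w : Fin n → ℂ) (K : Fin n → ℕ) :
    (vermaTensorDual w).f (phi w K)
      = ∑ b, (((K b : ℂ) + 1) * (w b - K b)) • phi w (K + Pi.single b 1) := by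
  refine Subtype.ext ?_
  rw [← Submodule.subtype_apply (p := (vermaTensor w).restrictedDual) (∑ b, _), map_sum]
  exact phiFunctional_e w K

theorem sum_phiFunctional_apply {P : (Fin n → ℕ) → Prop} [DecidablePred P]
    (s : Finset {K // P K}) (g : {K // P K} → ℂ) {K : {K // P K}} (hK : K ∈ s) :
    (∑ K' ∈ s, g K' • phiFunctional K'.1) (vermaVector K.1) = g K := by
  rw [LinearMap.sum_apply, Finset.sum_eq_single_of_mem K hK]
  · rw [LinearMap.smul_apply, phiFunctional_vermaVector, if_pos rfl, smul_eq_mul, mul_one]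
  · intro K' _ hne
    rw [LinearMap.smul_apply, phiFunctional_vermaVector,
      if_neg fun h => hne (Subtype.ext h.symm), smul_zero]

theorem linearIndependent_phiFunctional (P : (Fin n → ℕ) → Prop) :
    LinearIndependent ℂ fun K : {K // P K} => phiFunctional K.1 := by
  classical
  refine linearIndependent_iff'.2 fun s g hg K hK => ?_
  rw [← sum_phiFunctional_apply s g hK, hg, LinearMap.zero_apply]

/-- An eigenfunctional of h vanishes on the basis vectors of every other weight, so it is determined
by its values on the finitely many basis vectors of its own weight. -/
theorem mem_span_phiFunctional (w : Fin n → ℂ) (c : ℂ) {P : (Fin n → ℕ) → Prop}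
    (hP : ∀ K, P K ↔ c = (∑ i, w i) - 2 * ((∑ i, K i : ℕ) : ℂ)) [Finite {K // P K}]
    {φ : Module.Dual ℂ (⨂[ℂ] _i : Fin n, (ℕ →₀ ℂ))} (hφ : φ ∘ₗ (vermaTensor w).h = c • φ) :
    φ ∈ Submodule.span ℂ (Set.range fun K : {K // P K} => phiFunctional K.1) := by
  classical
  have := Fintype.ofFinite {K // P K}
  have h0 : ∀ K, ¬P K → φ (vermaVector K) = 0 := by
    intro K hK
    have h2 := LinearMap.congr_fun hφ (vermaVector K)
    rw [LinearMap.comp_apply, h_vermaVector, map_smul, LinearMap.smul_apply, ← sub_eq_zero,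
      ← sub_smul] at h2
    exact (smul_eq_zero.1 h2).resolve_left fun h => hK ((hP K).2 (sub_eq_zero.1 h).symm)
  have hsum : φ = ∑ K : {K // P K}, φ (vermaVector K.1) • phiFunctional K.1 := by
    refine dual_ext fun K => ?_
    by_cases h : P K
    · exact (sum_phiFunctional_apply Finset.univ (fun K : {K // P K} => φ (vermaVector K.1))
        (K := ⟨K, h⟩) (Finset.mem_univ _)).symm
    · rw [h0 K h, LinearMap.sum_apply]
      refine (Finset.sum_eq_zero fun K' _ => ?_).symm
      rw [LinearMap.smul_apply, phiFunctional_vermaVector,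
        if_neg fun h' : K = K'.1 => h (by rw [h']; exact K'.2), smul_zero]
  rw [hsum]
  exact Submodule.sum_mem _ fun K _ => Submodule.smul_mem _ _ (Submodule.subset_span ⟨K, rfl⟩)

theorem exists_basis_weightSpace (w : Fin n → ℂ) (c : ℂ) {P : (Fin n → ℕ) → Prop}
    (hP : ∀ K, P K ↔ c = (∑ i, w i) - 2 * ((∑ i, K i : ℕ) : ℂ)) [Finite {K // P K}] :
    ∃ B : Module.Basis {K // P K} ℂ ((vermaTensorDual w).weightSpace c),
      ∀ K, (B K : (vermaTensor w).restrictedDual) = phi w K := by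
  set v : {K // P K} → (vermaTensorDual w).weightSpace c :=
    fun K => ⟨phi w K, phi_mem_weightSpace w K c ((hP K).1 K.2)⟩ with hv
  set val : (vermaTensorDual w).weightSpace c →ₗ[ℂ] Module.Dual ℂ (⨂[ℂ] _i : Fin n, (ℕ →₀ ℂ)) :=
    (vermaTensor w).restrictedDual.subtype ∘ₗ ((vermaTensorDual w).weightSpace c).subtype with hval
  have hinj : Function.Injective val :=
    (Submodule.injective_subtype _).comp (Submodule.injective_subtype _)
  have hli : LinearIndependent ℂ v :=
    LinearIndependent.of_comp val (linearIndependent_phiFunctional P)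
  refine ⟨Module.Basis.mk hli ?_, fun K => by rw [Module.Basis.mk_apply]⟩
  rintro φ -
  have h1 : (vermaTensorDual w).h φ.1 = c • φ.1 := φ.2
  have h2 := mem_span_phiFunctional w c hP (congr_arg Subtype.val h1)
  have hle : Submodule.span ℂ (Set.range fun K : {K // P K} => phiFunctional K.1)
      ≤ (Submodule.span ℂ (Set.range v)).map val := by
    rw [Submodule.span_le]
    rintro _ ⟨K, rfl⟩
    exact ⟨v K, Submodule.subset_span ⟨K, rfl⟩, rfl⟩
  obtain ⟨φ', hφ', he⟩ := hle h2
  rwa [← hinj he]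

/-- The isomorphism `ℂ → 𝔫₋` which sends `1` to `f`. -/
def nMinusEquiv : ℂ ≃ₗ[ℂ] nMinus :=
  LinearEquiv.toSpanNonzeroSingleton ℂ (Matrix (Fin 2) (Fin 2) ℂ) matF fun h => by
    have := congr_fun (congr_fun h 1) 0
    simp [matF] at this

theorem nMinusEquiv_one : nMinusEquiv 1 = nMinusF := Subtype.ext (one_smul ℂ matF)

/-- Tensor multiplication by the basis element `f` of `𝔫₋`. -/
def tensorF (W : Type*) [AddCommMonoid W] [Module ℂ W] : W ≃ₗ[ℂ] nMinus ⊗[ℂ] W :=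
  (TensorProduct.lid ℂ W).symm ≪≫ₗ TensorProduct.congr nMinusEquiv (LinearEquiv.refl ℂ W)

theorem tensorF_apply {W : Type*} [AddCommMonoid W] [Module ℂ W] (v : W) :
    tensorF W v = nMinusF ⊗ₜ[ℂ] v := by
  rw [tensorF, LinearEquiv.trans_apply, TensorProduct.lid_symm_apply, TensorProduct.congr_tmul,
    nMinusEquiv_one, LinearEquiv.refl_apply]

theorem nMinusMap_nMinusF {V : Type*} [AddCommGroup V] [Module ℂ V] (M : Sl2Module V) (c : ℂ)
    (v : M.weightSpace (c + 2)) : (nMinusMap M c (nMinusF ⊗ₜ[ℂ] v) : V) = M.f v := by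
  rw [nMinusMap, TensorProduct.lift.tmul]
  simp [act, nMinusF, matF]

theorem finite_sum_eq (N : ℕ) : Finite {K : Fin n → ℕ // ∑ a, K a = N} := by
  refine Set.Finite.to_subtype (s := {K : Fin n → ℕ | ∑ a, K a = N})
    ((Set.finite_Iic fun _ => N).subset ?_)
  intro K hK a
  exact (Finset.single_le_sum (fun _ _ => Nat.zero_le _) (Finset.mem_univ a)).trans_eq hK

end Sl2Module

/-! ### Comparison of linear maps through bases -/

section LinearAlgebra

/-- The formula on the basis also shows that T carries one space into the other; applied to exterior
multiplication by ω̃, it makes a separate proof that the Orlik-Solomon spaces are preserved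
unnecessary. -/
theorem exists_linearMap_of_basis {ι₀ ι₁ β U₀ U₁ X : Type*} [Fintype β] [AddCommGroup U₀]
    [Module ℂ U₀] [AddCommGroup U₁] [Module ℂ U₁] [AddCommGroup X] [Module ℂ X]
    (i₀ : U₀ →ₗ[ℂ] X) (i₁ : U₁ →ₗ[ℂ] X) (T : X →ₗ[ℂ] X) (B₀ : Module.Basis ι₀ ℂ U₀) (v : ι₁ → U₁)
    (coef : ι₀ → β → ℂ) (up : ι₀ → β → ι₁)
    (h : ∀ K, T (i₀ (B₀ K)) = ∑ b, coef K b • i₁ (v (up K b))) :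
    ∃ d : U₀ →ₗ[ℂ] U₁, (∀ η, i₁ (d η) = T (i₀ η)) ∧
      ∀ K, d (B₀ K) = ∑ b, coef K b • v (up K b) := by
  have hd : ∀ K, B₀.constr ℂ (fun K => ∑ b, coef K b • v (up K b)) (B₀ K)
      = ∑ b, coef K b • v (up K b) := fun K => B₀.constr_basis ℂ _ K
  refine ⟨B₀.constr ℂ fun K => ∑ b, coef K b • v (up K b), fun η => ?_, hd⟩
  refine LinearMap.congr_fun (f := i₁ ∘ₗ _) (g := T ∘ₗ i₀) (B₀.ext fun K => ?_) η
  rw [LinearMap.comp_apply, LinearMap.comp_apply, hd, h, map_sum]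
  exact Finset.sum_congr rfl fun b _ => map_smul _ _ _

/-- The two differentials have the same matrix `coef` in bases with the same index sets. -/
theorem Sl2Module.equiv_comm {ι₀ ι₁ β U₀ U₁ V : Type*} [Fintype β] [AddCommGroup U₀] [Module ℂ U₀]
    [AddCommGroup U₁] [Module ℂ U₁] [AddCommGroup V] [Module ℂ V] (M : Sl2Module V) (c : ℂ)
    (B₀ : Module.Basis ι₀ ℂ U₀) (B₁ : Module.Basis ι₁ ℂ U₁)
    (C₀ : Module.Basis ι₀ ℂ (M.weightSpace (c + 2))) (C₁ : Module.Basis ι₁ ℂ (M.weightSpace c))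
    (coef : ι₀ → β → ℂ) (up : ι₀ → β → ι₁) (d : U₀ →ₗ[ℂ] U₁)
    (hd : ∀ K, d (B₀ K) = ∑ b, coef K b • B₁ (up K b))
    (hf : ∀ K, M.f (C₀ K) = ∑ b, coef K b • (C₁ (up K b) : V)) (η : U₀) :
    B₁.equiv C₁ (Equiv.refl _) (d η)
      = M.nMinusMap c (tensorF _ (B₀.equiv C₀ (Equiv.refl _) η)) := by
  refine LinearMap.congr_fun (f := (B₁.equiv C₁ (Equiv.refl _)).toLinearMap ∘ₗ d)
    (g := M.nMinusMap c ∘ₗ (B₀.equiv C₀ (Equiv.refl _) ≪≫ₗ tensorF _).toLinearMap)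
    (B₀.ext fun K => Subtype.ext ?_) η
  rw [LinearMap.comp_apply, LinearMap.comp_apply, hd, LinearEquiv.coe_coe, LinearEquiv.coe_coe,
    LinearEquiv.trans_apply, Module.Basis.equiv_apply, tensorF_apply, nMinusMap_nMinusF,
    Equiv.refl_apply, hf, map_sum, Submodule.coe_sum]
  refine Finset.sum_congr rfl fun b _ => ?_
  rw [map_smul, Submodule.coe_smul, Module.Basis.equiv_apply, Equiv.refl_apply]

end LinearAlgebra

/-! ### Bases of both complexes and the isomorphism -/

namespace Strata

open Forms Sl2Module

variable {k n : ℕ} {m : Fin n → ℕ} {z : Fin n → ℂ} {j : Finset (Fin n)}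

theorem freeDim_add_blockTotal (hjk : blockTotal m j ≤ k) :
    freeDim k m j + blockTotal m j = k := Nat.sub_add_cancel hjk

/-- With the index condition |K| + 1 = e, rather than |K| = e - 1 with truncated subtraction, the
case e = 0 gives an empty basis and a zero first term. -/
theorem exists_basis_omegaSub (hz : Function.Injective z) (hjk : blockTotal m j ≤ k)
    (hcard : j.card < k) {κ : ℂ} (hκ : κ ≠ 0) :
    ∃ B : Module.Basis {K : Fin n → ℕ // (∑ a, K a) + 1 = freeDim k m j} ℂ
      (OSskew k m z j (k - j.card - 1)), ∀ K, (B K : StratumForm k m z j) = omegaSub k m z j κ K := by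
  have hfree := freeDim_add_blockTotal hjk
  obtain ⟨s, hs, hω⟩ := exists_omega_eq (m := m) hz hjk κ
  exact exists_basis_OSskew (m := m) hz hjk
    (show k - 1 = k - j.card - 1 + j.card by omega) (Or.inr (by omega)) (fun K => by omega)
    (fun K => (-1) ^ (k - j.card) * (κ ^ (k - 1))⁻¹ * (alphaK m j K * s))
    (fun K => mul_ne_zero (mul_ne_zero (pow_ne_zero _ (neg_ne_zero.2 one_ne_zero))
      (inv_ne_zero (pow_ne_zero _ hκ))) (mul_ne_zero (alphaK_ne_zero K) hs))
    (omegaSub k m z j κ) (fun K hK => (hω K (by omega)).2)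
    (fun K hK => skew_smul_baseForm_mem hjk (by omega) (by omega) _)

theorem exists_basis_omegaTop (hz : Function.Injective z) (hjk : blockTotal m j ≤ k)
    (hcard : j.card < k) {κ : ℂ} (hκ : κ ≠ 0) :
    ∃ B : Module.Basis {K : Fin n → ℕ // ∑ a, K a = freeDim k m j} ℂ
      (OSskew k m z j (k - j.card)), ∀ K, (B K : StratumForm k m z j) = omegaTop k m z j κ K := by
  have hfree := freeDim_add_blockTotal hjk
  obtain ⟨s, hs, hω⟩ := exists_omega_eq (m := m) hz hjk κ
  exact exists_basis_OSskew (m := m) hz hjk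
    (show k = k - j.card + j.card by omega) (Or.inl rfl) (fun K => by omega)
    (fun K => (κ ^ k)⁻¹ * (alphaK m j K * s))
    (fun K => mul_ne_zero (inv_ne_zero (pow_ne_zero _ hκ)) (mul_ne_zero (alphaK_ne_zero K) hs))
    (omegaTop k m z j κ) (fun K hK => (hω K (by omega)).1)
    (fun K hK => skew_smul_baseForm_mem hjk (by omega) (by omega) _)

theorem cast_eq_freeDim_add (hjk : blockTotal m j ≤ k) :
    (k : ℂ) = (freeDim k m j : ℂ) + blockTotal m j := by
  rw [← Nat.cast_add, freeDim_add_blockTotal hjk]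

/-- By `sum_reflWeight`, φ^K has the weight |m| - 2s - 2|K|, which equals |m| - 2k + 2 exactly when
|K| + 1 = k - s. -/
theorem exists_basis_weightSpace_sub (hjk : blockTotal m j ≤ k) :
    ∃ C : Module.Basis {K : Fin n → ℕ // (∑ a, K a) + 1 = freeDim k m j} ℂ
      ((vermaTensorDual (reflWeight m j)).weightSpace (((∑ a, (m a : ℂ)) - 2 * k) + 2)),
      ∀ K, (C K : (vermaTensor (reflWeight m j)).restrictedDual) = phi (reflWeight m j) K := by
  have : Finite {K : Fin n → ℕ // (∑ a, K a) + 1 = freeDim k m j} :=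
    have := finite_sum_eq (n := n) (freeDim k m j - 1)
    Finite.of_injective (fun K : {K : Fin n → ℕ // (∑ a, K a) + 1 = freeDim k m j} =>
      (⟨K.1, by have := K.2; omega⟩ : {K : Fin n → ℕ // ∑ a, K a = freeDim k m j - 1}))
      fun K K' h => Subtype.ext (Subtype.mk.inj h)
  refine exists_basis_weightSpace (reflWeight m j) _ fun K => ?_
  rw [sum_reflWeight, cast_eq_freeDim_add hjk, ← Nat.cast_inj (R := ℂ), Nat.cast_add, Nat.cast_one]
  constructor <;> intro h
  · linear_combination 2 * h
  · linear_combination h / 2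

theorem exists_basis_weightSpace_top (hjk : blockTotal m j ≤ k) :
    ∃ C : Module.Basis {K : Fin n → ℕ // ∑ a, K a = freeDim k m j} ℂ
      ((vermaTensorDual (reflWeight m j)).weightSpace ((∑ a, (m a : ℂ)) - 2 * k)),
      ∀ K, (C K : (vermaTensor (reflWeight m j)).restrictedDual) = phi (reflWeight m j) K := by
  have := finite_sum_eq (n := n) (freeDim k m j)
  refine exists_basis_weightSpace (reflWeight m j) _ fun K => ?_
  rw [sum_reflWeight, cast_eq_freeDim_add hjk, ← Nat.cast_inj (R := ℂ)]
  constructor <;> intro h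
  · linear_combination 2 * h
  · linear_combination h / 2

end Strata

end

open Sl2Module Strata in
theorem lemma6 (n k n₀ : ℕ) (hk : 0 < k) (hn₀ : n₀ ≤ n)
    (m : Fin n → ℕ) (hm : ∀ a, 0 < m a)
    (hm_small : ∀ a : Fin n, a.val < n₀ → m a ≤ k - 1)
    (hm_large : ∀ a : Fin n, n₀ ≤ a.val → k - 1 < m a)
    (z : Fin n → ℂ) (hz : Function.Injective z)
    (κ : ℂ) (hκ : κ ≠ 0)
    (j : Finset (Fin n)) (hj : j.Nonempty) (hj₀ : ∀ a ∈ j, a.val < n₀)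
    (hjk : blockTotal m j ≤ k) :
    -- `ω̃_a` is well defined on the strata
    (∀ p : StratumPoint k m z j,
      Filter.Tendsto (fun s => Forms.pullCov (blowDown z p.I s) (Forms.omegaA m z κ) p.x)
        (offDivisors j) (𝓝 (omegaTildeCov κ p))) ∧
    -- the complex, with the differential `η ↦ ω̃_a ∧ η`
    ∃ d : OSskew k m z j (k - j.card - 1) →ₗ[ℂ] OSskew k m z j (k - j.card),
      (∀ η, (d η : StratumForm k m z j) = omegaTilde m z j κ * (η : StratumForm k m z j)) ∧
      -- the forms `ω_K` are bases of its two terms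
      ∃ (B₀ : Module.Basis {K : Fin n → ℕ // (∑ a, K a) + 1 = freeDim k m j} ℂ
            (OSskew k m z j (k - j.card - 1)))
        (B₁ : Module.Basis {K : Fin n → ℕ // ∑ a, K a = freeDim k m j} ℂ
            (OSskew k m z j (k - j.card))),
        (∀ K, (B₀ K : StratumForm k m z j) = omegaSub k m z j κ K) ∧
        (∀ K, (B₁ K : StratumForm k m z j) = omegaTop k m z j κ K) ∧
        -- the isomorphism of complexes
        ∃ (Φ₀ : OSskew k m z j (k - j.card - 1) ≃ₗ[ℂ]
              nMinus ⊗[ℂ] (vermaTensorDual (reflWeight m j)).weightSpace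
                (((∑ a, (m a : ℂ)) - 2 * k) + 2))
          (Φ₁ : OSskew k m z j (k - j.card) ≃ₗ[ℂ]
              (vermaTensorDual (reflWeight m j)).weightSpace ((∑ a, (m a : ℂ)) - 2 * k)),
          (∀ η, Φ₁ (d η) = nMinusMap (vermaTensorDual (reflWeight m j))
            ((∑ a, (m a : ℂ)) - 2 * k) (Φ₀ η)) ∧
          (∀ K, ∃ v : (vermaTensorDual (reflWeight m j)).weightSpace
                (((∑ a, (m a : ℂ)) - 2 * k) + 2),
            (v : (vermaTensor (reflWeight m j)).restrictedDual) = phi (reflWeight m j) K.1 ∧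
            Φ₀ (B₀ K) = nMinusF ⊗ₜ[ℂ] v) ∧
          (∀ K, (Φ₁ (B₁ K) : (vermaTensor (reflWeight m j)).restrictedDual)
            = phi (reflWeight m j) K.1) := by
  have hcard : j.card < k := card_lt_of_blockTotal_le hm hj hjk
  have hfree := freeDim_add_blockTotal hjk
  obtain ⟨B₀, hB₀⟩ := exists_basis_omegaSub (m := m) hz hjk hcard hκ
  obtain ⟨B₁, hB₁⟩ := exists_basis_omegaTop (m := m) hz hjk hcard hκ
  obtain ⟨C₀, hC₀⟩ := exists_basis_weightSpace_sub (m := m) hjk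
  obtain ⟨C₁, hC₁⟩ := exists_basis_weightSpace_top (m := m) hjk
  -- The coefficients (k_b + 1)(m^j_b - k_b) and the shift of K to K + 1_b are those of `f_phi`, so
  -- the correspondence of the bases commutes with the differentials.
  obtain ⟨d, hd, hdB⟩ := exists_linearMap_of_basis
    (OSskew k m z j (k - j.card - 1)).subtype (OSskew k m z j (k - j.card)).subtype
    (LinearMap.mulLeft ℂ (omegaTilde m z j κ)) B₀ B₁
    (fun K b => ((K.1 b : ℂ) + 1) * (reflWeight m j b - K.1 b))
    (fun K b => ⟨K.1 + Pi.single b 1, (sum_add_single K.1 b).trans K.2⟩) (fun K => by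
      rw [LinearMap.mulLeft_apply, Submodule.subtype_apply, hB₀,
        omegaTilde_mul_omegaSub hz hk hjk hcard.le κ (by have := K.2; omega)]
      refine Finset.sum_congr rfl fun b _ => ?_
      rw [Submodule.subtype_apply, hB₁])
  refine ⟨fun p => ?_, d, hd, B₀, B₁, hB₀, hB₁, B₀.equiv C₀ (Equiv.refl _) ≪≫ₗ tensorF _,
    B₁.equiv C₁ (Equiv.refl _), ?_, fun K => ⟨C₀ K, hC₀ K, ?_⟩, fun K => ?_⟩
  · rw [omegaTildeCov_eq hz]
    exact tendsto_limitCov hz κ p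
  · refine equiv_comm _ _ B₀ B₁ C₀ C₁ _ _ d hdB fun K => ?_
    rw [hC₀, f_phi]
    refine Finset.sum_congr rfl fun b _ => ?_
    rw [hC₁]
  · rw [LinearEquiv.trans_apply, Module.Basis.equiv_apply, tensorF_apply, Equiv.refl_apply]
  · rw [Module.Basis.equiv_apply, Equiv.refl_apply, hC₁]
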